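/- **Abstraction Theorem.** Let $\mathit{Loc}$ be a countably infinite set of locations. *Language.* Types are $\tau ::= \mathsf{com}\mid \mathsf{val}\to\tau\mid\tau\to\tau$; expressions $E ::= i\mid 0\mid 1\mid -1\mid E+E\mid E-E$ over stack variables $i$; terms $M ::= x\mid \lambda i.M\mid M\,E\mid\lambda x{:}\tau.M\mid M\,M\mid \mathsf{fix}\,M\mid \mathsf{if}\,(E{=}E)\,\mathsf{then}\,M\,\mathsf{else}\,M\mid M;M\mid \mathsf{let}\,i{=}\mathsf{new}\,\mathsf{in}\,M\mid\mathsf{free}(E)\mid\mathsf{let}\,i{=}E.f\,\mathsf{in}\,M\mid E.f:=E$ with $f\in\{0,1\}$ over identifiers $x$, typed simply by $\Delta\mid\Gamma\vdash M:\tau$ ($\Delta$ a finite set of stack variables, $\Gamma$ a type environment for identifiers; conditionals and the last five forms and their bodies have type $\mathsf{com}$). Assertions are $P ::= E{=}E\mid E\le E\mid E\mapsto E,E\mid\mathsf{emp}\mid P*P\mid P\wedge P\mid\neg P\mid\exists i.P$; $\vee$ on assertions is the classical abbreviation and $-$ in a points-to assertion abbreviates an existentially quantified field. Specifications are $\varphi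 ::= \{P\}M\{Q\}\mid\varphi\otimes P\mid E{=}E\mid M{=}M\mid\varphi\wedge\varphi\mid\varphi\vee\varphi\mid\varphi\Rightarrow\varphi\mid\forall x{:}\tau.\varphi\mid\exists x{:}\tau.\varphi\mid\forall i.\varphi\mid\exists i.\varphi$. Syntax is taken up to renaming of bound variables. *Semantics of programs.* Let $\mathsf{perm}$ be the group of permutations of $\mathit{Loc}$ that move only finitely many locations. An FM-cpo is a partially ordered set with a monotone action of $\mathsf{perm}$ such that every element $a$ is supported by a finite set $L\subseteq\mathit{Loc}$ (every $\pi\in\mathsf{perm}$ fixing $L$ pointwise fixes $a$; the least such $L$ is $\mathsf{supp}(a)$) and every $\omega$-chain whose elements have a common finite supporting set has a least upper bound. $A\times B$ is the componentwise product and $A\to B$ is the set of functions that are finitely supported under conjugation and preserve least upper bounds of finitely supported chains, ordered pointwise. Put $\mathit{Val}=\mathit{Loc}+\mathbb Z+\{\mathit{default}\}$ and $\mathit{Heap}=\mathit{Loc}\rightharpoonup_{\mathrm{fin}}\mathit{Val}\times\mathit{Val}$ (both discretely ordered, with the evident actions), $O=\{\mathit{normal},\mathit{err}\}_\bot$ (flat,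 trivial action), $\mathit{Cont}=\mathit{Heap}\to O$, $[\![\mathsf{com}]\!]=\mathit{Heap}\times\mathit{Cont}\to O$, $[\![\mathsf{val}\to\tau]\!]=\mathit{Val}\to[\![\tau]\!]$, $[\![\sigma\to\tau]\!]=[\![\sigma]\!]\to[\![\tau]\!]$, $[\![\Delta]\!]=\prod_{i\in\Delta}\mathit{Val}$, $[\![\Gamma]\!]=\prod_{x:\tau\in\Gamma}[\![\tau]\!]$. In an expression, $+$ or $-$ applied to values that are not both integers gives $\mathit{default}$. The meaning $[\![M]\!]_{\rho,\eta}\in[\![\tau]\!]$ of a term is standard for variables, abstraction, application, $\mathsf{fix}$ (least fixed point) and the conditional; for commands, - $[\![M;N]\!]_{\rho,\eta}(h,k)=[\![M]\!]_{\rho,\eta}(h,\lambda h'.[\![N]\!]_{\rho,\eta}(h',k))$; - $[\![\mathsf{let}\,i{=}\mathsf{new}\,\mathsf{in}\,M]\!]_{\rho,\eta}(h,k)=[\![M]\!]_{\rho[i\to l],\eta}(h\bullet[l\to 0,0],k)$ for any $l\notin\mathsf{supp}(h,\rho,\eta,k)$ (the choice is immaterial); - $\mathsf{free}(E)$, $\mathsf{let}\,i{=}E.f\,\mathsf{in}\,M$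 and $E.f:=F$ yield $\mathit{err}$ if $[\![E]\!]_\rho\notin\mathsf{dom}(h)$; otherwise they respectively call $k$ on $h$ without the cell $[\![E]\!]_\rho$, run $M$ on $(h,k)$ with $i$ bound to the field $f$ of that cell, and call $k$ on $h$ with that field updated to $[\![F]\!]_\rho$. Assertions denote sets of heaps $[\![P]\!]_\rho$ in the standard way of separation logic ($E\mapsto E_0,E_1$ describes the heaps whose only cell is at $E$; $E\le F$ holds when both values are integers and are so ordered; quantifiers range over $\mathit{Val}$). *Worlds and satisfaction.* Let $\mathcal R$ be the set of finitely supported binary relations on $\mathit{Heap}$, let $h_0[r*s]h_1$ mean that there are splittings into disjoint heaps $h_0=n_0\bullet m_0$, $h_1=n_1\bullet m_1$ with $n_0[r]n_1$ and $m_0[s]m_1$, and for a set $D$ let $\mathsf{eq}(D)$ be the identity relation on $D$. Let $G=\{\mathit{normal},\bot\}$. For $c_0,c_1\in[\![\mathsf{com}]\!]$ and $r,s\in\mathcal R$, the semantic quadruple $\{r\}\,c_0,c_1\,\{s\}$ holds iff for all $r'\in\mathcal R$, $h_0,h_1\in\mathit{Heap}$ and $k_0,k_1\in\mathit{Cont}$: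 if $h_0[r*r']h_1$, and $k_0(g_0)[\mathsf{eq}(G)]k_1(g_1)$ whenever $g_0[s*r']g_1$, then $c_0(h_0,k_0)[\mathsf{eq}(G)]c_1(h_1,k_1)$. For $\rho\in[\![\Delta]\!]$, $\eta_0,\eta_1\in[\![\Gamma]\!]$ and $r\in\mathcal R$, define $(\rho,\eta_0,\eta_1,r)\models\varphi$ by: - $\{P\}M\{Q\}$: the quadruple $\{\mathsf{eq}([\![P]\!]_\rho)*r\}\;[\![M]\!]_{\rho,\eta_0},[\![M]\!]_{\rho,\eta_1}\;\{\mathsf{eq}([\![Q]\!]_\rho)*r\}$ holds; - $\varphi\otimes P$: $(\rho,\eta_0,\eta_1,r*\mathsf{eq}([\![P]\!]_\rho))\models\varphi$; - $E=F$: $[\![E]\!]_\rho=[\![F]\!]_\rho$; and $M=N$: $[\![M]\!]_{\rho,\eta_j}=[\![N]\!]_{\rho,\eta_j}$ for $j=0,1$; - $\varphi\Rightarrow\psi$: for all $s\in\mathcal R$, if $(\rho,\eta_0,\eta_1,r*s)\models\varphi$ then $(\rho,\eta_0,\eta_1,r*s)\models\psi$; - $\wedge,\vee$ as usual; $\forall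 i,\exists i$ range over $v\in\mathit{Val}$, with $\rho[i\to v]$; $\forall x{:}\tau,\exists x{:}\tau$ range over pairs $m,n\in[\![\tau]\!]$, with $\eta_0[x\to m]$ and $\eta_1[x\to n]$. *The logic.* Provability of $\Delta\mid\Gamma\vdash\varphi$ is derivability, without hypotheses, by the rules of many-sorted first-order intuitionistic logic with equality (falsity being $0=1$); the equations $\beta$, $\eta$, $\mathsf{fix}\,M=M(\mathsf{fix}\,M)$ and extensionality $(\forall i.M{=}N)\Rightarrow\lambda i.M=\lambda i.N$, $(\forall x{:}\sigma.M{=}N)\Rightarrow\lambda x{:}\sigma.M=\lambda x{:}\sigma.N$; and the following axioms. 1. Triples: $(\forall i.\{P\}M\{Q\})\Rightarrow\{\exists i.P\}M\{\exists i.Q\}$ if $i\notin\mathsf{fv}(M)$; $\{P\}M\{Q\}\wedge\{P'\}M\{Q'\}\Rightarrow\{P\vee P'\}M\{Q\vee Q'\}$; $\{P\wedge E{=}F\}M\{Q\}\wedge\{P\wedge E{\ne}F\}N\{Q\}\Rightarrow\{P\}\,\mathsf{if}\,(E{=}F)\,\mathsf{then}\,M\,\mathsf{else}\,N\,\{Q\}$;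 $\{P\}M\{P_0\}\wedge\{P_0\}N\{Q\}\Rightarrow\{P\}M;N\{Q\}$; $(\forall i.\{P*i\mapsto 0,0\}M\{Q\})\Rightarrow\{P\}\,\mathsf{let}\,i{=}\mathsf{new}\,\mathsf{in}\,M\,\{Q\}$ if $i\notin\mathsf{fv}(P,Q)$; $(\forall i.\{P*E\mapsto i,E_1\}M\{Q\})\Rightarrow\{\exists i.P*E\mapsto i,E_1\}\,\mathsf{let}\,i{=}E.0\,\mathsf{in}\,M\,\{Q\}$ if $i\notin\mathsf{fv}(E,Q)$; $\{E\mapsto-\}\,\mathsf{free}(E)\,\{\mathsf{emp}\}$; $\{E\mapsto-,E_1\}\,E.0:=F\,\{E\mapsto F,E_1\}$; the symmetric lookup and update axioms for the field $1$; and $\{P'\}M\{Q'\}\Rightarrow\{P\}M\{Q\}$ whenever $[\![P]\!]_\rho\subseteq[\![P']\!]_\rho$ and $[\![Q']\!]_\rho\subseteq[\![Q]\!]_\rho$ for all $\rho\in[\![\Delta]\!]$. 2. Invariant extension: $\varphi\Rightarrow\varphi\otimes P$; $\{P\}M\{P'\}\otimes Q\Leftrightarrow\{P*Q\}M\{P'*Q\}$;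 $(E{=}F)\otimes Q\Leftrightarrow E{=}F$; $(M{=}N)\otimes Q\Leftrightarrow M{=}N$; $(\varphi\otimes P)\otimes Q\Leftrightarrow\varphi\otimes(P*Q)$; $(\varphi\oplus\psi)\otimes P\Leftrightarrow(\varphi\otimes P)\oplus(\psi\otimes P)$ for $\oplus\in\{\Rightarrow,\wedge,\vee\}$; $(\kappa x{:}\tau.\varphi)\otimes P\Leftrightarrow\kappa x{:}\tau.(\varphi\otimes P)$ and, if $i\notin\mathsf{fv}(P)$, $(\kappa i.\varphi)\otimes P\Leftrightarrow\kappa i.(\varphi\otimes P)$, for $\kappa\in\{\forall,\exists\}$. 3. Fixed-point induction: $(\forall x.\,\gamma(x)\Rightarrow\gamma(M\,x))\Rightarrow\gamma(\mathsf{fix}\,M)$, with $x$ not free in $\gamma$ or $M$, for $\gamma ::= \{P\}C\{Q\}\mid\gamma\wedge\gamma\mid\forall x{:}\tau.\gamma\mid\forall i.\gamma$ and $C ::= [\,]\mid\lambda i.C\mid C\,E\mid\lambda x{:}\tau.C\mid C\,M\mid\mathsf{fix}\,C\mid C;M$, where $\gamma(N)$ is the capture-avoiding insertion of $N$ into the holes.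 **Claim.** If $\Delta\mid\Gamma\vdash\varphi$ is provable, then $(\rho,\eta_0,\eta_1,r)\models\varphi$ for all $\rho\in[\![\Delta]\!]$, $\eta_0,\eta_1\in[\![\Gamma]\!]$ and $r\in\mathcal R$. -/

import Mathlib

noncomputable section

namespace ParamSL

open MulAction

/-! ### FM-sets and FM-cpos over a set `Loc` of locations -/

/-- The group of permutations of `Loc` that move only finitely many locations. -/
def FinPerm (Loc : Type) : Subgroup (Equiv.Perm Loc) where
  carrier := {π | {l | π l ≠ l}.Finite}
  one_mem' := by simp
  mul_mem' := by
    intro a b ha hb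
    refine (Set.Finite.union ha hb).subset ?_
    intro l hl
    by_contra h
    simp only [Set.mem_union, Set.mem_ofPred_eq, not_or, not_not] at h
    exact hl (by simp [h.1, h.2])
  inv_mem' := by
    intro a ha
    refine Set.Finite.subset ha ?_
    intro l hl h
    apply hl
    rw [Equiv.Perm.inv_eq_iff_eq]
    exact h.symm

/-- `L` is a finite set of locations supporting `a`. -/
def FSupports {Loc A : Type} [MulAction (FinPerm Loc) A] (L : Finset Loc) (a : A) : Prop :=
  Supports (FinPerm Loc) (L : Set Loc) a

/-- A sequence is finitely supported when one finite set supports all its elements. -/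
def FSeq (Loc : Type) {A : Type} [MulAction (FinPerm Loc) A] (c : ℕ → A) : Prop :=
  ∃ L : Finset Loc, ∀ n, FSupports L (c n)

/-- The support of `a`: the smallest finite set of locations supporting `a`, obtained as the
intersection of all finite supporting sets. -/
def supp (Loc : Type) {A : Type} [MulAction (FinPerm Loc) A] (a : A) : Set Loc :=
  {l | ∀ L : Finset Loc, FSupports L a → l ∈ L}

/-- An FM-cpo: an FM-set with an equivariant partial order in which every finitely supported
`ω`-chain has a least upper bound. -/
structure FMCpo (Loc : Type) where
  carrier : Type
  order : PartialOrder carrier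
  action : MulAction (FinPerm Loc) carrier
  supported : ∀ a : carrier, ∃ L : Finset Loc, FSupports L a
  smul_le : ∀ (π : FinPerm Loc) (a b : carrier), a ≤ b → π • a ≤ π • b
  complete : ∀ c : ℕ → carrier, Monotone c → FSeq Loc c → ∃ a, IsLUB (Set.range c) a

instance (Loc : Type) : CoeSort (FMCpo Loc) Type := ⟨FMCpo.carrier⟩

attribute [instance] FMCpo.order FMCpo.action

variable {Loc : Type}

theorem FSupports.mono {A : Type} [MulAction (FinPerm Loc) A] {L L' : Finset Loc} {a : A}
    (h : FSupports L a) (hl : L ⊆ L') : FSupports L' a :=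
  Supports.mono (by exact_mod_cast hl) h

theorem smul_isLUB {X : FMCpo Loc} (π : FinPerm Loc) {c : ℕ → X} {a : X}
    (h : IsLUB (Set.range c) a) : IsLUB (Set.range fun n => π • c n) (π • a) := by
  constructor
  · rintro _ ⟨n, rfl⟩
    exact X.smul_le _ _ _ (h.1 ⟨n, rfl⟩)
  · intro u hu
    have : a ≤ π⁻¹ • u := h.2 (by
      rintro _ ⟨n, rfl⟩
      have := X.smul_le π⁻¹ _ _ (hu ⟨n, rfl⟩)
      simpa using this)
    have := X.smul_le π _ _ this
    simpa using this

theorem FSupports.lub {X : FMCpo Loc} {L : Finset Loc} {c : ℕ → X} {a : X}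
    (hc : ∀ n, FSupports L (c n)) (h : IsLUB (Set.range c) a) : FSupports L a := by
  intro π hπ
  have h1 := smul_isLUB π h
  have h2 : (fun n => π • c n) = c := funext fun n => hc n π hπ
  rw [h2] at h1
  exact h1.unique h

/-- Preservation of the least upper bounds of all finitely supported chains. -/
def FSContinuous {X Y : FMCpo Loc} (f : X → Y) : Prop :=
  ∀ (c : ℕ → X) (a : X), Monotone c → FSeq Loc c → IsLUB (Set.range c) a →
    IsLUB (Set.range fun n => f (c n)) (f a)

/-- `f` commutes with all permutations that fix `L` pointwise, that is, `L` supports `f` for the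
conjugation action on functions. -/
def FnSupports {X Y : FMCpo Loc} (L : Finset Loc) (f : X → Y) : Prop :=
  ∀ π : FinPerm Loc, (∀ l ∈ L, π • l = l) → ∀ x, f (π • x) = π • f x

theorem FSContinuous.monotone {X Y : FMCpo Loc} {f : X → Y} (hf : FSContinuous f) :
    Monotone f := by
  classical
  intro a b hab
  obtain ⟨L, hL⟩ := X.supported a
  obtain ⟨L', hL'⟩ := X.supported b
  have := hf (fun n => if n = 0 then a else b) b
    (by
      intro m n hmn
      by_cases h : n = 0
      · have : m = 0 := by omega
        simp [h, this]
      · by_cases h' : m = 0 <;> simp [h, h', hab])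
    ⟨L ∪ L', fun n => by
      by_cases h : n = 0
      · simpa [h] using hL.mono Finset.subset_union_left
      · simpa [h] using hL'.mono Finset.subset_union_right⟩
    ⟨by
      rintro _ ⟨n, rfl⟩
      by_cases h : n = 0 <;> simp [h, hab],
     fun u hu => by simpa using hu ⟨1, rfl⟩⟩
  simpa using this.1 ⟨0, rfl⟩

theorem FnSupports.apply {X Y : FMCpo Loc} {L L' : Finset Loc} {f : X → Y} {x : X}
    (hf : FnSupports L f) (hx : FSupports L' x) [DecidableEq Loc] : FSupports (L ∪ L') (f x) := by
  intro π hπ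
  rw [← hf π (fun l hl => hπ (by simp [hl])), hx π (fun l hl => hπ (by
    simp only [Finset.coe_union, Set.mem_union]; exact Or.inr hl))]

theorem FnSupports.fseq {X Y : FMCpo Loc} {L : Finset Loc} {f : X → Y} {c : ℕ → X}
    (hf : FnSupports L f) (hc : FSeq Loc c) : FSeq Loc fun n => f (c n) := by
  classical
  obtain ⟨L', h⟩ := hc
  exact ⟨L ∪ L', fun n => hf.apply (h n)⟩

/-- Elements of the exponential `X ⟹ Y` in the category of FM-cpos: finitely supported functions
that preserve least upper bounds of finitely supported chains. -/
@[ext]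
structure Fn (X Y : FMCpo Loc) where
  toFun : X → Y
  continuous : FSContinuous toFun
  supported : ∃ L : Finset Loc, FnSupports L toFun

instance {X Y : FMCpo Loc} : CoeFun (Fn X Y) (fun _ => X → Y) := ⟨Fn.toFun⟩

namespace Fn

variable {X Y Z : FMCpo Loc}

theorem monotone (f : Fn X Y) : Monotone f := f.continuous.monotone

instance : PartialOrder (Fn X Y) where
  le f g := ∀ x, f x ≤ g x
  le_refl f x := le_rfl
  le_trans f g h h1 h2 x := (h1 x).trans (h2 x)
  le_antisymm f g h1 h2 := Fn.ext (funext fun x => le_antisymm (h1 x) (h2 x))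

/-- The conjugation action of permutations on functions. -/
def smul (π : FinPerm Loc) (f : Fn X Y) : Fn X Y where
  toFun x := π • f (π⁻¹ • x)
  continuous := by
    intro c a hc ⟨L, hL⟩ ha
    classical
    obtain ⟨L', hL'⟩ := f.supported
    refine smul_isLUB π (f.continuous (fun n => π⁻¹ • c n) _ ?_ ?_ (smul_isLUB π⁻¹ ha))
    · exact fun m n h => X.smul_le _ _ _ (hc h)
    · refine ⟨L.image (fun l => π⁻¹ • l), fun n σ hσ => ?_⟩
      have := hL n (π * σ * π⁻¹) (by
        intro l hl
        have := hσ (a := π⁻¹ • l) (by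
          simp only [Finset.coe_image, Set.mem_image]; exact ⟨l, hl, rfl⟩)
        rw [mul_smul, mul_smul, this, smul_inv_smul])
      rw [mul_smul, mul_smul] at this
      rw [eq_inv_smul_iff]
      exact this
  supported := by
    classical
    obtain ⟨L, hL⟩ := f.supported
    refine ⟨L.image (fun l => π • l), fun σ hσ x => ?_⟩
    have := hL (π⁻¹ * σ * π) (by
      intro l hl
      have := hσ (π • l) (Finset.mem_image_of_mem _ hl)
      rw [mul_smul, mul_smul, this, inv_smul_smul]) (π⁻¹ • x)
    rw [mul_smul, mul_smul, smul_inv_smul] at this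
    change π • f (π⁻¹ • σ • x) = σ • (π • f (π⁻¹ • x))
    rw [this, mul_smul, mul_smul, smul_inv_smul]

instance : MulAction (FinPerm Loc) (Fn X Y) where
  smul := smul
  one_smul f := Fn.ext (funext fun x => by
    change (1 : FinPerm Loc) • f ((1 : FinPerm Loc)⁻¹ • x) = f x
    simp)
  mul_smul π σ f := Fn.ext (funext fun x => by
    change (π * σ) • f ((π * σ)⁻¹ • x) = π • (σ • f (σ⁻¹ • (π⁻¹ • x)))
    simp [mul_smul])

theorem smul_apply (π : FinPerm Loc) (f : Fn X Y) (x : X) : (π • f) x = π • f (π⁻¹ • x) := rfl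

theorem smul_apply_smul (π : FinPerm Loc) (f : Fn X Y) (x : X) :
    (π • f) (π • x) = π • f x := by
  rw [smul_apply, inv_smul_smul]

theorem fsupports_iff {L : Finset Loc} {f : Fn X Y} : FSupports L f ↔ FnSupports L f := by
  constructor
  · intro h π hπ x
    have : π • f = f := h π hπ
    rw [← smul_apply_smul, this]
  · intro h π hπ
    refine Fn.ext (funext fun x => ?_)
    change π • f (π⁻¹ • x) = f x
    rw [← h π hπ, smul_inv_smul]

/-- The pointwise least upper bound of a finitely supported chain of functions. -/
theorem exists_lub (c : ℕ → Fn X Y) (hc : Monotone c) (hs : FSeq Loc c) :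
    ∃ F : Fn X Y, ∀ x, IsLUB (Set.range fun n => c n x) (F x) := by
  classical
  obtain ⟨L, hL⟩ := hs
  have hL' : ∀ n, FnSupports L (c n) := fun n => fsupports_iff.1 (hL n)
  have hex : ∀ x, ∃ y, IsLUB (Set.range fun n => c n x) y := by
    intro x
    obtain ⟨L', hx⟩ := X.supported x
    exact Y.complete _ (fun m n h => hc h x) ⟨L ∪ L', fun n => (hL' n).apply hx⟩
  choose F hF using hex
  refine ⟨⟨F, ?_, L, ?_⟩, hF⟩
  · intro d a hd hds ha
    constructor
    · rintro _ ⟨m, rfl⟩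
      refine (hF (d m)).2 ?_
      rintro _ ⟨n, rfl⟩
      exact ((c n).monotone (ha.1 ⟨m, rfl⟩)).trans ((hF a).1 ⟨n, rfl⟩)
    · intro u hu
      refine (hF a).2 ?_
      rintro _ ⟨n, rfl⟩
      refine ((c n).continuous d a hd hds ha).2 ?_
      rintro _ ⟨m, rfl⟩
      exact ((hF (d m)).1 ⟨n, rfl⟩).trans (hu ⟨m, rfl⟩)
  · intro π hπ x
    have h1 := smul_isLUB π (hF x)
    have h2 : (fun n => π • c n x) = fun n => c n (π • x) :=
      funext fun n => (hL' n π hπ x).symm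
    rw [h2] at h1
    exact (hF (π • x)).unique h1

theorem isLUB_of_pointwise {c : ℕ → Fn X Y} {F : Fn X Y}
    (h : ∀ x, IsLUB (Set.range fun n => c n x) (F x)) : IsLUB (Set.range c) F := by
  constructor
  · rintro _ ⟨n, rfl⟩ x
    exact (h x).1 ⟨n, rfl⟩
  · intro u hu x
    refine (h x).2 ?_
    rintro _ ⟨n, rfl⟩
    exact hu ⟨n, rfl⟩ x

theorem isLUB_apply {c : ℕ → Fn X Y} {F : Fn X Y} (hc : Monotone c) (hs : FSeq Loc c)
    (h : IsLUB (Set.range c) F) (x : X) : IsLUB (Set.range fun n => c n x) (F x) := by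
  obtain ⟨G, hG⟩ := exists_lub c hc hs
  rw [h.unique (isLUB_of_pointwise hG)]
  exact hG x

end Fn

namespace FMCpo

/-- An FM-set with the discrete order. -/
@[reducible]
def discrete (A : Type) [MulAction (FinPerm Loc) A]
    (h : ∀ a : A, ∃ L : Finset Loc, FSupports L a) : FMCpo Loc where
  carrier := A
  order :=
    { le := fun a b => a = b
      le_refl := fun _ => rfl
      le_trans := fun _ _ _ => Eq.trans
      le_antisymm := fun _ _ h _ => h }
  action := inferInstance
  supported := h
  smul_le := fun π _ _ h => congrArg (π • ·) h
  complete := fun c hc _ => ⟨c 0, by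
    constructor
    · rintro _ ⟨n, rfl⟩
      exact (hc (Nat.zero_le n)).symm
    · intro u hu
      exact hu ⟨0, rfl⟩⟩

/-- Binary cartesian products. -/
@[reducible]
def prod (X Y : FMCpo Loc) : FMCpo Loc where
  carrier := X × Y
  order := inferInstance
  action := inferInstance
  supported := by
    classical
    rintro ⟨x, y⟩
    obtain ⟨L, hL⟩ := X.supported x
    obtain ⟨L', hL'⟩ := Y.supported y
    exact ⟨L ∪ L', fun π hπ => Prod.ext (hL.mono Finset.subset_union_left π hπ)
      (hL'.mono Finset.subset_union_right π hπ)⟩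
  smul_le := fun π a b h => ⟨X.smul_le π _ _ h.1, Y.smul_le π _ _ h.2⟩
  complete := by
    rintro c hc ⟨L, hL⟩
    obtain ⟨a, ha⟩ := X.complete (fun n => (c n).1) (fun m n h => (hc h).1)
      ⟨L, fun n π hπ => congrArg Prod.fst (hL n π hπ)⟩
    obtain ⟨b, hb⟩ := Y.complete (fun n => (c n).2) (fun m n h => (hc h).2)
      ⟨L, fun n π hπ => congrArg Prod.snd (hL n π hπ)⟩
    refine ⟨(a, b), isLUB_prod.2 ⟨?_, ?_⟩⟩
    · rw [← Set.range_comp]; exact ha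
    · rw [← Set.range_comp]; exact hb

/-- Cartesian products of finite families. -/
@[reducible]
def pi {ι : Type} [Finite ι] (X : ι → FMCpo Loc) : FMCpo Loc where
  carrier := ∀ i, X i
  order := inferInstance
  action := inferInstance
  supported := by
    classical
    intro x
    have := Fintype.ofFinite ι
    choose L hL using fun i => (X i).supported (x i)
    exact ⟨Finset.univ.biUnion L, fun π hπ => funext fun i =>
      (hL i).mono (Finset.subset_biUnion_of_mem L (Finset.mem_univ i)) π hπ⟩
  smul_le := fun π a b h i => (X i).smul_le π _ _ (h i)
  complete := by
    rintro c hc ⟨L, hL⟩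
    choose a ha using fun i => (X i).complete (fun n => c n i) (fun m n h => hc h i)
      ⟨L, fun n π hπ => congrFun (hL n π hπ) i⟩
    refine ⟨a, isLUB_pi.2 fun i => ?_⟩
    rw [← Set.range_comp]; exact ha i

/-- Exponentials. -/
@[reducible]
def exp (X Y : FMCpo Loc) : FMCpo Loc where
  carrier := Fn X Y
  order := inferInstance
  action := inferInstance
  supported := fun f => f.supported.imp fun _ h => Fn.fsupports_iff.2 h
  smul_le := fun π _ _ h x => Y.smul_le π _ _ (h (π⁻¹ • x))
  complete := fun c hc hs => (Fn.exists_lub c hc hs).imp fun _ h => Fn.isLUB_of_pointwise h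

end FMCpo

/-- Morphisms of FM-cpos: equivariant functions preserving least upper bounds of finitely
supported chains. -/
@[ext]
structure Hom (X Y : FMCpo Loc) where
  toFun : X → Y
  continuous : FSContinuous toFun
  equivariant : ∀ (π : FinPerm Loc) (x : X), toFun (π • x) = π • toFun x

instance {X Y : FMCpo Loc} : CoeFun (Hom X Y) (fun _ => X → Y) := ⟨Hom.toFun⟩

theorem lub_fst {X Y : FMCpo Loc} {c : ℕ → X.prod Y} {a : X.prod Y}
    (h : IsLUB (Set.range c) a) : IsLUB (Set.range fun n => (c n).1) a.1 := by
  have := (isLUB_prod.1 h).1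
  rw [← Set.range_comp] at this
  exact this

theorem lub_snd {X Y : FMCpo Loc} {c : ℕ → X.prod Y} {a : X.prod Y}
    (h : IsLUB (Set.range c) a) : IsLUB (Set.range fun n => (c n).2) a.2 := by
  have := (isLUB_prod.1 h).2
  rw [← Set.range_comp] at this
  exact this

theorem lub_mk {X Y : FMCpo Loc} {c : ℕ → X.prod Y} {a : X.prod Y}
    (h1 : IsLUB (Set.range fun n => (c n).1) a.1) (h2 : IsLUB (Set.range fun n => (c n).2) a.2) :
    IsLUB (Set.range c) a := by
  refine isLUB_prod.2 ⟨?_, ?_⟩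
  · rw [← Set.range_comp]; exact h1
  · rw [← Set.range_comp]; exact h2

theorem FSeq.fst {X Y : FMCpo Loc} {c : ℕ → X.prod Y} (h : FSeq Loc c) :
    FSeq Loc fun n => (c n).1 :=
  h.imp fun _ hL n π hπ => congrArg Prod.fst (hL n π hπ)

theorem FSeq.snd {X Y : FMCpo Loc} {c : ℕ → X.prod Y} (h : FSeq Loc c) :
    FSeq Loc fun n => (c n).2 :=
  h.imp fun _ hL n π hπ => congrArg Prod.snd (hL n π hπ)

/-- Continuity can be checked separately on each chain. -/
theorem FSContinuous.of_chainwise {X Y : FMCpo Loc} {f : X → Y}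
    (h : ∀ (c : ℕ → X) (a : X), Monotone c → FSeq Loc c → IsLUB (Set.range c) a →
      ∃ g : X → Y, FSContinuous g ∧ (∀ n, f (c n) = g (c n)) ∧ f a = g a) :
    FSContinuous f := by
  intro c a hc hs ha
  obtain ⟨g, hg, h1, h2⟩ := h c a hc hs ha
  simp only [h1, h2]
  exact hg c a hc hs ha

theorem FSContinuous.comp {X Y Z : FMCpo Loc} {g : Y → Z} {f : X → Y} (hg : FSContinuous g)
    (hf : FSContinuous f) (hs : ∃ L : Finset Loc, FnSupports L f) :
    FSContinuous fun x => g (f x) := by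
  intro c a hc hcs ha
  obtain ⟨L, hL⟩ := hs
  exact hg (fun n => f (c n)) _ (fun _ _ h => hf.monotone (hc h)) (hL.fseq hcs) (hf c a hc hcs ha)

theorem FSContinuous.const {X Y : FMCpo Loc} (y : Y) : FSContinuous fun _ : X => y := by
  intro c a _ _ _
  simp [isLUB_singleton]

/-- Joint continuity of application. -/
theorem FSContinuous.eval {X Y : FMCpo Loc} :
    FSContinuous (X := (X.exp Y).prod X) (Y := Y) fun p => p.1 p.2 := by
  intro c a hc hs ha
  have hm1 : Monotone fun n => (c n).1 := fun _ _ h => (hc h).1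
  have hm2 : Monotone fun n => (c n).2 := fun _ _ h => (hc h).2
  have h1 := Fn.isLUB_apply hm1 (FSeq.fst hs) (lub_fst ha)
  constructor
  · rintro _ ⟨n, rfl⟩
    exact ((c n).1.monotone ((lub_snd ha).1 ⟨n, rfl⟩)).trans ((h1 a.2).1 ⟨n, rfl⟩)
  · intro u hu
    refine (h1 a.2).2 ?_
    rintro _ ⟨n, rfl⟩
    refine ((c n).1.continuous _ _ hm2 (FSeq.snd hs) (lub_snd ha)).2 ?_
    rintro _ ⟨m, rfl⟩
    have h2 : (c n).1 (c m).2 ≤ (c (max n m)).1 (c (max n m)).2 :=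
      (hm1 (le_max_left n m) _).trans ((c (max n m)).1.monotone (hm2 (le_max_right n m)))
    exact h2.trans (hu ⟨_, rfl⟩)

namespace Hom

variable {X Y Z : FMCpo Loc}

theorem fnSupports (f : Hom X Y) : FnSupports ∅ f := fun π _ x => f.equivariant π x

theorem monotone (f : Hom X Y) : Monotone f := f.continuous.monotone

/-- Composition of morphisms. -/
def comp (g : Hom Y Z) (f : Hom X Y) : Hom X Z where
  toFun x := g (f x)
  continuous := g.continuous.comp f.continuous ⟨∅, f.fnSupports⟩
  equivariant π x := by rw [f.equivariant, g.equivariant]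

/-- Pairing of morphisms. -/
def pair (f : Hom X Y) (g : Hom X Z) : Hom X (Y.prod Z) where
  toFun x := (f x, g x)
  continuous c a hc hs ha := lub_mk (f.continuous c a hc hs ha) (g.continuous c a hc hs ha)
  equivariant π x := Prod.ext (f.equivariant π x) (g.equivariant π x)

/-- The first projection. -/
def fst : Hom (X.prod Y) X where
  toFun p := p.1
  continuous _ _ _ _ ha := lub_fst ha
  equivariant _ _ := rfl

/-- The second projection. -/
def snd : Hom (X.prod Y) Y where
  toFun p := p.2
  continuous _ _ _ _ ha := lub_snd ha
  equivariant _ _ := rfl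

/-- The evaluation morphism. -/
def eval : Hom ((X.exp Y).prod X) Y where
  toFun p := p.1 p.2
  continuous := FSContinuous.eval
  equivariant π p := Fn.smul_apply_smul π p.1 p.2

/-- Application of a morphism into an exponential to an argument depending on the same input. -/
def app (f : Hom X (Y.exp Z)) (g : Hom X Y) : Hom X Z where
  toFun x := f x (g x)
  continuous := (eval.comp (f.pair g)).continuous
  equivariant := (eval.comp (f.pair g)).equivariant

/-- Currying: `curry f x = fun y => f (x, y)`. -/
def curry (f : Hom (X.prod Y) Z) : Hom X (Y.exp Z) where
  toFun x :=
    { toFun := fun y => f (x, y)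
      continuous := by
        classical
        intro c a hc ⟨L, hL⟩ ha
        obtain ⟨L', hx⟩ := X.supported x
        refine f.continuous (fun n => (x, c n)) (x, a) (fun _ _ h => ⟨le_rfl, hc h⟩)
          ⟨L ∪ L', fun n π hπ => Prod.ext (hx.mono Finset.subset_union_right π hπ)
            ((hL n).mono Finset.subset_union_left π hπ)⟩ (lub_mk ?_ ha)
        simp [isLUB_singleton]
      supported := by
        obtain ⟨L, hx⟩ := X.supported x
        refine ⟨L, fun π hπ y => ?_⟩
        have := f.equivariant π (x, y)
        rw [← this]
        exact congrArg f (Prod.ext (hx π hπ).symm rfl) }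
  continuous := by
    classical
    intro c a hc ⟨L, hL⟩ ha
    refine Fn.isLUB_of_pointwise fun y => ?_
    obtain ⟨L', hy⟩ := Y.supported y
    refine f.continuous (fun n => (c n, y)) (a, y) (fun _ _ h => ⟨hc h, le_rfl⟩)
      ⟨L ∪ L', fun n π hπ => Prod.ext ((hL n).mono Finset.subset_union_left π hπ)
        (hy.mono Finset.subset_union_right π hπ)⟩ (lub_mk ha ?_)
    simp [isLUB_singleton]
  equivariant π x := Fn.ext (funext fun y => by
    have := f.equivariant π (x, π⁻¹ • y)
    change f (π • x, y) = π • f (x, π⁻¹ • y)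
    rw [← this]
    exact congrArg f (Prod.ext rfl (smul_inv_smul π y).symm))

end Hom

/-! ### Least fixed points -/

theorem smul_bot (X : FMCpo Loc) [OrderBot X] (π : FinPerm Loc) : π • (⊥ : X) = ⊥ := by
  apply le_antisymm _ bot_le
  have := X.smul_le π _ _ (bot_le (a := π⁻¹ • (⊥ : X)))
  simpa using this

instance {X Y : FMCpo Loc} [OrderBot Y] : OrderBot (X.exp Y) where
  bot := ⟨fun _ => ⊥, FSContinuous.const ⊥, ∅, fun π _ _ => (smul_bot Y π).symm⟩
  bot_le _ _ := bot_le

theorem exists_leastfix {X : FMCpo Loc} [OrderBot X] (f : Fn X X) :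
    ∃ a, IsLUB (Set.range fun n : ℕ => f^[n] ⊥) a := by
  obtain ⟨L, hL⟩ := f.supported
  refine X.complete _ ?_ ⟨L, fun n π hπ => ?_⟩
  · exact f.monotone.monotone_iterate_of_le_map bot_le
  · induction n with
    | zero => exact smul_bot X π
    | succ n ih =>
      change π • f^[n+1] ⊥ = f^[n+1] ⊥
      rw [Function.iterate_succ_apply', ← hL π hπ]
      exact congrArg f ih

/-- The least fixed point of `f`, the least upper bound of the chain `⊥ ⊑ f ⊥ ⊑ f (f ⊥) ⊑ ⋯`. -/
def leastfix {X : FMCpo Loc} [OrderBot X] (f : Fn X X) : X := Classical.choose (exists_leastfix f)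

theorem leastfix_isLUB {X : FMCpo Loc} [OrderBot X] (f : Fn X X) :
    IsLUB (Set.range fun n : ℕ => f^[n] ⊥) (leastfix f) := Classical.choose_spec (exists_leastfix f)

theorem leastfix_le {X : FMCpo Loc} [OrderBot X] (f : Fn X X) {a : X} (h : f a ≤ a) :
    leastfix f ≤ a := by
  refine (leastfix_isLUB f).2 ?_
  rintro _ ⟨n, rfl⟩
  change f^[n] ⊥ ≤ a
  induction n with
  | zero => exact bot_le
  | succ n ih =>
    rw [Function.iterate_succ_apply']
    exact (f.monotone ih).trans h

theorem map_leastfix_le {X : FMCpo Loc} [OrderBot X] (f : Fn X X) :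
    f (leastfix f) ≤ leastfix f := by
  have hm : Monotone fun n : ℕ => f^[n] (⊥ : X) := f.monotone.monotone_iterate_of_le_map bot_le
  have hs : FSeq Loc fun n : ℕ => f^[n] (⊥ : X) := by
    obtain ⟨L, hL⟩ := f.supported
    refine ⟨L, fun n π hπ => ?_⟩
    induction n with
    | zero => exact smul_bot X π
    | succ n ih =>
      change π • f^[n+1] ⊥ = f^[n+1] ⊥
      rw [Function.iterate_succ_apply', ← hL π hπ]
      exact congrArg f ih
  refine (f.continuous _ _ hm hs (leastfix_isLUB f)).2 ?_
  rintro _ ⟨n, rfl⟩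
  refine (leastfix_isLUB f).1 ⟨n + 1, ?_⟩
  exact Function.iterate_succ_apply' f n ⊥

theorem leastfix_mono {X : FMCpo Loc} [OrderBot X] {f g : Fn X X} (h : f ≤ g) :
    leastfix f ≤ leastfix g :=
  leastfix_le f ((h _).trans (map_leastfix_le g))

theorem leastfix_smul {X : FMCpo Loc} [OrderBot X] (π : FinPerm Loc) (f : Fn X X) :
    leastfix (π • f) = π • leastfix f := by
  have h := smul_isLUB π (leastfix_isLUB f)
  have h2 : (fun n : ℕ => π • f^[n] (⊥ : X)) = fun n : ℕ => (π • f).toFun^[n] ⊥ := by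
    funext n
    induction n with
    | zero => exact smul_bot X π
    | succ n ih =>
      rw [Function.iterate_succ_apply', Function.iterate_succ_apply', ← ih, Fn.smul_apply_smul]
  rw [h2] at h
  exact (leastfix_isLUB _).unique h

/-- The least fixed point operator as a morphism. -/
def Hom.fix {X : FMCpo Loc} [OrderBot X] : Hom (X.exp X) X where
  toFun := leastfix
  continuous := by
    intro c f hc hs hf
    have hm : Monotone fun n => leastfix (c n) := fun _ _ h => leastfix_mono (hc h)
    have hsf : FSeq Loc fun n => leastfix (c n) := by
      obtain ⟨L, hL⟩ := hs
      exact ⟨L, fun n π hπ => by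
        rw [← leastfix_smul]; exact congrArg leastfix (hL n π hπ)⟩
    obtain ⟨w, hw⟩ := X.complete _ hm hsf
    have hev := FSContinuous.eval (X := X) (Y := X) (fun n => (c n, leastfix (c n))) (f, w)
      (fun _ _ h => ⟨hc h, hm h⟩)
      (by
        classical
        obtain ⟨L, hL⟩ := hs
        obtain ⟨L', hL'⟩ := hsf
        exact ⟨L ∪ L', fun n π hπ => Prod.ext ((hL n).mono Finset.subset_union_left π hπ)
          ((hL' n).mono Finset.subset_union_right π hπ)⟩)
      (lub_mk hf hw)
    have hfw : f w ≤ w := hev.2 (by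
      rintro _ ⟨n, rfl⟩
      exact (map_leastfix_le (c n)).trans (hw.1 ⟨n, rfl⟩))
    constructor
    · rintro _ ⟨n, rfl⟩
      exact leastfix_mono (hf.1 ⟨n, rfl⟩)
    · intro u hu
      exact (leastfix_le f hfw).trans (hw.2 hu)
  equivariant := leastfix_smul

/-! ### Values, heaps, observations -/

/-- Values: locations, integers, and a default value for type-incorrect expressions. -/
inductive Val (Loc : Type) : Type
  | loc (l : Loc)
  | int (z : ℤ)
  | default

/-- Permutations act on the locations among the values. -/
instance : MulAction (FinPerm Loc) (Val Loc) where
  smul π v := match v with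
    | .loc l => .loc (π • l)
    | .int z => .int z
    | .default => .default
  one_smul v := by cases v <;> rfl
  mul_smul π σ v := by cases v <;> rfl

theorem Val.smul_loc (π : FinPerm Loc) (l : Loc) : π • Val.loc l = Val.loc (π • l) := rfl
theorem Val.smul_int (π : FinPerm Loc) (z : ℤ) : π • (Val.int z : Val Loc) = Val.int z := rfl
theorem Val.smul_default (π : FinPerm Loc) : π • (Val.default : Val Loc) = Val.default := rfl

theorem Val.exists_fsupports (v : Val Loc) : ∃ L : Finset Loc, FSupports L v := by
  cases v with
  | loc l => exact ⟨{l}, fun π hπ => congrArg Val.loc (hπ (by simp))⟩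
  | int z => exact ⟨∅, fun π _ => rfl⟩
  | default => exact ⟨∅, fun π _ => rfl⟩

/-- The discrete FM-cpo of values. -/
@[reducible]
def valCpo (Loc : Type) : FMCpo Loc := FMCpo.discrete (Val Loc) Val.exists_fsupports

/-- Heaps: finite partial functions from locations to pairs of values. -/
@[ext]
structure Heap (Loc : Type) where
  toFun : Loc → Option (Val Loc × Val Loc)
  finite_dom : {l | toFun l ≠ none}.Finite

namespace Heap

instance : CoeFun (Heap Loc) (fun _ => Loc → Option (Val Loc × Val Loc)) := ⟨Heap.toFun⟩

/-- The empty heap. -/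
def empty : Heap Loc where
  toFun _ := none
  finite_dom := by simp

open Classical in
/-- The heap `[l ↦ c]` with one cell. -/
def single (l : Loc) (c : Val Loc × Val Loc) : Heap Loc where
  toFun l' := if l' = l then some c else none
  finite_dom := (Set.finite_singleton l).subset (by
    intro l' h
    by_contra hne
    exact h (if_neg hne))

/-- Disjointness of domains. -/
def Disj (h h' : Heap Loc) : Prop := ∀ l, h l = none ∨ h' l = none

/-- The union of two heaps (used for disjoint heaps only). -/
def union (h h' : Heap Loc) : Heap Loc where
  toFun l := (h l).or (h' l)
  finite_dom := (h.finite_dom.union h'.finite_dom).subset (by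
    intro l hl
    by_contra hn
    simp only [Set.mem_union, Set.mem_ofPred_eq, not_or, not_not] at hn
    exact hl (by simp [hn.1, hn.2]))

open Classical in
/-- Overwriting the cell at `l`. -/
def update (h : Heap Loc) (l : Loc) (c : Val Loc × Val Loc) : Heap Loc where
  toFun l' := if l' = l then some c else h l'
  finite_dom := (h.finite_dom.union (Set.finite_singleton l)).subset (by
    intro l' hl
    by_contra hn
    simp only [Set.mem_union, Set.mem_ofPred_eq, Set.mem_singleton_iff, not_or, not_not] at hn
    exact hl (by simp [hn.1, hn.2]))

open Classical in
/-- Removing the cell at `l`. -/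
def erase (h : Heap Loc) (l : Loc) : Heap Loc where
  toFun l' := if l' = l then none else h l'
  finite_dom := h.finite_dom.subset (by
    intro l' hl hn
    exact hl (by simp [show h l' = none from hn]))

/-- The action of permutations on heaps. -/
instance : MulAction (FinPerm Loc) (Heap Loc) where
  smul π h :=
    { toFun := fun l => π • h (π⁻¹ • l)
      finite_dom := by
        refine (h.finite_dom.image (fun l => π • l)).subset ?_
        intro l hl
        refine ⟨π⁻¹ • l, ?_, smul_inv_smul π l⟩
        intro hn
        apply hl
        simp [show h (π⁻¹ • l) = none from hn] }
  one_smul h := Heap.ext (funext fun l => by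
    change (1 : FinPerm Loc) • h ((1 : FinPerm Loc)⁻¹ • l) = h l
    simp)
  mul_smul π σ h := Heap.ext (funext fun l => by
    change (π * σ) • h ((π * σ)⁻¹ • l) = π • (σ • h (σ⁻¹ • (π⁻¹ • l)))
    simp [mul_smul])

theorem smul_apply (π : FinPerm Loc) (h : Heap Loc) (l : Loc) :
    (π • h) l = π • h (π⁻¹ • l) := rfl

theorem smul_apply_smul (π : FinPerm Loc) (h : Heap Loc) (l : Loc) :
    (π • h) (π • l) = π • h l := by
  rw [smul_apply, inv_smul_smul]

theorem smul_eq_iff {π : FinPerm Loc} {h g : Heap Loc} :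
    π • h = g ↔ ∀ l, g (π • l) = π • h l := by
  constructor
  · rintro rfl l
    exact smul_apply_smul π h l
  · intro H
    refine Heap.ext (funext fun l => ?_)
    have := H (π⁻¹ • l)
    rw [smul_inv_smul] at this
    rw [this]
    rfl

theorem smul_empty (π : FinPerm Loc) : π • (empty : Heap Loc) = empty :=
  smul_eq_iff.2 fun _ => rfl

theorem smul_single (π : FinPerm Loc) (l : Loc) (c : Val Loc × Val Loc) :
    π • single l c = single (π • l) (π • c) := by
  refine smul_eq_iff.2 fun l' => ?_
  by_cases h : l' = l <;> simp [single, h]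

theorem smul_union (π : FinPerm Loc) (h h' : Heap Loc) :
    π • union h h' = union (π • h) (π • h') := by
  refine smul_eq_iff.2 fun l => ?_
  simp only [union, smul_apply_smul]
  cases h l <;> simp

theorem smul_update (π : FinPerm Loc) (h : Heap Loc) (l : Loc) (c : Val Loc × Val Loc) :
    π • update h l c = update (π • h) (π • l) (π • c) := by
  refine smul_eq_iff.2 fun l' => ?_
  by_cases e : l' = l
  · simp [update, e]
  · simp only [update, smul_left_cancel_iff, e, if_false, smul_apply_smul]

theorem smul_erase (π : FinPerm Loc) (h : Heap Loc) (l : Loc) :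
    π • erase h l = erase (π • h) (π • l) := by
  refine smul_eq_iff.2 fun l' => ?_
  by_cases e : l' = l
  · simp [erase, e]
  · simp only [erase, smul_left_cancel_iff, e, if_false, smul_apply_smul]

theorem smul_disj (π : FinPerm Loc) {h h' : Heap Loc} (hd : Disj h h') :
    Disj (π • h) (π • h') := by
  intro l
  rcases hd (π⁻¹ • l) with e | e
  · left; rw [smul_apply, e]; rfl
  · right; rw [smul_apply, e]; rfl

theorem exists_fsupports (h : Heap Loc) : ∃ L : Finset Loc, FSupports L h := by
  classical
  choose S hS using fun v : Val Loc => v.exists_fsupports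
  let T : Loc → Finset Loc := fun l => match h l with
    | none => {l}
    | some c => {l} ∪ (S c.1 ∪ S c.2)
  refine ⟨h.finite_dom.toFinset.biUnion T, fun π hπ => ?_⟩
  have key : ∀ l, h l ≠ none → π • l = l ∧ π • h l = h l := by
    intro l hl
    have hT : ∀ l' ∈ T l, π • l' = l' := fun l' hl' => hπ (by
      simp only [Finset.coe_biUnion, Set.mem_iUnion]
      exact ⟨l, by simpa using hl, hl'⟩)
    obtain ⟨c, hc⟩ := Option.ne_none_iff_exists'.1 hl
    have hTl : T l = {l} ∪ (S c.1 ∪ S c.2) := by simp only [T, hc]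
    rw [hTl] at hT
    refine ⟨hT l (by simp), ?_⟩
    rw [hc]
    refine congrArg some (Prod.ext (hS c.1 π fun l' hl' => hT l' ?_)
      (hS c.2 π fun l' hl' => hT l' ?_))
    · simp only [Finset.mem_union]; exact Or.inr (Or.inl hl')
    · simp only [Finset.mem_union]; exact Or.inr (Or.inr hl')
  refine smul_eq_iff.2 fun l => ?_
  by_cases hl : h l = none
  · rw [hl]
    by_cases hp : h (π • l) = none
    · rw [hp]; rfl
    · have := (key _ hp).1
      rw [smul_left_cancel_iff] at this
      rw [this] at hp
      exact absurd hl hp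
  · rw [(key l hl).1, (key l hl).2]

end Heap

/-- The discrete FM-cpo of heaps. -/
@[reducible]
def heapCpo (Loc : Type) : FMCpo Loc := FMCpo.discrete (Heap Loc) Heap.exists_fsupports

/-- Observations: divergence, normal termination, erroneous termination. -/
inductive Obs : Type
  | bot
  | normal
  | err

/-- The flat order on observations, with divergence as least element. -/
instance : PartialOrder Obs where
  le a b := a = Obs.bot ∨ a = b
  le_refl _ := Or.inr rfl
  le_trans := by
    rintro a b c (rfl | rfl) h
    · exact Or.inl rfl
    · exact h
  le_antisymm := by
    rintro a b (rfl | rfl) h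
    · rcases h with rfl | rfl <;> rfl
    · rfl

instance : OrderBot Obs where
  bot := Obs.bot
  bot_le _ := Or.inl rfl

/-- Permutations act trivially on observations. -/
instance : MulAction (FinPerm Loc) Obs where
  smul _ o := o
  one_smul _ := rfl
  mul_smul _ _ _ := rfl

theorem Obs.exists_lub (c : ℕ → Obs) (hc : Monotone c) : ∃ a, IsLUB (Set.range c) a := by
  by_cases h : ∃ n, c n ≠ Obs.bot
  · obtain ⟨n, hn⟩ := h
    refine ⟨c n, ?_, fun u hu => hu ⟨n, rfl⟩⟩
    rintro _ ⟨m, rfl⟩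
    rcases hc (le_max_left n m) with h1 | h1
    · exact absurd h1 hn
    · rw [h1]; exact hc (le_max_right n m)
  · push Not at h
    refine ⟨Obs.bot, ?_, fun u _ => Or.inl rfl⟩
    rintro _ ⟨m, rfl⟩
    exact Or.inl (h m)

/-- The flat FM-cpo of observations. -/
@[reducible]
def obsCpo (Loc : Type) : FMCpo Loc where
  carrier := Obs
  order := inferInstance
  action := inferInstance
  supported := fun _ => ⟨∅, fun _ _ => rfl⟩
  smul_le := fun _ _ _ h => h
  complete := fun c hc _ => Obs.exists_lub c hc

/-- Continuations. -/
@[reducible]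
def contCpo (Loc : Type) : FMCpo Loc := (heapCpo Loc).exp (obsCpo Loc)

/-- Commands in continuation passing style. -/
@[reducible]
def comCpo (Loc : Type) : FMCpo Loc := ((heapCpo Loc).prod (contCpo Loc)).exp (obsCpo Loc)

/-! ### Types, expressions and terms

Syntax is represented up to renaming of bound variables, by well-scoped and well-typed de Bruijn
terms. A context `Δ` of stack variables is given by its number `n` of variables, a context `Γ` of
identifiers by the list of their types; the most recently bound variable comes first. The inhabitants
of `Expr n` and `Term n Γ τ` are the derivable judgments `Δ ⊢ E` and `Δ | Γ ⊢ M : τ`. -/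

/-- Types: `com`, `val → τ` and `σ → τ`. -/
inductive Ty : Type
  | com
  | val (τ : Ty)
  | fn (σ τ : Ty)

/-- Identifiers of type `τ` in the context `Γ`. -/
inductive Var : List Ty → Ty → Type
  | zero {Γ : List Ty} {τ : Ty} : Var (τ :: Γ) τ
  | succ {Γ : List Ty} {σ τ : Ty} (x : Var Γ τ) : Var (σ :: Γ) τ

/-- The two fields of a heap cell. -/
inductive Fld : Type
  | f0
  | f1

/-- Expressions. -/
inductive Expr (n : ℕ) : Type
  | var (i : Fin n)
  | zero
  | one
  | negOne
  | add (E F : Expr n)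
  | sub (E F : Expr n)

/-- Terms. -/
inductive Term : ℕ → List Ty → Ty → Type
  /-- an identifier `x` -/
  | var {n : ℕ} {Γ : List Ty} {τ : Ty} (x : Var Γ τ) : Term n Γ τ
  /-- `λ i. M` -/
  | lamV {n : ℕ} {Γ : List Ty} {τ : Ty} (M : Term (n + 1) Γ τ) : Term n Γ (.val τ)
  /-- `M E` -/
  | appV {n : ℕ} {Γ : List Ty} {τ : Ty} (M : Term n Γ (.val τ)) (E : Expr n) : Term n Γ τ
  /-- `λ x : σ. M` -/
  | lam {n : ℕ} {Γ : List Ty} {σ τ : Ty} (M : Term n (σ :: Γ) τ) : Term n Γ (.fn σ τ)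
  /-- `M N` -/
  | app {n : ℕ} {Γ : List Ty} {σ τ : Ty} (M : Term n Γ (.fn σ τ)) (N : Term n Γ σ) : Term n Γ τ
  /-- `fix M` -/
  | fix {n : ℕ} {Γ : List Ty} {τ : Ty} (M : Term n Γ (.fn τ τ)) : Term n Γ τ
  /-- `if (E = F) then M else N` -/
  | ite {n : ℕ} {Γ : List Ty} (E F : Expr n) (M N : Term n Γ .com) : Term n Γ .com
  /-- `M; N` -/
  | seq {n : ℕ} {Γ : List Ty} (M N : Term n Γ .com) : Term n Γ .com
  /-- `let i = new in M` -/
  | new {n : ℕ} {Γ : List Ty} (M : Term (n + 1) Γ .com) : Term n Γ .com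
  /-- `free(E)` -/
  | free {n : ℕ} {Γ : List Ty} (E : Expr n) : Term n Γ .com
  /-- `let i = E.f in M` -/
  | lookup {n : ℕ} {Γ : List Ty} (E : Expr n) (f : Fld) (M : Term (n + 1) Γ .com) : Term n Γ .com
  /-- `E.f := F` -/
  | assign {n : ℕ} {Γ : List Ty} (E : Expr n) (f : Fld) (F : Expr n) : Term n Γ .com

/-! ### Semantics of types and contexts -/

/-- The FM-cpo denoted by a type. -/
@[reducible]
def Ty.den (Loc : Type) : Ty → FMCpo Loc
  | .com => comCpo Loc
  | .val τ => (valCpo Loc).exp (τ.den Loc)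
  | .fn σ τ => (σ.den Loc).exp (τ.den Loc)

/-- Types denote pointed FM-cpos. -/
instance Ty.orderBot (Loc : Type) : (τ : Ty) → OrderBot (τ.den Loc)
  | .com => inferInstanceAs (OrderBot (comCpo Loc))
  | .val τ =>
    have := Ty.orderBot Loc τ
    inferInstanceAs (OrderBot ((valCpo Loc).exp (τ.den Loc)))
  | .fn σ τ =>
    have := Ty.orderBot Loc τ
    inferInstanceAs (OrderBot ((σ.den Loc).exp (τ.den Loc)))

theorem Var.finite : (Γ : List Ty) → Finite (Σ τ, Var Γ τ)
  | [] => by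
    have : IsEmpty (Σ τ, Var [] τ) := ⟨by rintro ⟨_, x⟩; cases x⟩
    infer_instance
  | σ :: Γ => by
    have := Var.finite Γ
    refine Finite.of_surjective
      (fun o : Option (Σ τ, Var Γ τ) => match o with
        | none => (⟨σ, Var.zero⟩ : Σ τ, Var (σ :: Γ) τ)
        | some x => ⟨x.1, Var.succ x.2⟩) ?_
    rintro ⟨τ, x⟩
    cases x with
    | zero => exact ⟨none, rfl⟩
    | succ x => exact ⟨some ⟨τ, x⟩, rfl⟩

instance (Γ : List Ty) : Finite (Σ τ, Var Γ τ) := Var.finite Γ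

/-- Stack environments: the product of one copy of the values for each stack variable. -/
@[reducible]
def senv (Loc : Type) (n : ℕ) : FMCpo Loc := FMCpo.pi fun _ : Fin n => valCpo Loc

/-- Identifier environments: the product of the meanings of the types in the context. -/
@[reducible]
def ienv (Loc : Type) (Γ : List Ty) : FMCpo Loc := FMCpo.pi fun x : Σ τ, Var Γ τ => x.1.den Loc

/-- `ρ[i → v]` for a new stack variable. -/
def consV {n : ℕ} (v : Val Loc) (ρ : senv Loc n) : senv Loc (n + 1) :=
  Fin.cases (motive := fun _ => Val Loc) v ρ

/-- `η[x → m]` for a new identifier. -/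
def consI {Γ : List Ty} {σ : Ty} (m : σ.den Loc) (η : ienv Loc Γ) : ienv Loc (σ :: Γ)
  | ⟨_, .zero⟩ => m
  | ⟨_, .succ x⟩ => η ⟨_, x⟩

/-- The product of stack and identifier environments. -/
@[reducible]
def env (Loc : Type) (n : ℕ) (Γ : List Ty) : FMCpo Loc := (senv Loc n).prod (ienv Loc Γ)

theorem lub_pi {ι : Type} [Finite ι] {X : ι → FMCpo Loc} {c : ℕ → FMCpo.pi X} {a : FMCpo.pi X} :
    IsLUB (Set.range c) a ↔ ∀ i, IsLUB (Set.range fun n => c n i) (a i) := by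
  refine (isLUB_pi (f := a)).trans (forall_congr' fun i => ?_)
  rw [← Set.range_comp]
  rfl

/-- Extension of the stack environment. -/
def extV {n : ℕ} {Γ : List Ty} : Hom ((env Loc n Γ).prod (valCpo Loc)) (env Loc (n + 1) Γ) where
  toFun p := (consV p.2 p.1.1, p.1.2)
  continuous c a hc hs ha := by
    have h1 := lub_fst ha
    have h2 := lub_snd h1
    refine lub_mk (lub_pi.2 fun i => ?_) h2
    refine Fin.cases ?_ (fun i => ?_) i
    · exact lub_snd ha
    · exact lub_pi.1 (lub_fst (lub_fst ha)) i
  equivariant π p := by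
    refine Prod.ext (funext fun i => ?_) rfl
    refine Fin.cases ?_ (fun i => ?_) i <;> rfl

/-- Extension of the identifier environment. -/
def extI {n : ℕ} {Γ : List Ty} {σ : Ty} :
    Hom ((env Loc n Γ).prod (σ.den Loc)) (env Loc n (σ :: Γ)) where
  toFun p := (p.1.1, consI p.2 p.1.2)
  continuous c a hc hs ha := by
    have h1 := lub_fst ha
    have h2 := lub_fst h1
    refine lub_mk h2 (lub_pi.2 ?_)
    rintro ⟨τ, x⟩
    cases x with
    | zero => exact lub_snd ha
    | succ x => exact lub_pi.1 (lub_snd (lub_fst ha)) ⟨τ, x⟩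
  equivariant π p := by
    refine Prod.ext rfl (funext ?_)
    rintro ⟨τ, x⟩
    cases x <;> rfl

/-! ### Semantics of expressions -/

/-- Addition of values. -/
def Val.add : Val Loc → Val Loc → Val Loc
  | .int a, .int b => .int (a + b)
  | _, _ => .default

/-- Subtraction of values. -/
def Val.sub : Val Loc → Val Loc → Val Loc
  | .int a, .int b => .int (a - b)
  | _, _ => .default

/-- The meaning of an expression. -/
def Expr.den {n : ℕ} : Expr n → senv Loc n → Val Loc
  | .var i, ρ => ρ i
  | .zero, _ => .int 0
  | .one, _ => .int 1
  | .negOne, _ => .int (-1)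
  | .add E F, ρ => (E.den ρ).add (F.den ρ)
  | .sub E F, ρ => (E.den ρ).sub (F.den ρ)

theorem Expr.den_smul {n : ℕ} (E : Expr n) (π : FinPerm Loc) (ρ : senv Loc n) :
    E.den (π • ρ) = π • E.den ρ := by
  induction E with
  | var i => rfl
  | zero => rfl
  | one => rfl
  | negOne => rfl
  | add E F ihE ihF =>
    simp only [Expr.den, ihE, ihF]
    cases E.den ρ <;> cases F.den ρ <;> rfl
  | sub E F ihE ihF =>
    simp only [Expr.den, ihE, ihF]
    cases E.den ρ <;> cases F.den ρ <;> rfl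

theorem FSContinuous.of_discrete {A : Type} [MulAction (FinPerm Loc) A]
    {hA : ∀ a : A, ∃ L : Finset Loc, FSupports L a} {Y : FMCpo Loc}
    (f : A → Y) : FSContinuous (X := FMCpo.discrete A hA) f := by
  refine FSContinuous.of_chainwise fun c a hc hs ha => ⟨fun _ => f a, FSContinuous.const _, ?_, rfl⟩
  intro n
  exact congrArg f (ha.1 ⟨n, rfl⟩)

/-- A function on environments that depends only on the stack is continuous. -/
def Expr.hom {n : ℕ} {Γ : List Ty} (E : Expr n) : Hom (env Loc n Γ) (valCpo Loc) where
  toFun p := E.den p.1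
  continuous := by
    refine FSContinuous.of_chainwise fun c a hc hs ha =>
      ⟨fun _ => E.den a.1, FSContinuous.const _, fun n => ?_, rfl⟩
    have h : (c n).1 = a.1 := funext fun i => (ha.1 ⟨n, rfl⟩).1 i
    rw [h]
  equivariant π p := E.den_smul π p.1

/-! ### Semantics of terms -/

/-- Every element of an FM-cpo has a fresh location. -/
theorem exists_fresh [Infinite Loc] {X : FMCpo Loc} (x : X) : ∃ l, l ∉ supp Loc x := by
  obtain ⟨L, hL⟩ := X.supported x
  obtain ⟨l, hl⟩ := Infinite.exists_notMem_finset L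
  exact ⟨l, fun h => hl (h L hL)⟩

/-- A location outside the support of `x`. -/
def fresh [Infinite Loc] {X : FMCpo Loc} (x : X) : Loc := Classical.choose (exists_fresh x)

theorem fresh_spec [Infinite Loc] {X : FMCpo Loc} (x : X) : fresh x ∉ supp Loc x :=
  Classical.choose_spec (exists_fresh x)

/-- Observations do not depend on the choice of a fresh location. -/
theorem fresh_irrel [Infinite Loc] {X : FMCpo Loc} {g : Loc → X → Obs}
    (hg : ∀ (π : FinPerm Loc) l x, g (π • l) (π • x) = g l x) {x : X} {l l' : Loc}
    (hl : l ∉ supp Loc x) (hl' : l' ∉ supp Loc x) : g l x = g l' x := by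
  classical
  have key : ∀ (L : Finset Loc) (a b : Loc), FSupports L x → a ∉ L → b ∉ L → g a x = g b x := by
    intro L a b hL ha hb
    let π : FinPerm Loc := ⟨Equiv.swap a b, by
      refine ((Set.finite_singleton a).union (Set.finite_singleton b)).subset ?_
      intro c hc
      by_contra hn
      simp only [Set.mem_union, Set.mem_singleton_iff, not_or] at hn
      exact hc (Equiv.swap_apply_of_ne_of_ne hn.1 hn.2)⟩
    have h1 : π • x = x := hL π (by
      intro c hc
      exact Equiv.swap_apply_of_ne_of_ne (by rintro rfl; exact ha hc) (by rintro rfl; exact hb hc))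
    have h2 : π • a = b := Equiv.swap_apply_left a b
    have := hg π a x
    rw [h1, h2] at this
    exact this.symm
  simp only [supp, Set.mem_ofPred_eq, not_forall] at hl hl'
  obtain ⟨L, hL, hlL⟩ := hl
  obtain ⟨L', hL', hlL'⟩ := hl'
  obtain ⟨b, hb⟩ := Infinite.exists_notMem_finset (L ∪ L')
  simp only [Finset.mem_union, not_or] at hb
  exact (key L l b hL hlL hb.1).trans (key L' b l' hL' hb.2 hlL')

/-- Reading a field of a cell. -/
def Fld.get : Fld → Val Loc × Val Loc → Val Loc
  | .f0, c => c.1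
  | .f1, c => c.2

/-- Writing a field of a cell. -/
def Fld.set : Fld → Val Loc × Val Loc → Val Loc → Val Loc × Val Loc
  | .f0, c, v => (v, c.2)
  | .f1, c, v => (c.1, v)

theorem Fld.get_smul (f : Fld) (π : FinPerm Loc) (c : Val Loc × Val Loc) :
    f.get (π • c) = π • f.get c := by cases f <;> rfl

theorem Fld.set_smul (f : Fld) (π : FinPerm Loc) (c : Val Loc × Val Loc) (v : Val Loc) :
    f.set (π • c) (π • v) = π • f.set c v := by cases f <;> rfl

/-- The cell stored in `h` at the value `v`; there is none if `v` is not in the domain of `h`. -/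
def Heap.cell (h : Heap Loc) : Val Loc → Option (Loc × (Val Loc × Val Loc))
  | .loc l => (h l).map fun c => (l, c)
  | _ => none

theorem Heap.cell_smul (π : FinPerm Loc) (h : Heap Loc) (v : Val Loc) :
    (π • h).cell (π • v) = π • h.cell v := by
  cases v with
  | loc l =>
    rw [Val.smul_loc]
    simp only [Heap.cell, Heap.smul_apply_smul]
    cases h l <;> rfl
  | int z => rfl
  | default => rfl

namespace Hom

variable {X Y : FMCpo Loc}

open Classical in
/-- The conditional on equality of two values. -/
def ite (e f : Hom X (valCpo Loc)) (m n : Hom X Y) : Hom X Y where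
  toFun x := if e x = f x then m x else n x
  continuous := by
    refine FSContinuous.of_chainwise fun c a hc hs ha => ?_
    have he : ∀ i, e (c i) = e a := fun i => e.monotone (ha.1 ⟨i, rfl⟩)
    have hf : ∀ i, f (c i) = f a := fun i => f.monotone (ha.1 ⟨i, rfl⟩)
    by_cases h : e a = f a
    · exact ⟨m, m.continuous, fun i => by rw [he, hf, if_pos h], if_pos h⟩
    · exact ⟨n, n.continuous, fun i => by rw [he, hf, if_neg h], if_neg h⟩
  equivariant π x := by
    simp only [e.equivariant, f.equivariant, m.equivariant, n.equivariant, smul_left_cancel_iff]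
    split <;> rfl

/-- The continuation `fun h' => n x (h', k)` as a function of `(x, k)`. -/
def thenCont (n : Hom X (comCpo Loc)) : Hom (X.prod (contCpo Loc)) (contCpo Loc) :=
  curry (app (n.comp (fst.comp fst)) (pair snd (snd.comp fst)))

/-- Sequential composition. -/
def seq (m n : Hom X (comCpo Loc)) : Hom X (comCpo Loc) :=
  curry
    { toFun := fun p => m p.1 (p.2.1, n.thenCont (p.1, p.2.2))
      continuous := (app (m.comp fst) (pair (fst.comp snd)
        (n.thenCont.comp (pair fst (snd.comp snd))))).continuous
      equivariant := (app (m.comp fst) (pair (fst.comp snd)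
        (n.thenCont.comp (pair fst (snd.comp snd))))).equivariant }

/-- Extending a heap by a cell `0, 0` at the address `v`. -/
def allocHeap : Val Loc → Heap Loc → Heap Loc
  | .loc l, h => h.union (Heap.single l (.int 0, .int 0))
  | _, h => h

theorem allocHeap_smul (π : FinPerm Loc) (v : Val Loc) (h : Heap Loc) :
    allocHeap (π • v) (π • h) = π • allocHeap v h := by
  cases v with
  | loc l =>
    rw [Val.smul_loc]
    simp only [allocHeap, Heap.smul_union, Heap.smul_single]
    rfl
  | int z => rfl
  | default => rfl

/-- Running `m` with a given address of the new cell. -/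
def allocAt (m : Hom (X.prod (valCpo Loc)) (comCpo Loc)) :
    Hom ((valCpo Loc).prod (X.prod ((heapCpo Loc).prod (contCpo Loc)))) (obsCpo Loc) where
  toFun q := m (q.2.1, q.1) (allocHeap q.1 q.2.2.1, q.2.2.2)
  continuous := by
    refine FSContinuous.of_chainwise fun c a hc hs ha => ?_
    let w : Heap Loc := allocHeap a.1 a.2.2.1
    let F : Hom ((heapCpo Loc).prod ((valCpo Loc).prod
        (X.prod ((heapCpo Loc).prod (contCpo Loc))))) (obsCpo Loc) :=
      app (m.comp (pair (fst.comp (snd.comp snd)) (fst.comp snd)))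
        (pair fst (snd.comp (snd.comp (snd.comp snd))))
    refine ⟨fun q => F (w, q), (F.curry w).continuous, fun n => ?_, rfl⟩
    have h1 : (c n).1 = a.1 := (ha.1 ⟨n, rfl⟩).1
    have h2 : (c n).2.2.1 = a.2.2.1 := (ha.1 ⟨n, rfl⟩).2.2.1
    change m ((c n).2.1, (c n).1) (allocHeap (c n).1 (c n).2.2.1, (c n).2.2.2) =
      m ((c n).2.1, (c n).1) (w, (c n).2.2.2)
    rw [h2]
    simp only [w, h1]
  equivariant π q := by
    have h := m.equivariant π (q.2.1, q.1)
    change m (π • (q.2.1, q.1)) (allocHeap (π • q.1) (π • q.2.2.1), π • q.2.2.2) = _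
    rw [h, allocHeap_smul]
    exact Fn.smul_apply_smul (X := (heapCpo Loc).prod (contCpo Loc)) π _
      (allocHeap q.1 q.2.2.1, q.2.2.2)

/-- Allocation: the new cell is placed at a location outside the support of the environment, the
heap and the continuation. -/
def new [Infinite Loc] (m : Hom (X.prod (valCpo Loc)) (comCpo Loc)) : Hom X (comCpo Loc) :=
  curry
    { toFun := fun p =>
        m (p.1, .loc (fresh p))
          (p.2.1.union (Heap.single (fresh p) (.int 0, .int 0)), p.2.2)
      continuous := by
        classical
        refine FSContinuous.of_chainwise fun c a hc hs ha => ?_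
        obtain ⟨L, hL⟩ := hs
        obtain ⟨l, hl⟩ := Infinite.exists_notMem_finset L
        have hg : ∀ (π : FinPerm Loc) (l : Loc) x,
            m.allocAt (.loc (π • l), π • x) = m.allocAt (.loc l, x) := fun π l x =>
          m.allocAt.equivariant π (.loc l, x)
        refine ⟨fun p => m.allocAt (.loc l, p), (m.allocAt.curry (.loc l)).continuous, ?_, ?_⟩
        · intro n
          exact fresh_irrel (g := fun l x => m.allocAt (.loc l, x)) hg (fresh_spec _)
            fun h => hl (h L (hL n))
        · exact fresh_irrel (g := fun l x => m.allocAt (.loc l, x)) hg (fresh_spec _)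
            fun h => hl (h L (FSupports.lub hL ha))
      equivariant := by
        intro π p
        have hg : ∀ (π : FinPerm Loc) (l : Loc) x,
            m.allocAt (.loc (π • l), π • x) = m.allocAt (.loc l, x) := fun π l x =>
          m.allocAt.equivariant π (.loc l, x)
        classical
        obtain ⟨L, hL⟩ := (X.prod ((heapCpo Loc).prod (contCpo Loc))).supported p
        obtain ⟨L', hL'⟩ := (X.prod ((heapCpo Loc).prod (contCpo Loc))).supported (π • p)
        obtain ⟨l, hl⟩ := Infinite.exists_notMem_finset (L ∪ L'.image (fun l => π⁻¹ • l))
        simp only [Finset.mem_union, Finset.mem_image, not_or, not_exists, not_and] at hl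
        have h1 := fresh_irrel (g := fun l x => m.allocAt (.loc l, x)) hg (fresh_spec p)
          (l' := l) fun h => hl.1 (h L hL)
        have h2 := fresh_irrel (g := fun l x => m.allocAt (.loc l, x)) hg (fresh_spec (π • p))
          (l' := π • l) fun h => hl.2 _ (h L' hL') (inv_smul_smul π l)
        exact h2.trans ((hg π l p).trans h1.symm) }

/-- A command that inspects the cell at the address `e x`, failing if there is none. -/
theorem continuous_access (e : Hom X (valCpo Loc))
    (F : Loc × (Val Loc × Val Loc) → X.prod ((heapCpo Loc).prod (contCpo Loc)) → Obs)
    (hF : ∀ (q : Loc × (Val Loc × Val Loc)) (x₀ : X) (h₀ : Heap Loc),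
      ∃ g : X.prod ((heapCpo Loc).prod (contCpo Loc)) → Obs,
        FSContinuous (Y := obsCpo Loc) g ∧ ∀ x k, x ≤ x₀ → F q (x, (h₀, k)) = g (x, (h₀, k))) :
    FSContinuous (X := X.prod ((heapCpo Loc).prod (contCpo Loc))) (Y := obsCpo Loc) fun p =>
      match p.2.1.cell (e p.1) with
      | none => Obs.err
      | some q => F q p := by
  refine FSContinuous.of_chainwise fun c a hc hs ha => ?_
  have h1 : ∀ n, (c n).2.1 = a.2.1 := fun n => (ha.1 ⟨n, rfl⟩).2.1
  have h2 : ∀ n, e (c n).1 = e a.1 := fun n => e.monotone (ha.1 ⟨n, rfl⟩).1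
  cases hq : a.2.1.cell (e a.1) with
  | none =>
    refine ⟨fun _ => Obs.err, FSContinuous.const _, fun n => ?_, rfl⟩
    simp only [h1, h2, hq]
  | some q =>
    obtain ⟨g, hg, hgF⟩ := hF q a.1 a.2.1
    refine ⟨g, hg, fun n => ?_, hgF _ _ le_rfl⟩
    simp only [h1, h2, hq]
    have := hgF (c n).1 (c n).2.2 (ha.1 ⟨n, rfl⟩).1
    rw [← h1 n] at this
    exact this

theorem equivariant_access (e : Hom X (valCpo Loc))
    (F : Loc × (Val Loc × Val Loc) → X.prod ((heapCpo Loc).prod (contCpo Loc)) → Obs)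
    (hF : ∀ (π : FinPerm Loc) q p, F (π • q) (π • p) = F q p)
    (π : FinPerm Loc) (p : X.prod ((heapCpo Loc).prod (contCpo Loc))) :
    (match (π • p).2.1.cell (e (π • p).1) with
      | none => Obs.err
      | some q => F q (π • p)) =
    π • (match p.2.1.cell (e p.1) with
      | none => Obs.err
      | some q => F q p) := by
  have h : (π • p).2.1.cell (e (π • p).1) = π • p.2.1.cell (e p.1) := by
    have h1 : e (π • p).1 = π • e p.1 := e.equivariant π p.1
    rw [h1]
    exact Heap.cell_smul π p.2.1 (e p.1)
  rw [h]
  cases p.2.1.cell (e p.1) with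
  | none => rfl
  | some q => exact hF π q p

/-- Calling the continuation with a given heap. -/
def callWith : Hom ((heapCpo Loc).prod (X.prod ((heapCpo Loc).prod (contCpo Loc))))
    (obsCpo Loc) :=
  app (snd.comp (snd.comp snd)) fst

/-- Deallocation of the cell at `e x`. -/
def free (e : Hom X (valCpo Loc)) : Hom X (comCpo Loc) :=
  curry
    { toFun := fun p => match p.2.1.cell (e p.1) with
        | none => Obs.err
        | some q => p.2.2 (p.2.1.erase q.1)
      continuous := continuous_access e (fun q p => p.2.2 (p.2.1.erase q.1)) fun q _ h₀ =>
        ⟨_, (callWith.curry (h₀.erase q.1)).continuous, fun _ _ _ => rfl⟩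
      equivariant := equivariant_access e (fun q p => p.2.2 (p.2.1.erase q.1)) fun π q p => by
        refine Eq.trans ?_ (Fn.smul_apply_smul π p.2.2 (p.2.1.erase q.1))
        exact congrArg (π • p.2.2).toFun (Heap.smul_erase π p.2.1 q.1).symm }

/-- Binding the field `f` of the cell at `e x` and running `m`. -/
def lookup (e : Hom X (valCpo Loc)) (f : Fld) (m : Hom (X.prod (valCpo Loc)) (comCpo Loc)) :
    Hom X (comCpo Loc) :=
  curry
    { toFun := fun p => match p.2.1.cell (e p.1) with
        | none => Obs.err
        | some q => m (p.1, f.get q.2) p.2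
      continuous := continuous_access e (fun q p => m (p.1, f.get q.2) p.2) fun q _ _ =>
        let F : Hom ((valCpo Loc).prod (X.prod ((heapCpo Loc).prod (contCpo Loc)))) (obsCpo Loc) :=
          app (m.comp (pair (fst.comp snd) fst)) (snd.comp snd)
        ⟨_, (F.curry (f.get q.2)).continuous, fun _ _ _ => rfl⟩
      equivariant := equivariant_access e (fun q p => m (p.1, f.get q.2) p.2) fun π q p => by
        have h1 : m (π • p.1, f.get (π • q.2)) = π • m (p.1, f.get q.2) := by
          rw [Fld.get_smul]
          exact m.equivariant π (p.1, f.get q.2)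
        change m (π • p.1, f.get (π • q.2)) (π • p.2) = _
        rw [h1]
        exact Fn.smul_apply_smul π _ p.2 }

/-- Updating the field `f` of the cell at `e x` with the value `v x`. -/
def assign (e : Hom X (valCpo Loc)) (f : Fld) (v : Hom X (valCpo Loc)) : Hom X (comCpo Loc) :=
  curry
    { toFun := fun p => match p.2.1.cell (e p.1) with
        | none => Obs.err
        | some q => p.2.2 (p.2.1.update q.1 (f.set q.2 (v p.1)))
      continuous := continuous_access e
        (fun q p => p.2.2 (p.2.1.update q.1 (f.set q.2 (v p.1)))) fun q x₀ h₀ =>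
        ⟨_, (callWith.curry (h₀.update q.1 (f.set q.2 (v x₀)))).continuous, fun x k hx => by
          have : v x = v x₀ := v.monotone hx
          simp only [this]
          rfl⟩
      equivariant := equivariant_access e
        (fun q p => p.2.2 (p.2.1.update q.1 (f.set q.2 (v p.1)))) fun π q p => by
        have h1 : v (π • p.1) = π • v p.1 := v.equivariant π p.1
        have h2 : (π • p.2.1).update (π • q.1) (f.set (π • q.2) (v (π • p.1))) =
            π • p.2.1.update q.1 (f.set q.2 (v p.1)) := by
          rw [h1, Heap.smul_update, Fld.set_smul]
        refine Eq.trans ?_ (Fn.smul_apply_smul π p.2.2 (p.2.1.update q.1 (f.set q.2 (v p.1))))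
        exact congrArg (π • p.2.2).toFun h2 }

/-- The value of an identifier. -/
def var {n : ℕ} {Γ : List Ty} {τ : Ty} (x : Var Γ τ) : Hom (env Loc n Γ) (τ.den Loc) where
  toFun p := p.2 ⟨τ, x⟩
  continuous _ _ _ _ ha := lub_pi.1 (lub_snd ha) ⟨τ, x⟩
  equivariant _ _ := rfl

end Hom

/-- The meaning of a term, a morphism from environments to the meaning of its type. -/
def Term.hom (Loc : Type) [Infinite Loc] {n : ℕ} {Γ : List Ty} {τ : Ty} :
    Term n Γ τ → Hom (env Loc n Γ) (τ.den Loc)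
  | .var x => Hom.var x
  | .lamV M => Hom.curry ((M.hom Loc).comp extV)
  | .appV M E => Hom.app (M.hom Loc) E.hom
  | .lam M => Hom.curry ((M.hom Loc).comp extI)
  | .app M N => Hom.app (M.hom Loc) (N.hom Loc)
  | .fix M => Hom.fix.comp (M.hom Loc)
  | .ite E F M N => Hom.ite E.hom F.hom (M.hom Loc) (N.hom Loc)
  | .seq M N => Hom.seq (M.hom Loc) (N.hom Loc)
  | .new M => Hom.new ((M.hom Loc).comp extV)
  | .free E => Hom.free E.hom
  | .lookup E f M => Hom.lookup E.hom f ((M.hom Loc).comp extV)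
  | .assign E f F => Hom.assign E.hom f F.hom

/-- The meaning of a term in a stack environment and an identifier environment. -/
def Term.den [Infinite Loc] {n : ℕ} {Γ : List Ty} {τ : Ty} (M : Term n Γ τ) (ρ : senv Loc n)
    (η : ienv Loc Γ) : τ.den Loc :=
  M.hom Loc (ρ, η)

section equations

/-! The defining equations of the semantics of terms. -/

variable [Infinite Loc] {n : ℕ} {Γ : List Ty} {σ τ : Ty} (ρ : senv Loc n) (η : ienv Loc Γ)

theorem den_var (x : Var Γ τ) : (Term.var x).den ρ η = η ⟨τ, x⟩ := rfl

theorem den_lamV (M : Term (n + 1) Γ τ) (v : Val Loc) :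
    (Term.lamV M).den ρ η v = M.den (consV v ρ) η := rfl

theorem den_appV (M : Term n Γ (.val τ)) (E : Expr n) :
    (Term.appV M E).den ρ η = M.den ρ η (E.den ρ) := rfl

theorem den_lam (M : Term n (σ :: Γ) τ) (m : σ.den Loc) :
    (Term.lam M).den ρ η m = M.den ρ (consI m η) := rfl

theorem den_app (M : Term n Γ (.fn σ τ)) (N : Term n Γ σ) :
    (Term.app M N).den ρ η = M.den ρ η (N.den ρ η) := rfl

theorem den_fix (M : Term n Γ (.fn τ τ)) :
    (Term.fix M).den ρ η = leastfix (M.den ρ η) := rfl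

open Classical in
theorem den_ite (E F : Expr n) (M N : Term n Γ .com) :
    (Term.ite E F M N).den ρ η = if E.den ρ = F.den ρ then M.den ρ η else N.den ρ η := rfl

theorem den_seq (M N : Term n Γ .com) (h : Heap Loc) (k : contCpo Loc) :
    ∃ k' : contCpo Loc, (∀ h', k' h' = N.den ρ η (h', k)) ∧
      (Term.seq M N).den ρ η (h, k) = M.den ρ η (h, k') :=
  ⟨(N.hom Loc).thenCont ((ρ, η), k), fun _ => rfl, rfl⟩

theorem den_new (M : Term (n + 1) Γ .com) (h : Heap Loc) (k : contCpo Loc) (l : Loc)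
    (hl : l ∉ supp Loc (A := (env Loc n Γ).prod ((heapCpo Loc).prod (contCpo Loc)))
      ((ρ, η), (h, k))) :
    (Term.new M).den ρ η (h, k) =
      M.den (consV (.loc l) ρ) η (h.union (Heap.single l (.int 0, .int 0)), k) :=
  fresh_irrel (X := (env Loc n Γ).prod ((heapCpo Loc).prod (contCpo Loc)))
    (g := fun l x => ((M.hom Loc).comp extV).allocAt (.loc l, x))
    (fun π l x => ((M.hom Loc).comp extV).allocAt.equivariant π (.loc l, x))
    (fresh_spec (X := (env Loc n Γ).prod ((heapCpo Loc).prod (contCpo Loc))) _) hl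

theorem den_free (E : Expr n) (h : Heap Loc) (k : contCpo Loc) :
    (Term.free E : Term n Γ .com).den ρ η (h, k) = match h.cell (E.den ρ) with
      | none => Obs.err
      | some q => k (h.erase q.1) := rfl

theorem den_lookup (E : Expr n) (f : Fld) (M : Term (n + 1) Γ .com) (h : Heap Loc)
    (k : contCpo Loc) :
    (Term.lookup E f M).den ρ η (h, k) = match h.cell (E.den ρ) with
      | none => Obs.err
      | some q => M.den (consV (f.get q.2) ρ) η (h, k) := rfl

theorem den_assign (E F : Expr n) (f : Fld) (h : Heap Loc) (k : contCpo Loc) :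
    (Term.assign E f F : Term n Γ .com).den ρ η (h, k) = match h.cell (E.den ρ) with
      | none => Obs.err
      | some q => k (h.update q.1 (f.set q.2 (F.den ρ))) := rfl

end equations

/-! ### Renaming and capture-avoiding substitution -/

/-- Renamings of identifiers. -/
def Ren (Γ Γ' : List Ty) : Type := ∀ τ : Ty, Var Γ τ → Var Γ' τ

/-- A renaming of stack variables under a binder. -/
def liftV {n m : ℕ} (f : Fin n → Fin m) : Fin (n + 1) → Fin (m + 1) :=
  Fin.cases 0 fun i => (f i).succ

/-- A renaming of identifiers under a binder. -/
def Ren.lift {Γ Γ' : List Ty} {σ : Ty} (g : Ren Γ Γ') : Ren (σ :: Γ) (σ :: Γ')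
  | _, .zero => .zero
  | _, .succ x => .succ (g _ x)

/-- Renaming of stack variables in an expression. -/
def Expr.rename {n m : ℕ} (f : Fin n → Fin m) : Expr n → Expr m
  | .var i => .var (f i)
  | .zero => .zero
  | .one => .one
  | .negOne => .negOne
  | .add E F => .add (E.rename f) (F.rename f)
  | .sub E F => .sub (E.rename f) (F.rename f)

/-- Weakening of an expression by a new stack variable. -/
def Expr.wk {n : ℕ} (E : Expr n) : Expr (n + 1) := E.rename Fin.succ

/-- Simultaneous substitution in an expression. -/
def Expr.subst {n m : ℕ} (s : Fin n → Expr m) : Expr n → Expr m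
  | .var i => s i
  | .zero => .zero
  | .one => .one
  | .negOne => .negOne
  | .add E F => .add (E.subst s) (F.subst s)
  | .sub E F => .sub (E.subst s) (F.subst s)

/-- A substitution for stack variables under a binder. -/
def substLiftV {n m : ℕ} (s : Fin n → Expr m) : Fin (n + 1) → Expr (m + 1) :=
  Fin.cases (.var 0) fun i => (s i).wk

/-- The substitution of `E` for the most recent stack variable. -/
def substOneV {n : ℕ} (E : Expr n) : Fin (n + 1) → Expr n :=
  Fin.cases E fun i => .var i

/-- Simultaneous renaming of stack variables and identifiers in a term. -/
def Term.rename {n m : ℕ} {Γ Γ' : List Ty} {τ : Ty} (f : Fin n → Fin m) (g : Ren Γ Γ') :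
    Term n Γ τ → Term m Γ' τ
  | .var x => .var (g _ x)
  | .lamV M => .lamV (M.rename (liftV f) g)
  | .appV M E => .appV (M.rename f g) (E.rename f)
  | .lam M => .lam (M.rename f g.lift)
  | .app M N => .app (M.rename f g) (N.rename f g)
  | .fix M => .fix (M.rename f g)
  | .ite E F M N => .ite (E.rename f) (F.rename f) (M.rename f g) (N.rename f g)
  | .seq M N => .seq (M.rename f g) (N.rename f g)
  | .new M => .new (M.rename (liftV f) g)
  | .free E => .free (E.rename f)
  | .lookup E fl M => .lookup (E.rename f) fl (M.rename (liftV f) g)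
  | .assign E fl F => .assign (E.rename f) fl (F.rename f)

/-- Weakening of a term by a new stack variable. -/
def Term.wkV {n : ℕ} {Γ : List Ty} {τ : Ty} (M : Term n Γ τ) : Term (n + 1) Γ τ :=
  M.rename Fin.succ fun _ x => x

/-- Weakening of a term by a new identifier. -/
def Term.wkI {n : ℕ} {Γ : List Ty} {σ τ : Ty} (M : Term n Γ τ) : Term n (σ :: Γ) τ :=
  M.rename id fun _ x => .succ x

/-- Substitutions of terms for identifiers. -/
def Sub (n : ℕ) (Γ Γ' : List Ty) : Type := ∀ τ : Ty, Var Γ τ → Term n Γ' τ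

/-- The identity substitution. -/
def Sub.ids {n : ℕ} {Γ : List Ty} : Sub n Γ Γ := fun _ x => .var x

/-- A substitution for identifiers under a binder of a stack variable. -/
def Sub.wkV {n : ℕ} {Γ Γ' : List Ty} (t : Sub n Γ Γ') : Sub (n + 1) Γ Γ' :=
  fun _ x => (t _ x).wkV

/-- A substitution for identifiers under a binder of an identifier. -/
def Sub.lift {n : ℕ} {Γ Γ' : List Ty} {σ : Ty} (t : Sub n Γ Γ') : Sub n (σ :: Γ) (σ :: Γ')
  | _, .zero => .var .zero
  | _, .succ x => (t _ x).wkI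

/-- The substitution of `N` for the most recent identifier. -/
def Sub.one {n : ℕ} {Γ : List Ty} {σ : Ty} (N : Term n Γ σ) : Sub n (σ :: Γ) Γ
  | _, .zero => N
  | _, .succ x => .var x

/-- Simultaneous substitution for stack variables and identifiers in a term. -/
def Term.subst {n m : ℕ} {Γ Γ' : List Ty} {τ : Ty} (s : Fin n → Expr m) (t : Sub m Γ Γ') :
    Term n Γ τ → Term m Γ' τ
  | .var x => t _ x
  | .lamV M => .lamV (M.subst (substLiftV s) t.wkV)
  | .appV M E => .appV (M.subst s t) (E.subst s)
  | .lam M => .lam (M.subst s t.lift)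
  | .app M N => .app (M.subst s t) (N.subst s t)
  | .fix M => .fix (M.subst s t)
  | .ite E F M N => .ite (E.subst s) (F.subst s) (M.subst s t) (N.subst s t)
  | .seq M N => .seq (M.subst s t) (N.subst s t)
  | .new M => .new (M.subst (substLiftV s) t.wkV)
  | .free E => .free (E.subst s)
  | .lookup E f M => .lookup (E.subst s) f (M.subst (substLiftV s) t.wkV)
  | .assign E f F => .assign (E.subst s) f (F.subst s)

/-- `M[E/i]` for the most recent stack variable `i`. -/
def Term.instV {n : ℕ} {Γ : List Ty} {τ : Ty} (M : Term (n + 1) Γ τ) (E : Expr n) : Term n Γ τ :=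
  M.subst (substOneV E) Sub.ids

/-- `M[N/x]` for the most recent identifier `x`. -/
def Term.instI {n : ℕ} {Γ : List Ty} {σ τ : Ty} (M : Term n (σ :: Γ) τ) (N : Term n Γ σ) :
    Term n Γ τ :=
  M.subst Expr.var (Sub.one N)

/-! ### Assertions -/

/-- Assertions over `n` stack variables. -/
inductive Assertion : ℕ → Type
  | eq {n : ℕ} (E F : Expr n) : Assertion n
  | le {n : ℕ} (E F : Expr n) : Assertion n
  /-- `E ↦ E₀, E₁` -/
  | pointsTo {n : ℕ} (E E₀ E₁ : Expr n) : Assertion n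
  | emp {n : ℕ} : Assertion n
  | star {n : ℕ} (P Q : Assertion n) : Assertion n
  | and {n : ℕ} (P Q : Assertion n) : Assertion n
  | not {n : ℕ} (P : Assertion n) : Assertion n
  | ex {n : ℕ} (P : Assertion (n + 1)) : Assertion n

namespace Assertion

/-- Renaming of stack variables in an assertion. -/
def rename {n m : ℕ} (f : Fin n → Fin m) : Assertion n → Assertion m
  | .eq E F => .eq (E.rename f) (F.rename f)
  | .le E F => .le (E.rename f) (F.rename f)
  | .pointsTo E E₀ E₁ => .pointsTo (E.rename f) (E₀.rename f) (E₁.rename f)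
  | .emp => .emp
  | .star P Q => .star (P.rename f) (Q.rename f)
  | .and P Q => .and (P.rename f) (Q.rename f)
  | .not P => .not (P.rename f)
  | .ex P => .ex (P.rename (liftV f))

/-- Weakening of an assertion by a new stack variable. -/
def wk {n : ℕ} (P : Assertion n) : Assertion (n + 1) := P.rename Fin.succ

/-- Simultaneous substitution in an assertion. -/
def subst {n m : ℕ} (s : Fin n → Expr m) : Assertion n → Assertion m
  | .eq E F => .eq (E.subst s) (F.subst s)
  | .le E F => .le (E.subst s) (F.subst s)
  | .pointsTo E E₀ E₁ => .pointsTo (E.subst s) (E₀.subst s) (E₁.subst s)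
  | .emp => .emp
  | .star P Q => .star (P.subst s) (Q.subst s)
  | .and P Q => .and (P.subst s) (Q.subst s)
  | .not P => .not (P.subst s)
  | .ex P => .ex (P.subst (substLiftV s))

/-- Classical disjunction. -/
def or {n : ℕ} (P Q : Assertion n) : Assertion n := .not (.and (.not P) (.not Q))

/-- The heap has exactly one cell, at `E`, whose field `f` contains `V` and whose other field
contains `W`: `E ↦ V, W` for the field `0`, and `E ↦ W, V` for the field `1`. -/
def field {n : ℕ} (E : Expr n) : Fld → Expr n → Expr n → Assertion n
  | .f0, V, W => .pointsTo E V W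
  | .f1, V, W => .pointsTo E W V

/-- `E ↦ -`, that is, `∃ i j. E ↦ i, j`. -/
def cell {n : ℕ} (E : Expr n) : Assertion n :=
  .ex (.ex (.pointsTo E.wk.wk (.var 1) (.var 0)))

/-- `E ↦ -, W` for the field `0`, and `E ↦ W, -` for the field `1`. -/
def cellExcept {n : ℕ} (E : Expr n) (f : Fld) (W : Expr n) : Assertion n :=
  .ex (field E.wk f (.var 0) W.wk)

/-- The standard meaning of an assertion as a set of heaps. -/
def den {n : ℕ} : Assertion n → senv Loc n → Set (Heap Loc)
  | .eq E F, ρ => {_h | E.den ρ = F.den ρ}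
  | .le E F, ρ => {_h | ∃ a b : ℤ, E.den ρ = .int a ∧ F.den ρ = .int b ∧ a ≤ b}
  | .pointsTo E E₀ E₁, ρ => {h | ∃ l, E.den ρ = .loc l ∧ h = Heap.single l (E₀.den ρ, E₁.den ρ)}
  | .emp, _ => {Heap.empty}
  | .star P Q, ρ => {h | ∃ h₀ ∈ P.den ρ, ∃ h₁ ∈ Q.den ρ, h₀.Disj h₁ ∧ h₀.union h₁ = h}
  | .and P Q, ρ => P.den ρ ∩ Q.den ρ
  | .not P, ρ => (P.den ρ)ᶜ
  | .ex P, ρ => {h | ∃ v : Val Loc, h ∈ P.den (consV v ρ)}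

theorem den_smul {n : ℕ} (P : Assertion n) (π : FinPerm Loc) (ρ : senv Loc n) (h : Heap Loc) :
    π • h ∈ P.den (π • ρ) ↔ h ∈ P.den ρ := by
  have mp : ∀ {n : ℕ} (P : Assertion n),
      (∀ (π : FinPerm Loc) (ρ : senv Loc n) (h : Heap Loc),
        h ∈ P.den ρ → π • h ∈ P.den (π • ρ)) →
      ∀ (π : FinPerm Loc) (ρ : senv Loc n) (h : Heap Loc),
        π • h ∈ P.den (π • ρ) ↔ h ∈ P.den ρ := by
    intro n P H π ρ h
    refine ⟨fun h1 => ?_, H π ρ h⟩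
    have := H π⁻¹ _ _ h1
    rwa [inv_smul_smul, inv_smul_smul] at this
  revert π ρ h
  induction P with
  | eq E F =>
    intro π ρ h
    change E.den (π • ρ) = F.den (π • ρ) ↔ E.den ρ = F.den ρ
    rw [Expr.den_smul, Expr.den_smul, smul_left_cancel_iff]
  | le E F =>
    refine mp _ fun π ρ h => ?_
    rintro ⟨a, b, ha, hb, hab⟩
    exact ⟨a, b, by rw [Expr.den_smul, ha]; rfl, by rw [Expr.den_smul, hb]; rfl, hab⟩
  | pointsTo E E₀ E₁ =>
    refine mp _ fun π ρ h => ?_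
    rintro ⟨l, hl, rfl⟩
    exact ⟨π • l, by rw [Expr.den_smul, hl]; rfl, by
      rw [Heap.smul_single, Expr.den_smul, Expr.den_smul]; rfl⟩
  | emp =>
    refine mp _ fun π ρ h => ?_
    rintro rfl
    exact Heap.smul_empty π
  | star P Q ihP ihQ =>
    refine mp _ fun π ρ h => ?_
    rintro ⟨h₀, hP, h₁, hQ, hd, rfl⟩
    exact ⟨π • h₀, (ihP π ρ h₀).2 hP, π • h₁, (ihQ π ρ h₁).2 hQ, Heap.smul_disj π hd,
      (Heap.smul_union π h₀ h₁).symm⟩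
  | and P Q ihP ihQ =>
    intro π ρ h
    exact and_congr (ihP π ρ h) (ihQ π ρ h)
  | not P ih =>
    intro π ρ h
    exact not_congr (ih π ρ h)
  | ex P ih =>
    refine mp _ fun π ρ h => ?_
    rintro ⟨v, hv⟩
    refine ⟨π • v, ?_⟩
    have h1 := (ih π (consV v ρ) h).2 hv
    have h2 : π • consV v ρ = consV (π • v) (π • ρ) := by
      funext i
      refine Fin.cases ?_ (fun i => ?_) i <;> rfl
    rwa [h2] at h1

end Assertion

/-! ### Specifications -/

/-- Specifications `φ` with `Δ | Γ ⊢ φ : Specs`. -/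
inductive Spec : ℕ → List Ty → Type
  /-- the Hoare triple `{P} M {Q}` -/
  | triple {n : ℕ} {Γ : List Ty} (P : Assertion n) (M : Term n Γ .com) (Q : Assertion n) : Spec n Γ
  /-- invariant extension `φ ⊗ P` -/
  | inv {n : ℕ} {Γ : List Ty} (φ : Spec n Γ) (P : Assertion n) : Spec n Γ
  /-- `E = F` -/
  | eqE {n : ℕ} {Γ : List Ty} (E F : Expr n) : Spec n Γ
  /-- `M = N` -/
  | eqT {n : ℕ} {Γ : List Ty} {τ : Ty} (M N : Term n Γ τ) : Spec n Γ
  | and {n : ℕ} {Γ : List Ty} (φ ψ : Spec n Γ) : Spec n Γ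
  | or {n : ℕ} {Γ : List Ty} (φ ψ : Spec n Γ) : Spec n Γ
  | imp {n : ℕ} {Γ : List Ty} (φ ψ : Spec n Γ) : Spec n Γ
  /-- `∀ x : τ. φ` -/
  | allI {n : ℕ} {Γ : List Ty} (τ : Ty) (φ : Spec n (τ :: Γ)) : Spec n Γ
  /-- `∃ x : τ. φ` -/
  | exI {n : ℕ} {Γ : List Ty} (τ : Ty) (φ : Spec n (τ :: Γ)) : Spec n Γ
  /-- `∀ i. φ` -/
  | allV {n : ℕ} {Γ : List Ty} (φ : Spec (n + 1) Γ) : Spec n Γ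
  /-- `∃ i. φ` -/
  | exV {n : ℕ} {Γ : List Ty} (φ : Spec (n + 1) Γ) : Spec n Γ

namespace Spec

/-- Logical equivalence. -/
def iff {n : ℕ} {Γ : List Ty} (φ ψ : Spec n Γ) : Spec n Γ := .and (.imp φ ψ) (.imp ψ φ)

/-- Simultaneous renaming of stack variables and identifiers in a specification. -/
def rename {n m : ℕ} {Γ Γ' : List Ty} (f : Fin n → Fin m) (g : Ren Γ Γ') :
    Spec n Γ → Spec m Γ'
  | .triple P M Q => .triple (P.rename f) (M.rename f g) (Q.rename f)
  | .inv φ P => .inv (φ.rename f g) (P.rename f)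
  | .eqE E F => .eqE (E.rename f) (F.rename f)
  | .eqT M N => .eqT (M.rename f g) (N.rename f g)
  | .and φ ψ => .and (φ.rename f g) (ψ.rename f g)
  | .or φ ψ => .or (φ.rename f g) (ψ.rename f g)
  | .imp φ ψ => .imp (φ.rename f g) (ψ.rename f g)
  | .allI τ φ => .allI τ (φ.rename f g.lift)
  | .exI τ φ => .exI τ (φ.rename f g.lift)
  | .allV φ => .allV (φ.rename (liftV f) g)
  | .exV φ => .exV (φ.rename (liftV f) g)

/-- Weakening of a specification by a new stack variable. -/
def wkV {n : ℕ} {Γ : List Ty} (φ : Spec n Γ) : Spec (n + 1) Γ := φ.rename Fin.succ fun _ x => x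

/-- Weakening of a specification by a new identifier. -/
def wkI {n : ℕ} {Γ : List Ty} {σ : Ty} (φ : Spec n Γ) : Spec n (σ :: Γ) :=
  φ.rename id fun _ x => .succ x

/-- Simultaneous substitution for stack variables and identifiers in a specification. -/
def subst {n m : ℕ} {Γ Γ' : List Ty} (s : Fin n → Expr m) (t : Sub m Γ Γ') :
    Spec n Γ → Spec m Γ'
  | .triple P M Q => .triple (P.subst s) (M.subst s t) (Q.subst s)
  | .inv φ P => .inv (φ.subst s t) (P.subst s)
  | .eqE E F => .eqE (E.subst s) (F.subst s)
  | .eqT M N => .eqT (M.subst s t) (N.subst s t)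
  | .and φ ψ => .and (φ.subst s t) (ψ.subst s t)
  | .or φ ψ => .or (φ.subst s t) (ψ.subst s t)
  | .imp φ ψ => .imp (φ.subst s t) (ψ.subst s t)
  | .allI τ φ => .allI τ (φ.subst s t.lift)
  | .exI τ φ => .exI τ (φ.subst s t.lift)
  | .allV φ => .allV (φ.subst (substLiftV s) t.wkV)
  | .exV φ => .exV (φ.subst (substLiftV s) t.wkV)

/-- `φ[E/i]` for the most recent stack variable `i`. -/
def instV {n : ℕ} {Γ : List Ty} (φ : Spec (n + 1) Γ) (E : Expr n) : Spec n Γ :=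
  φ.subst (substOneV E) Sub.ids

/-- `φ[N/x]` for the most recent identifier `x`. -/
def instI {n : ℕ} {Γ : List Ty} {σ : Ty} (φ : Spec n (σ :: Γ)) (N : Term n Γ σ) : Spec n Γ :=
  φ.subst Expr.var (Sub.one N)

end Spec

/-! ### Contexts for fixed-point induction -/

/-- Term contexts
`C ::= [] | λ i. C | C E | λ x : σ. C | C M | fix C | C; M` with a hole of type `θ`. -/
inductive TCtx (θ : Ty) : ℕ → List Ty → Ty → Type
  | hole {n : ℕ} {Γ : List Ty} : TCtx θ n Γ θ
  | lamV {n : ℕ} {Γ : List Ty} {τ : Ty} (C : TCtx θ (n + 1) Γ τ) : TCtx θ n Γ (.val τ)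
  | appV {n : ℕ} {Γ : List Ty} {τ : Ty} (C : TCtx θ n Γ (.val τ)) (E : Expr n) : TCtx θ n Γ τ
  | lam {n : ℕ} {Γ : List Ty} {σ τ : Ty} (C : TCtx θ n (σ :: Γ) τ) : TCtx θ n Γ (.fn σ τ)
  | app {n : ℕ} {Γ : List Ty} {σ τ : Ty} (C : TCtx θ n Γ (.fn σ τ)) (M : Term n Γ σ) :
      TCtx θ n Γ τ
  | fix {n : ℕ} {Γ : List Ty} {τ : Ty} (C : TCtx θ n Γ (.fn τ τ)) : TCtx θ n Γ τ
  | seq {n : ℕ} {Γ : List Ty} (C : TCtx θ n Γ .com) (M : Term n Γ .com) : TCtx θ n Γ .com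

namespace TCtx

variable {θ : Ty}

/-- Renaming in a term context. -/
def rename {n m : ℕ} {Γ Γ' : List Ty} {τ : Ty} (f : Fin n → Fin m) (g : Ren Γ Γ') :
    TCtx θ n Γ τ → TCtx θ m Γ' τ
  | .hole => .hole
  | .lamV C => .lamV (C.rename (liftV f) g)
  | .appV C E => .appV (C.rename f g) (E.rename f)
  | .lam C => .lam (C.rename f g.lift)
  | .app C M => .app (C.rename f g) (M.rename f g)
  | .fix C => .fix (C.rename f g)
  | .seq C M => .seq (C.rename f g) (M.rename f g)

/-- Capture-avoiding insertion of `N` into the hole. -/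
def fill {n : ℕ} {Γ : List Ty} {τ : Ty} : TCtx θ n Γ τ → Term n Γ θ → Term n Γ τ
  | .hole, N => N
  | .lamV C, N => .lamV (C.fill N.wkV)
  | .appV C E, N => .appV (C.fill N) E
  | .lam C, N => .lam (C.fill N.wkI)
  | .app C M, N => .app (C.fill N) M
  | .fix C, N => .fix (C.fill N)
  | .seq C M, N => .seq (C.fill N) M

end TCtx

/-- Specification contexts `γ ::= {P} C {Q} | γ ∧ γ | ∀ x : τ. γ | ∀ i. γ`, with holes of
type `θ`. -/
inductive SCtx (θ : Ty) : ℕ → List Ty → Type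
  | triple {n : ℕ} {Γ : List Ty} (P : Assertion n) (C : TCtx θ n Γ .com) (Q : Assertion n) :
      SCtx θ n Γ
  | and {n : ℕ} {Γ : List Ty} (γ δ : SCtx θ n Γ) : SCtx θ n Γ
  | allI {n : ℕ} {Γ : List Ty} (τ : Ty) (γ : SCtx θ n (τ :: Γ)) : SCtx θ n Γ
  | allV {n : ℕ} {Γ : List Ty} (γ : SCtx θ (n + 1) Γ) : SCtx θ n Γ

namespace SCtx

variable {θ : Ty}

/-- Renaming in a specification context. -/
def rename {n m : ℕ} {Γ Γ' : List Ty} (f : Fin n → Fin m) (g : Ren Γ Γ') :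
    SCtx θ n Γ → SCtx θ m Γ'
  | .triple P C Q => .triple (P.rename f) (C.rename f g) (Q.rename f)
  | .and γ δ => .and (γ.rename f g) (δ.rename f g)
  | .allI τ γ => .allI τ (γ.rename f g.lift)
  | .allV γ => .allV (γ.rename (liftV f) g)

/-- Weakening of a specification context by a new identifier. -/
def wkI {n : ℕ} {Γ : List Ty} {σ : Ty} (γ : SCtx θ n Γ) : SCtx θ n (σ :: Γ) :=
  γ.rename id fun _ x => .succ x

/-- Capture-avoiding insertion of `N` into all holes. -/
def fill {n : ℕ} {Γ : List Ty} : SCtx θ n Γ → Term n Γ θ → Spec n Γ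
  | .triple P C Q, N => .triple P (C.fill N) Q
  | .and γ δ, N => .and (γ.fill N) (δ.fill N)
  | .allI τ γ, N => .allI τ (γ.fill N.wkI)
  | .allV γ, N => .allV (γ.fill N.wkV)

end SCtx

/-! ### Provability

`Provable Loc Φ φ` is derivability of `φ` from the hypotheses `Φ`, in natural deduction style; a
judgment `Δ | Γ ⊢ φ` without hypotheses is `Provable Loc [] φ`. Side conditions `i ∉ fv(-)` are
expressed by weakening. The parameter `Loc` enters only through the semantic side condition of the
rule of consequence. -/

open Assertion in
/-- Provability in the logic. -/
inductive Provable (Loc : Type) :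
    {n : ℕ} → {Γ : List Ty} → List (Spec n Γ) → Spec n Γ → Prop
  -- first-order intuitionistic logic
  | hyp {n : ℕ} {Γ : List Ty} {Φ : List (Spec n Γ)} {φ : Spec n Γ} :
      φ ∈ Φ → Provable Loc Φ φ
  | andI {n : ℕ} {Γ : List Ty} {Φ : List (Spec n Γ)} {φ ψ : Spec n Γ} :
      Provable Loc Φ φ → Provable Loc Φ ψ → Provable Loc Φ (.and φ ψ)
  | andE₁ {n : ℕ} {Γ : List Ty} {Φ : List (Spec n Γ)} {φ ψ : Spec n Γ} :
      Provable Loc Φ (.and φ ψ) → Provable Loc Φ φ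
  | andE₂ {n : ℕ} {Γ : List Ty} {Φ : List (Spec n Γ)} {φ ψ : Spec n Γ} :
      Provable Loc Φ (.and φ ψ) → Provable Loc Φ ψ
  | orI₁ {n : ℕ} {Γ : List Ty} {Φ : List (Spec n Γ)} {φ ψ : Spec n Γ} :
      Provable Loc Φ φ → Provable Loc Φ (.or φ ψ)
  | orI₂ {n : ℕ} {Γ : List Ty} {Φ : List (Spec n Γ)} {φ ψ : Spec n Γ} :
      Provable Loc Φ ψ → Provable Loc Φ (.or φ ψ)
  | orE {n : ℕ} {Γ : List Ty} {Φ : List (Spec n Γ)} {φ ψ χ : Spec n Γ} :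
      Provable Loc Φ (.or φ ψ) → Provable Loc (φ :: Φ) χ → Provable Loc (ψ :: Φ) χ →
      Provable Loc Φ χ
  | impI {n : ℕ} {Γ : List Ty} {Φ : List (Spec n Γ)} {φ ψ : Spec n Γ} :
      Provable Loc (φ :: Φ) ψ → Provable Loc Φ (.imp φ ψ)
  | impE {n : ℕ} {Γ : List Ty} {Φ : List (Spec n Γ)} {φ ψ : Spec n Γ} :
      Provable Loc Φ (.imp φ ψ) → Provable Loc Φ φ → Provable Loc Φ ψ
  /-- ex falso; the grammar has no symbol for falsity, which is expressed by `0 = 1` -/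
  | exFalso {n : ℕ} {Γ : List Ty} {Φ : List (Spec n Γ)} {φ : Spec n Γ} :
      Provable Loc Φ (.eqE .zero .one) → Provable Loc Φ φ
  | allVI {n : ℕ} {Γ : List Ty} {Φ : List (Spec n Γ)} {φ : Spec (n + 1) Γ} :
      Provable Loc (Φ.map Spec.wkV) φ → Provable Loc Φ (.allV φ)
  | allVE {n : ℕ} {Γ : List Ty} {Φ : List (Spec n Γ)} {φ : Spec (n + 1) Γ} (E : Expr n) :
      Provable Loc Φ (.allV φ) → Provable Loc Φ (φ.instV E)
  | exVI {n : ℕ} {Γ : List Ty} {Φ : List (Spec n Γ)} {φ : Spec (n + 1) Γ} (E : Expr n) :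
      Provable Loc Φ (φ.instV E) → Provable Loc Φ (.exV φ)
  | exVE {n : ℕ} {Γ : List Ty} {Φ : List (Spec n Γ)} {φ : Spec (n + 1) Γ} {ψ : Spec n Γ} :
      Provable Loc Φ (.exV φ) → Provable Loc (φ :: Φ.map Spec.wkV) ψ.wkV → Provable Loc Φ ψ
  | allII {n : ℕ} {Γ : List Ty} {Φ : List (Spec n Γ)} {τ : Ty} {φ : Spec n (τ :: Γ)} :
      Provable Loc (Φ.map Spec.wkI) φ → Provable Loc Φ (.allI τ φ)
  | allIE {n : ℕ} {Γ : List Ty} {Φ : List (Spec n Γ)} {τ : Ty} {φ : Spec n (τ :: Γ)}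
      (M : Term n Γ τ) : Provable Loc Φ (.allI τ φ) → Provable Loc Φ (φ.instI M)
  | exII {n : ℕ} {Γ : List Ty} {Φ : List (Spec n Γ)} {τ : Ty} {φ : Spec n (τ :: Γ)}
      (M : Term n Γ τ) : Provable Loc Φ (φ.instI M) → Provable Loc Φ (.exI τ φ)
  | exIE {n : ℕ} {Γ : List Ty} {Φ : List (Spec n Γ)} {τ : Ty} {φ : Spec n (τ :: Γ)}
      {ψ : Spec n Γ} :
      Provable Loc Φ (.exI τ φ) → Provable Loc (φ :: Φ.map Spec.wkI) ψ.wkI → Provable Loc Φ ψ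
  -- equality
  | reflE {n : ℕ} {Γ : List Ty} {Φ : List (Spec n Γ)} (E : Expr n) : Provable Loc Φ (.eqE E E)
  | substE {n : ℕ} {Γ : List Ty} {Φ : List (Spec n Γ)} {E F : Expr n} (φ : Spec (n + 1) Γ) :
      Provable Loc Φ (.eqE E F) → Provable Loc Φ (φ.instV E) → Provable Loc Φ (φ.instV F)
  | reflT {n : ℕ} {Γ : List Ty} {Φ : List (Spec n Γ)} {τ : Ty} (M : Term n Γ τ) :
      Provable Loc Φ (.eqT M M)
  | substT {n : ℕ} {Γ : List Ty} {Φ : List (Spec n Γ)} {τ : Ty} {M N : Term n Γ τ}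
      (φ : Spec n (τ :: Γ)) :
      Provable Loc Φ (.eqT M N) → Provable Loc Φ (φ.instI M) → Provable Loc Φ (φ.instI N)
  -- the equational theory of the functional part of the language
  | betaV {n : ℕ} {Γ : List Ty} {Φ : List (Spec n Γ)} {τ : Ty} (M : Term (n + 1) Γ τ)
      (E : Expr n) : Provable Loc Φ (.eqT (.appV (.lamV M) E) (M.instV E))
  | betaI {n : ℕ} {Γ : List Ty} {Φ : List (Spec n Γ)} {σ τ : Ty} (M : Term n (σ :: Γ) τ)
      (N : Term n Γ σ) : Provable Loc Φ (.eqT (.app (.lam M) N) (M.instI N))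
  | etaV {n : ℕ} {Γ : List Ty} {Φ : List (Spec n Γ)} {τ : Ty} (M : Term n Γ (.val τ)) :
      Provable Loc Φ (.eqT (.lamV (.appV M.wkV (.var 0))) M)
  | etaI {n : ℕ} {Γ : List Ty} {Φ : List (Spec n Γ)} {σ τ : Ty} (M : Term n Γ (.fn σ τ)) :
      Provable Loc Φ (.eqT (.lam (.app M.wkI (.var .zero))) M)
  | xiV {n : ℕ} {Γ : List Ty} {Φ : List (Spec n Γ)} {τ : Ty} (M N : Term (n + 1) Γ τ) :
      Provable Loc Φ (.imp (.allV (.eqT M N)) (.eqT (.lamV M) (.lamV N)))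
  | xiI {n : ℕ} {Γ : List Ty} {Φ : List (Spec n Γ)} {σ τ : Ty} (M N : Term n (σ :: Γ) τ) :
      Provable Loc Φ (.imp (.allI σ (.eqT M N)) (.eqT (.lam M) (.lam N)))
  | unfold {n : ℕ} {Γ : List Ty} {Φ : List (Spec n Γ)} {τ : Ty} (M : Term n Γ (.fn τ τ)) :
      Provable Loc Φ (.eqT (.fix M) (.app M (.fix M)))
  -- Hoare triples
  | existsRule {n : ℕ} {Γ : List Ty} {Φ : List (Spec n Γ)} (P Q : Assertion (n + 1))
      (M : Term n Γ .com) :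
      Provable Loc Φ (.imp (.allV (.triple P M.wkV Q)) (.triple (.ex P) M (.ex Q)))
  | disjRule {n : ℕ} {Γ : List Ty} {Φ : List (Spec n Γ)} (P P' Q Q' : Assertion n)
      (M : Term n Γ .com) :
      Provable Loc Φ (.imp (.and (.triple P M Q) (.triple P' M Q'))
        (.triple (P.or P') M (Q.or Q')))
  | iteRule {n : ℕ} {Γ : List Ty} {Φ : List (Spec n Γ)} (P Q : Assertion n) (E F : Expr n)
      (M N : Term n Γ .com) :
      Provable Loc Φ (.imp
        (.and (.triple (.and P (.eq E F)) M Q) (.triple (.and P (.not (.eq E F))) N Q))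
        (.triple P (.ite E F M N) Q))
  | seqRule {n : ℕ} {Γ : List Ty} {Φ : List (Spec n Γ)} (P P₀ Q : Assertion n)
      (M N : Term n Γ .com) :
      Provable Loc Φ (.imp (.and (.triple P M P₀) (.triple P₀ N Q)) (.triple P (.seq M N) Q))
  | newRule {n : ℕ} {Γ : List Ty} {Φ : List (Spec n Γ)} (P Q : Assertion n)
      (M : Term (n + 1) Γ .com) :
      Provable Loc Φ (.imp
        (.allV (.triple (.star P.wk (.pointsTo (.var 0) .zero .zero)) M Q.wk))
        (.triple P (.new M) Q))
  /-- `(∀ i. {P * E ↦ i, W} M {Q}) ⇒ {∃ i. P * E ↦ i, W} let i = E.0 in M {Q}`, and the same for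
  the field `1` -/
  | lookupRule {n : ℕ} {Γ : List Ty} {Φ : List (Spec n Γ)} (f : Fld) (P : Assertion (n + 1))
      (Q : Assertion n) (E : Expr n) (W : Expr (n + 1)) (M : Term (n + 1) Γ .com) :
      Provable Loc Φ (.imp
        (.allV (.triple (.star P (field E.wk f (.var 0) W)) M Q.wk))
        (.triple (.ex (.star P (field E.wk f (.var 0) W))) (.lookup E f M) Q))
  | freeRule {n : ℕ} {Γ : List Ty} {Φ : List (Spec n Γ)} (E : Expr n) :
      Provable Loc Φ (.triple (cell E) (.free E) .emp)
  /-- `{E ↦ -, W} E.0 := F {E ↦ F, W}`, and the same for the field `1` -/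
  | assignRule {n : ℕ} {Γ : List Ty} {Φ : List (Spec n Γ)} (f : Fld) (E F W : Expr n) :
      Provable Loc Φ (.triple (cellExcept E f W) (.assign E f F) (field E f F W))
  | consequence {n : ℕ} {Γ : List Ty} {Φ : List (Spec n Γ)} (P P' Q Q' : Assertion n)
      (M : Term n Γ .com) :
      (∀ ρ : senv Loc n, P.den ρ ⊆ P'.den ρ) → (∀ ρ : senv Loc n, Q'.den ρ ⊆ Q.den ρ) →
      Provable Loc Φ (.imp (.triple P' M Q') (.triple P M Q))
  -- invariant extension
  | invIntro {n : ℕ} {Γ : List Ty} {Φ : List (Spec n Γ)} (φ : Spec n Γ) (P : Assertion n) :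
      Provable Loc Φ (.imp φ (.inv φ P))
  | invTriple {n : ℕ} {Γ : List Ty} {Φ : List (Spec n Γ)} (P P' Q : Assertion n)
      (M : Term n Γ .com) :
      Provable Loc Φ (.iff (.inv (.triple P M P') Q) (.triple (.star P Q) M (.star P' Q)))
  | invEqE {n : ℕ} {Γ : List Ty} {Φ : List (Spec n Γ)} (E F : Expr n) (Q : Assertion n) :
      Provable Loc Φ (.iff (.inv (.eqE E F) Q) (.eqE E F))
  | invEqT {n : ℕ} {Γ : List Ty} {Φ : List (Spec n Γ)} {τ : Ty} (M N : Term n Γ τ)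
      (Q : Assertion n) : Provable Loc Φ (.iff (.inv (.eqT M N) Q) (.eqT M N))
  | invInv {n : ℕ} {Γ : List Ty} {Φ : List (Spec n Γ)} (φ : Spec n Γ) (P Q : Assertion n) :
      Provable Loc Φ (.iff (.inv (.inv φ P) Q) (.inv φ (.star P Q)))
  | invImp {n : ℕ} {Γ : List Ty} {Φ : List (Spec n Γ)} (φ ψ : Spec n Γ) (P : Assertion n) :
      Provable Loc Φ (.iff (.inv (.imp φ ψ) P) (.imp (.inv φ P) (.inv ψ P)))
  | invAnd {n : ℕ} {Γ : List Ty} {Φ : List (Spec n Γ)} (φ ψ : Spec n Γ) (P : Assertion n) :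
      Provable Loc Φ (.iff (.inv (.and φ ψ) P) (.and (.inv φ P) (.inv ψ P)))
  | invOr {n : ℕ} {Γ : List Ty} {Φ : List (Spec n Γ)} (φ ψ : Spec n Γ) (P : Assertion n) :
      Provable Loc Φ (.iff (.inv (.or φ ψ) P) (.or (.inv φ P) (.inv ψ P)))
  | invAllI {n : ℕ} {Γ : List Ty} {Φ : List (Spec n Γ)} (τ : Ty) (φ : Spec n (τ :: Γ))
      (P : Assertion n) :
      Provable Loc Φ (.iff (.inv (.allI τ φ) P) (.allI τ (.inv φ P)))
  | invExI {n : ℕ} {Γ : List Ty} {Φ : List (Spec n Γ)} (τ : Ty) (φ : Spec n (τ :: Γ))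
      (P : Assertion n) :
      Provable Loc Φ (.iff (.inv (.exI τ φ) P) (.exI τ (.inv φ P)))
  | invAllV {n : ℕ} {Γ : List Ty} {Φ : List (Spec n Γ)} (φ : Spec (n + 1) Γ) (P : Assertion n) :
      Provable Loc Φ (.iff (.inv (.allV φ) P) (.allV (.inv φ P.wk)))
  | invExV {n : ℕ} {Γ : List Ty} {Φ : List (Spec n Γ)} (φ : Spec (n + 1) Γ) (P : Assertion n) :
      Provable Loc Φ (.iff (.inv (.exV φ) P) (.exV (.inv φ P.wk)))
  /-- fixed-point induction `(∀ x. γ(x) ⇒ γ(M x)) ⇒ γ(fix M)` -/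
  | fixInd {n : ℕ} {Γ : List Ty} {Φ : List (Spec n Γ)} {τ : Ty} (γ : SCtx τ n Γ)
      (M : Term n Γ (.fn τ τ)) :
      Provable Loc Φ (.imp
        (.allI τ (.imp (γ.wkI.fill (.var .zero)) (γ.wkI.fill (.app M.wkI (.var .zero)))))
        (γ.fill (.fix M)))

/-! ### Worlds and semantic quadruples -/

/-- Worlds: finitely supported binary relations on heaps. -/
@[ext]
structure World (Loc : Type) where
  rel : Heap Loc → Heap Loc → Prop
  supported : ∃ L : Finset Loc, ∀ π : FinPerm Loc, (∀ l ∈ L, π • l = l) →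
    ∀ h₀ h₁, rel h₀ h₁ ↔ rel (π • h₀) (π • h₁)

namespace World

theorem supported_of_imp {r : Heap Loc → Heap Loc → Prop} {L : Finset Loc}
    (h : ∀ π : FinPerm Loc, (∀ l ∈ L, π • l = l) → ∀ h₀ h₁, r h₀ h₁ → r (π • h₀) (π • h₁)) :
    ∀ π : FinPerm Loc, (∀ l ∈ L, π • l = l) → ∀ h₀ h₁, r h₀ h₁ ↔ r (π • h₀) (π • h₁) := by
  intro π hπ h₀ h₁
  refine ⟨h π hπ h₀ h₁, fun hr => ?_⟩
  have := h π⁻¹ (fun l hl => by rw [inv_smul_eq_iff, hπ l hl]) _ _ hr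
  rwa [inv_smul_smul, inv_smul_smul] at this

/-- Separating conjunction of relations. -/
def star (r s : World Loc) : World Loc where
  rel h₀ h₁ := ∃ n₀ m₀ n₁ m₁ : Heap Loc, (n₀.Disj m₀ ∧ n₀.union m₀ = h₀) ∧
    (n₁.Disj m₁ ∧ n₁.union m₁ = h₁) ∧ r.rel n₀ n₁ ∧ s.rel m₀ m₁
  supported := by
    classical
    obtain ⟨L, hL⟩ := r.supported
    obtain ⟨L', hL'⟩ := s.supported
    refine ⟨L ∪ L', supported_of_imp ?_⟩
    rintro π hπ _ _ ⟨n₀, m₀, n₁, m₁, ⟨hd, rfl⟩, ⟨hd', rfl⟩, hr, hs⟩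
    exact ⟨π • n₀, π • m₀, π • n₁, π • m₁,
      ⟨Heap.smul_disj π hd, (Heap.smul_union π n₀ m₀).symm⟩,
      ⟨Heap.smul_disj π hd', (Heap.smul_union π n₁ m₁).symm⟩,
      (hL π (fun l hl => hπ l (Finset.mem_union_left _ hl)) _ _).1 hr,
      (hL' π (fun l hl => hπ l (Finset.mem_union_right _ hl)) _ _).1 hs⟩

/-- The partial identity relation on the heaps satisfying `P`. -/
def eq {n : ℕ} (P : Assertion n) (ρ : senv Loc n) : World Loc where
  rel h₀ h₁ := h₀ = h₁ ∧ h₀ ∈ P.den ρ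
  supported := by
    obtain ⟨L, hL⟩ := (senv Loc n).supported ρ
    refine ⟨L, supported_of_imp ?_⟩
    rintro π hπ h₀ _ ⟨rfl, hP⟩
    refine ⟨rfl, ?_⟩
    have h := (P.den_smul π ρ h₀).2 hP
    rwa [show π • ρ = ρ from hL π hπ] at h

end World

/-- The partial identity on the good observations, that is, on all observations except `err`. -/
def EqG (a b : Obs) : Prop := a = b ∧ a ≠ Obs.err

/-- The semantic quadruple `{r} c₀, c₁ {s}`. -/
def Quad (r : World Loc) (c₀ c₁ : comCpo Loc) (s : World Loc) : Prop :=
  ∀ (r' : World Loc) (h₀ h₁ : Heap Loc) (k₀ k₁ : contCpo Loc),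
    (r.star r').rel h₀ h₁ →
    (∀ g₀ g₁ : Heap Loc, (s.star r').rel g₀ g₁ → EqG (k₀ g₀) (k₁ g₁)) →
    EqG (c₀ (h₀, k₀)) (c₁ (h₁, k₁))

/-- The satisfaction relation `(ρ, η₀, η₁, r) ⊨ φ`. -/
def Sat [Infinite Loc] : {n : ℕ} → {Γ : List Ty} → (ρ : senv Loc n) → (η₀ η₁ : ienv Loc Γ) →
    (r : World Loc) → Spec n Γ → Prop
  | _, _, ρ, η₀, η₁, r, .triple P M Q =>
      Quad ((World.eq P ρ).star r) (M.den ρ η₀) (M.den ρ η₁) ((World.eq Q ρ).star r)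
  | _, _, ρ, η₀, η₁, r, .inv φ P => Sat ρ η₀ η₁ (r.star (World.eq P ρ)) φ
  | _, _, ρ, _, _, _, .eqE E F => E.den ρ = F.den ρ
  | _, _, ρ, η₀, η₁, _, .eqT M N => M.den ρ η₀ = N.den ρ η₀ ∧ M.den ρ η₁ = N.den ρ η₁
  | _, _, ρ, η₀, η₁, r, .and φ ψ => Sat ρ η₀ η₁ r φ ∧ Sat ρ η₀ η₁ r ψ
  | _, _, ρ, η₀, η₁, r, .or φ ψ => Sat ρ η₀ η₁ r φ ∨ Sat ρ η₀ η₁ r ψ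
  | _, _, ρ, η₀, η₁, r, .imp φ ψ =>
      ∀ s : World Loc, Sat ρ η₀ η₁ (r.star s) φ → Sat ρ η₀ η₁ (r.star s) ψ
  | _, _, ρ, η₀, η₁, r, .allI τ φ =>
      ∀ m₀ m₁ : τ.den Loc, Sat ρ (consI m₀ η₀) (consI m₁ η₁) r φ
  | _, _, ρ, η₀, η₁, r, .exI τ φ =>
      ∃ m₀ m₁ : τ.den Loc, Sat ρ (consI m₀ η₀) (consI m₁ η₁) r φ
  | _, _, ρ, η₀, η₁, r, .allV φ => ∀ v : Val Loc, Sat (consV v ρ) η₀ η₁ r φ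
  | _, _, ρ, η₀, η₁, r, .exV φ => ∃ v : Val Loc, Sat (consV v ρ) η₀ η₁ r φ

end ParamSL

end

noncomputable section

namespace ParamSL

variable {Loc : Type}

/-! ### Renaming and substitution lemmas -/

/-! Soundness is proved by induction on derivations from arbitrary hypotheses, uniformly in
environments and worlds (`Provable.sat`); the theorem is the case of no hypotheses. The environments
`η₀` and `η₁` are never assumed to be related: relatedness of free identifiers enters only through
specifications that stand to the left of an implication.

The logical rules are the Kripke semantics of intuitionistic logic, with worlds ordered by `r ≤ r *
s`. They need that separating conjunction of relations is a commutative monoid (`World.star_comm`,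
`World.star_assoc`, `World.star_emp`) and that satisfaction persists along the order (`Sat.star`).
Persistence of triples costs nothing, because a quadruple already quantifies over every further
relation `r'`: the frame property is built into it. The invariant extension axioms then reduce to
rearranging starred relations, since `eq(P * Q)` is `eq(P) * eq(Q)` (`World.eq_star`).

The triple axioms rest on one observation (`quad_iff_semTriple`): the precondition is a diagonal
relation, so two related heaps have the form `p ∪ m₀`, `p ∪ m₁` with the same part `p` in the
precondition, and only the remainders are related by the world. A command that touches just `p`
therefore performs the same action on both sides and leaves the remainders as they were. The same
sharing lets one existential witness, or one disjunct, serve both sides at once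
(`SemTriple.of_pre`). Allocation fits this pattern because its result does not depend on the fresh
location: one location, fresh for both runs, can be chosen, and the new cell joins the shared part
(`semTriple_new`).

Fixed-point induction is Scott induction (`SCtx.sat_leastfix`). The hole of a context `C` is always
in head position, so `C` denotes a strict continuous function of its hole (`TCtx.den_bot`); the
triple for `⊥` holds because divergence is a good observation, and triples survive suprema of chains
because `err` is not the supremum of a chain of good observations (`EqG.of_isLUB`).

The quantifier, equality, `β` and `η` rules use the usual lemmas that syntactic renaming and
substitution correspond to pulling back environments (`sat_rename`, `sat_subst`). -/

/-- The stack environment pulled back along a renaming. -/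
def senv.ren {n m : ℕ} (f : Fin n → Fin m) (ρ : senv Loc m) : senv Loc n := fun i => ρ (f i)

/-- The identifier environment pulled back along a renaming. -/
def ienv.ren {Γ Γ' : List Ty} (g : Ren Γ Γ') (η : ienv Loc Γ') : ienv Loc Γ :=
  fun x => η ⟨x.1, g x.1 x.2⟩

/-- The stack environment pulled back along a substitution. -/
def senv.sub {n m : ℕ} (s : Fin n → Expr m) (ρ : senv Loc m) : senv Loc n := fun i => (s i).den ρ

/-- The identifier environment pulled back along a substitution. -/
def ienv.sub [Infinite Loc] {n : ℕ} {Γ Γ' : List Ty} (t : Sub n Γ Γ') (ρ : senv Loc n)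
    (η : ienv Loc Γ') : ienv Loc Γ :=
  fun x => (t x.1 x.2).den ρ η

theorem senv.ren_liftV {n m : ℕ} (f : Fin n → Fin m) (v : Val Loc) (ρ : senv Loc m) :
    senv.ren (liftV f) (consV v ρ) = consV v (senv.ren f ρ) := by
  funext i
  refine Fin.cases ?_ (fun i => ?_) i <;> rfl

theorem ienv.ren_lift {Γ Γ' : List Ty} {σ : Ty} (g : Ren Γ Γ') (m : σ.den Loc)
    (η : ienv Loc Γ') : ienv.ren g.lift (consI m η) = consI m (ienv.ren g η) := by
  funext ⟨τ, x⟩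
  cases x <;> rfl

theorem Expr.den_rename {n m : ℕ} (f : Fin n → Fin m) (E : Expr n) (ρ : senv Loc m) :
    (E.rename f).den ρ = E.den (senv.ren f ρ) := by
  induction E with
  | var | zero | one | negOne => rfl
  | add E F hE hF | sub E F hE hF => simp only [Expr.rename, Expr.den, hE, hF]

theorem Expr.den_wk {n : ℕ} (E : Expr n) (v : Val Loc) (ρ : senv Loc n) :
    E.wk.den (consV v ρ) = E.den ρ :=
  E.den_rename Fin.succ (consV v ρ)

theorem Expr.den_subst {n m : ℕ} (s : Fin n → Expr m) (E : Expr n) (ρ : senv Loc m) :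
    (E.subst s).den ρ = E.den (senv.sub s ρ) := by
  induction E with
  | var | zero | one | negOne => rfl
  | add E F hE hF | sub E F hE hF => simp only [Expr.subst, Expr.den, hE, hF]

theorem senv.sub_lift {n m : ℕ} (s : Fin n → Expr m) (v : Val Loc) (ρ : senv Loc m) :
    senv.sub (substLiftV s) (consV v ρ) = consV v (senv.sub s ρ) := by
  funext i
  refine Fin.cases ?_ (fun i => ?_) i
  · rfl
  · exact (s i).den_wk v ρ

theorem senv.sub_one {n : ℕ} (E : Expr n) (ρ : senv Loc n) :
    senv.sub (substOneV E) ρ = consV (E.den ρ) ρ := by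
  funext i
  refine Fin.cases ?_ (fun i => ?_) i <;> rfl

/-! ### Assertions under renaming and substitution -/

namespace Assertion

theorem den_rename {n m : ℕ} (f : Fin n → Fin m) (P : Assertion n) (ρ : senv Loc m) :
    (P.rename f).den ρ = P.den (senv.ren f ρ) := by
  induction P generalizing m with
  | eq | le | pointsTo => simp only [rename, den, Expr.den_rename]
  | emp => rfl
  | star P Q hP hQ | and P Q hP hQ => simp only [rename, den, hP, hQ]
  | not P hP => simp only [rename, den, hP]
  | ex P hP => simp only [rename, den, hP, senv.ren_liftV]

theorem den_wk {n : ℕ} (P : Assertion n) (v : Val Loc) (ρ : senv Loc n) :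
    P.wk.den (consV v ρ) = P.den ρ :=
  P.den_rename Fin.succ (consV v ρ)

theorem den_subst {n m : ℕ} (s : Fin n → Expr m) (P : Assertion n) (ρ : senv Loc m) :
    (P.subst s).den ρ = P.den (senv.sub s ρ) := by
  induction P generalizing m with
  | eq | le | pointsTo => simp only [subst, den, Expr.den_subst]
  | emp => rfl
  | star P Q hP hQ | and P Q hP hQ => simp only [subst, den, hP, hQ]
  | not P hP => simp only [subst, den, hP]
  | ex P hP => simp only [subst, den, hP, senv.sub_lift]

theorem mem_den_or {n : ℕ} {P Q : Assertion n} {ρ : senv Loc n} {h : Heap Loc} :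
    h ∈ (P.or Q).den ρ ↔ h ∈ P.den ρ ∨ h ∈ Q.den ρ := by
  simp only [Assertion.or, den, Set.mem_compl_iff, Set.mem_inter_iff]
  tauto

/-- A form uniform in the field: starting from a cell with `W` in both fields and writing `V` to the
field `f` leaves `W` in the other one. This lets the lookup and update axioms be handled without a
case split on `f`. -/
theorem mem_den_field {n : ℕ} {E V W : Expr n} {f : Fld} {ρ : senv Loc n} {h : Heap Loc} :
    h ∈ (field E f V W).den ρ ↔ ∃ l, E.den ρ = .loc l ∧
      h = Heap.single l (f.set (W.den ρ, W.den ρ) (V.den ρ)) := by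
  cases f <;> rfl

end Assertion

/-! ### Congruence of the command combinators, across different environment objects -/

namespace Hom

variable {X X' : FMCpo Loc}

/-- The combinators are morphisms out of a whole environment object, but only the values at the
given point matter. Renaming and substitution change the environment object, so these congruences
have to compare morphisms with different domains `X` and `X'`. -/
theorem seq_congr {m n : Hom X (comCpo Loc)} {m' n' : Hom X' (comCpo Loc)} {x : X} {x' : X'}
    (hm : m x = m' x') (hn : n x = n' x') : seq m n x = seq m' n' x' := by
  refine Fn.ext (funext fun ⟨h, k⟩ => ?_)
  change m x (h, n.thenCont (x, k)) = m' x' (h, n'.thenCont (x', k))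
  have hk : n.thenCont (x, k) = n'.thenCont (x', k) := Fn.ext (funext fun h' => by
    change n x (h', k) = n' x' (h', k)
    rw [hn])
  rw [hm, hk]

theorem ite_congr {Y : FMCpo Loc} {e f : Hom X (valCpo Loc)} {e' f' : Hom X' (valCpo Loc)}
    {m n : Hom X Y} {m' n' : Hom X' Y} {x : X} {x' : X'} (he : e x = e' x') (hf : f x = f' x')
    (hm : m x = m' x') (hn : n x = n' x') : ite e f m n x = ite e' f' m' n' x' := by
  classical
  change (if e x = f x then m x else n x) = if e' x' = f' x' then m' x' else n' x'
  rw [he, hf, hm, hn]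

theorem free_congr {e : Hom X (valCpo Loc)} {e' : Hom X' (valCpo Loc)} {x : X} {x' : X'}
    (he : e x = e' x') : free e x = free e' x' := by
  refine Fn.ext (funext fun p => ?_)
  change (match p.1.cell (e x) with | none => Obs.err | some q => p.2 (p.1.erase q.1)) =
    (match p.1.cell (e' x') with | none => Obs.err | some q => p.2 (p.1.erase q.1))
  rw [he]

theorem assign_congr {e v : Hom X (valCpo Loc)} {e' v' : Hom X' (valCpo Loc)} {f : Fld} {x : X}
    {x' : X'} (he : e x = e' x') (hv : v x = v' x') : assign e f v x = assign e' f v' x' := by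
  refine Fn.ext (funext fun p => ?_)
  change (match p.1.cell (e x) with
      | none => Obs.err | some q => p.2 (p.1.update q.1 (f.set q.2 (v x)))) =
    (match p.1.cell (e' x') with
      | none => Obs.err | some q => p.2 (p.1.update q.1 (f.set q.2 (v' x'))))
  rw [he, hv]

theorem lookup_congr {e : Hom X (valCpo Loc)} {e' : Hom X' (valCpo Loc)} {f : Fld}
    {m : Hom (X.prod (valCpo Loc)) (comCpo Loc)} {m' : Hom (X'.prod (valCpo Loc)) (comCpo Loc)}
    {x : X} {x' : X'} (he : e x = e' x') (hm : ∀ v, m (x, v) = m' (x', v)) :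
    lookup e f m x = lookup e' f m' x' := by
  refine Fn.ext (funext fun p => ?_)
  change (match p.1.cell (e x) with | none => Obs.err | some q => m (x, f.get q.2) p) =
    (match p.1.cell (e' x') with | none => Obs.err | some q => m' (x', f.get q.2) p)
  simp only [he, hm]

theorem new_apply [Infinite Loc] (m : Hom (X.prod (valCpo Loc)) (comCpo Loc)) (x : X)
    (p : (heapCpo Loc).prod (contCpo Loc)) {L : Finset Loc}
    (hL : FSupports (A := X.prod ((heapCpo Loc).prod (contCpo Loc))) L (x, p)) {l : Loc}
    (hl : l ∉ L) :
    new m x p = m (x, .loc l) (p.1.union (Heap.single l (.int 0, .int 0)), p.2) :=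
  fresh_irrel (X := X.prod ((heapCpo Loc).prod (contCpo Loc)))
    (g := fun l x => m.allocAt (.loc l, x)) (fun π l x => m.allocAt.equivariant π (.loc l, x))
    (fresh_spec (X := X.prod ((heapCpo Loc).prod (contCpo Loc))) _) fun h => hl (h L hL)

/-- Here the two sides are not computed with the same address: each picks one that is fresh for its
own environment. Since the choice is immaterial (`new_apply`), both can be recomputed with a single
location avoiding the two supports. -/
theorem new_congr [Infinite Loc] {m : Hom (X.prod (valCpo Loc)) (comCpo Loc)}
    {m' : Hom (X'.prod (valCpo Loc)) (comCpo Loc)} {x : X} {x' : X'}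
    (hm : ∀ v, m (x, v) = m' (x', v)) : new m x = new m' x' := by
  classical
  refine Fn.ext (funext fun p => ?_)
  obtain ⟨L, hL⟩ := (X.prod ((heapCpo Loc).prod (contCpo Loc))).supported (x, p)
  obtain ⟨L', hL'⟩ := (X'.prod ((heapCpo Loc).prod (contCpo Loc))).supported (x', p)
  obtain ⟨l, hl⟩ := Infinite.exists_notMem_finset (L ∪ L')
  rw [Finset.mem_union, not_or] at hl
  exact (new_apply m x p hL hl.1).trans ((congrArg (fun c : comCpo Loc => c _) (hm _)).trans
    (new_apply m' x' p hL' hl.2).symm)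

end Hom

/-! ### Terms under renaming -/

namespace Term

variable [Infinite Loc]

theorem den_rename {n m : ℕ} {Γ Γ' : List Ty} {τ : Ty} (f : Fin n → Fin m) (g : Ren Γ Γ')
    (M : Term n Γ τ) (ρ : senv Loc m) (η : ienv Loc Γ') :
    (M.rename f g).den ρ η = M.den (senv.ren f ρ) (ienv.ren g η) := by
  induction M generalizing m Γ' with
  | var => rfl
  | lamV M ih =>
    exact Fn.ext (funext fun v => (ih _ _ _ _).trans (by rw [senv.ren_liftV]; rfl))
  | appV M E ih => simp only [rename, den_appV, ih, Expr.den_rename]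
  | lam M ih =>
    exact Fn.ext (funext fun v => (ih _ _ _ _).trans (by rw [ienv.ren_lift]; rfl))
  | app M N ihM ihN => simp only [rename, den_app, ihM, ihN]
  | fix M ih => simp only [rename, den_fix, ih]
  | ite E F M N ihM ihN =>
    exact Hom.ite_congr (E.den_rename f ρ) (F.den_rename f ρ) (ihM _ _ _ _) (ihN _ _ _ _)
  | seq M N ihM ihN => exact Hom.seq_congr (ihM _ _ _ _) (ihN _ _ _ _)
  | new M ih =>
    exact Hom.new_congr fun v => (ih _ _ _ _).trans (by rw [senv.ren_liftV]; rfl)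
  | free E => exact Hom.free_congr (E.den_rename f ρ)
  | lookup E fl M ih =>
    exact Hom.lookup_congr (E.den_rename f ρ) fun v =>
      (ih _ _ _ _).trans (by rw [senv.ren_liftV]; rfl)
  | assign E fl F => exact Hom.assign_congr (E.den_rename f ρ) (F.den_rename f ρ)

theorem den_wkV {n : ℕ} {Γ : List Ty} {τ : Ty} (M : Term n Γ τ) (v : Val Loc) (ρ : senv Loc n)
    (η : ienv Loc Γ) : M.wkV.den (consV v ρ) η = M.den ρ η :=
  M.den_rename _ _ _ _

theorem den_wkI {n : ℕ} {Γ : List Ty} {σ τ : Ty} (M : Term n Γ τ) (m : σ.den Loc)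
    (ρ : senv Loc n) (η : ienv Loc Γ) : M.wkI.den ρ (consI m η) = M.den ρ η :=
  M.den_rename _ _ _ _

end Term

/-- The diagonal world sees an assertion only through its set of heaps; this transports the renaming
and substitution lemmas for assertions to worlds. -/
theorem World.eq_congr {n m : ℕ} {P : Assertion n} {Q : Assertion m} {ρ : senv Loc n}
    {ρ' : senv Loc m} (h : P.den ρ = Q.den ρ') : World.eq P ρ = World.eq Q ρ' :=
  World.ext (by simp only [World.eq, h])

section

variable [Infinite Loc]

theorem ienv.sub_wkV {n : ℕ} {Γ Γ' : List Ty} (t : Sub n Γ Γ') (v : Val Loc) (ρ : senv Loc n)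
    (η : ienv Loc Γ') : ienv.sub t.wkV (consV v ρ) η = ienv.sub t ρ η :=
  funext fun x => (t x.1 x.2).den_wkV v ρ η

theorem ienv.sub_lift {n : ℕ} {Γ Γ' : List Ty} {σ : Ty} (t : Sub n Γ Γ') (m : σ.den Loc)
    (ρ : senv Loc n) (η : ienv Loc Γ') :
    ienv.sub t.lift ρ (consI m η) = consI m (ienv.sub t ρ η) := by
  funext ⟨τ, x⟩
  cases x with
  | zero => rfl
  | succ x => exact (t τ x).den_wkI m ρ η

theorem ienv.sub_one {n : ℕ} {Γ : List Ty} {σ : Ty} (N : Term n Γ σ) (ρ : senv Loc n)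
    (η : ienv Loc Γ) : ienv.sub (Sub.one N) ρ η = consI (N.den ρ η) η := by
  funext ⟨τ, x⟩
  cases x <;> rfl

/-! ### Terms under substitution -/

namespace Term

theorem den_subst {n m : ℕ} {Γ Γ' : List Ty} {τ : Ty} (s : Fin n → Expr m) (t : Sub m Γ Γ')
    (M : Term n Γ τ) (ρ : senv Loc m) (η : ienv Loc Γ') :
    (M.subst s t).den ρ η = M.den (senv.sub s ρ) (ienv.sub t ρ η) := by
  induction M generalizing m Γ' with
  | var => rfl
  | lamV M ih =>
    exact Fn.ext (funext fun v => (ih _ _ _ _).trans (by rw [senv.sub_lift, ienv.sub_wkV]; rfl))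
  | appV M E ih => simp only [subst, den_appV, ih, Expr.den_subst]
  | lam M ih =>
    exact Fn.ext (funext fun v => (ih _ _ _ _).trans (by rw [ienv.sub_lift]; rfl))
  | app M N ihM ihN => simp only [subst, den_app, ihM, ihN]
  | fix M ih => simp only [subst, den_fix, ih]
  | ite E F M N ihM ihN =>
    exact Hom.ite_congr (E.den_subst s ρ) (F.den_subst s ρ) (ihM _ _ _ _) (ihN _ _ _ _)
  | seq M N ihM ihN => exact Hom.seq_congr (ihM _ _ _ _) (ihN _ _ _ _)
  | new M ih =>
    exact Hom.new_congr fun v =>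
      (ih _ _ _ _).trans (by rw [senv.sub_lift, ienv.sub_wkV]; rfl)
  | free E => exact Hom.free_congr (E.den_subst s ρ)
  | lookup E fl M ih =>
    exact Hom.lookup_congr (E.den_subst s ρ) fun v =>
      (ih _ _ _ _).trans (by rw [senv.sub_lift, ienv.sub_wkV]; rfl)
  | assign E fl F => exact Hom.assign_congr (E.den_subst s ρ) (F.den_subst s ρ)

theorem den_instV {n : ℕ} {Γ : List Ty} {τ : Ty} (M : Term (n + 1) Γ τ) (E : Expr n)
    (ρ : senv Loc n) (η : ienv Loc Γ) : (M.instV E).den ρ η = M.den (consV (E.den ρ) ρ) η :=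
  (M.den_subst _ _ ρ η).trans (by rw [senv.sub_one]; rfl)

theorem den_instI {n : ℕ} {Γ : List Ty} {σ τ : Ty} (M : Term n (σ :: Γ) τ) (N : Term n Γ σ)
    (ρ : senv Loc n) (η : ienv Loc Γ) : (M.instI N).den ρ η = M.den ρ (consI (N.den ρ η) η) :=
  (M.den_subst _ _ ρ η).trans (by rw [ienv.sub_one]; rfl)

end Term

/-! ### Satisfaction under renaming and substitution -/

theorem sat_rename {n m : ℕ} {Γ Γ' : List Ty} (f : Fin n → Fin m) (g : Ren Γ Γ')
    (φ : Spec n Γ) (ρ : senv Loc m) (η₀ η₁ : ienv Loc Γ') (r : World Loc) :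
    Sat ρ η₀ η₁ r (φ.rename f g) ↔
      Sat (senv.ren f ρ) (ienv.ren g η₀) (ienv.ren g η₁) r φ := by
  -- The world varies because invariant extension and implication move to an extended one; the
  -- target contexts vary because of binders.
  induction φ generalizing m Γ' r with
  | triple P M Q =>
    simp only [Spec.rename, Sat, Term.den_rename, World.eq_congr (P.den_rename f ρ),
      World.eq_congr (Q.den_rename f ρ)]
  | inv φ P ih => simp only [Spec.rename, Sat, ih, World.eq_congr (P.den_rename f ρ)]
  | eqE E F => simp only [Spec.rename, Sat, Expr.den_rename]
  | eqT M N => simp only [Spec.rename, Sat, Term.den_rename]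
  | and φ ψ ihφ ihψ | or φ ψ ihφ ihψ | imp φ ψ ihφ ihψ =>
    simp only [Spec.rename, Sat, ihφ, ihψ]
  | allI τ φ ih | exI τ φ ih => simp only [Spec.rename, Sat, ih, ienv.ren_lift]
  | allV φ ih | exV φ ih => simp only [Spec.rename, Sat, ih, senv.ren_liftV]

theorem sat_wkV {n : ℕ} {Γ : List Ty} (φ : Spec n Γ) (v : Val Loc) (ρ : senv Loc n)
    (η₀ η₁ : ienv Loc Γ) (r : World Loc) :
    Sat (consV v ρ) η₀ η₁ r φ.wkV ↔ Sat ρ η₀ η₁ r φ :=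
  sat_rename _ _ φ _ _ _ r

theorem sat_wkI {n : ℕ} {Γ : List Ty} {σ : Ty} (φ : Spec n Γ) (m₀ m₁ : σ.den Loc)
    (ρ : senv Loc n) (η₀ η₁ : ienv Loc Γ) (r : World Loc) :
    Sat ρ (consI m₀ η₀) (consI m₁ η₁) r φ.wkI ↔ Sat ρ η₀ η₁ r φ :=
  sat_rename _ _ φ _ _ _ r

theorem sat_subst {n m : ℕ} {Γ Γ' : List Ty} (s : Fin n → Expr m) (t : Sub m Γ Γ')
    (φ : Spec n Γ) (ρ : senv Loc m) (η₀ η₁ : ienv Loc Γ') (r : World Loc) :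
    Sat ρ η₀ η₁ r (φ.subst s t) ↔
      Sat (senv.sub s ρ) (ienv.sub t ρ η₀) (ienv.sub t ρ η₁) r φ := by
  induction φ generalizing m Γ' r with
  | triple P M Q =>
    simp only [Spec.subst, Sat, Term.den_subst, World.eq_congr (P.den_subst s ρ),
      World.eq_congr (Q.den_subst s ρ)]
  | inv φ P ih => simp only [Spec.subst, Sat, ih, World.eq_congr (P.den_subst s ρ)]
  | eqE E F => simp only [Spec.subst, Sat, Expr.den_subst]
  | eqT M N => simp only [Spec.subst, Sat, Term.den_subst]
  | and φ ψ ihφ ihψ | or φ ψ ihφ ihψ | imp φ ψ ihφ ihψ =>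
    simp only [Spec.subst, Sat, ihφ, ihψ]
  | allI τ φ ih | exI τ φ ih => simp only [Spec.subst, Sat, ih, ienv.sub_lift]
  | allV φ ih | exV φ ih => simp only [Spec.subst, Sat, ih, senv.sub_lift, ienv.sub_wkV]

theorem sat_instV {n : ℕ} {Γ : List Ty} (φ : Spec (n + 1) Γ) (E : Expr n) (ρ : senv Loc n)
    (η₀ η₁ : ienv Loc Γ) (r : World Loc) :
    Sat ρ η₀ η₁ r (φ.instV E) ↔ Sat (consV (E.den ρ) ρ) η₀ η₁ r φ := by
  rw [Spec.instV, sat_subst, senv.sub_one]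
  rfl

/-- A term yields the pair of its meanings in the two environments. Quantifiers over identifiers
range over all pairs, so this pair is a legitimate instance. -/
theorem sat_instI {n : ℕ} {Γ : List Ty} {σ : Ty} (φ : Spec n (σ :: Γ)) (N : Term n Γ σ)
    (ρ : senv Loc n) (η₀ η₁ : ienv Loc Γ) (r : World Loc) :
    Sat ρ η₀ η₁ r (φ.instI N) ↔ Sat ρ (consI (N.den ρ η₀) η₀) (consI (N.den ρ η₁) η₁) r φ := by
  rw [Spec.instI, sat_subst, ienv.sub_one, ienv.sub_one]
  rfl

end

/-! ### Heaps and worlds -/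

namespace Heap

theorem Disj.symm {h h' : Heap Loc} (hd : h.Disj h') : h'.Disj h := fun l => (hd l).symm

/-- Disjointness is needed since `union` prefers its left argument; associativity below holds
without it. -/
theorem union_comm {h h' : Heap Loc} (hd : h.Disj h') : h.union h' = h'.union h := by
  refine Heap.ext (funext fun l => ?_)
  rcases hd l with e | e <;> simp [union, e]

theorem union_assoc (h h' h'' : Heap Loc) :
    (h.union h').union h'' = h.union (h'.union h'') :=
  Heap.ext (funext fun l => by simp [union, Option.or_assoc])

theorem disj_union_left {h h' h'' : Heap Loc} :
    (h.union h').Disj h'' ↔ h.Disj h'' ∧ h'.Disj h'' := by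
  simp only [Disj, ← forall_and, union, Option.or_eq_none_iff]
  exact forall_congr' fun l => by tauto

theorem disj_union_right {h h' h'' : Heap Loc} :
    h.Disj (h'.union h'') ↔ h.Disj h' ∧ h.Disj h'' := by
  simp only [Disj, ← forall_and, union, Option.or_eq_none_iff]
  exact forall_congr' fun l => by tauto

theorem union_empty (h : Heap Loc) : h.union empty = h :=
  Heap.ext (funext fun l => by simp [union, empty])

theorem disj_empty (h : Heap Loc) : h.Disj empty := fun _ => Or.inr rfl

theorem empty_disj (h : Heap Loc) : empty.Disj h := fun _ => Or.inl rfl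

theorem disj_single {h : Heap Loc} {l : Loc} {c : Val Loc × Val Loc} :
    h.Disj (single l c) ↔ h l = none := by
  refine ⟨fun hd => (hd l).resolve_right (by simp [single]), fun hl l' => ?_⟩
  by_cases e : l' = l
  · exact Or.inl (e ▸ hl)
  · exact Or.inr (if_neg e)

theorem single_disj {h : Heap Loc} {l : Loc} {c : Val Loc × Val Loc} :
    (single l c).Disj h ↔ h l = none :=
  ⟨fun hd => disj_single.1 hd.symm, fun hl => (disj_single.2 hl).symm⟩

theorem single_union_self (l : Loc) (c : Val Loc × Val Loc) (h : Heap Loc) :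
    (single l c).union h l = some c := by
  simp [union, single]

theorem cell_of_apply {h : Heap Loc} {l : Loc} {c : Val Loc × Val Loc} (hc : h l = some c) :
    h.cell (.loc l) = some (l, c) := by
  simp [cell, hc]

theorem erase_single_union {l : Loc} {c : Val Loc × Val Loc} {h : Heap Loc} (hl : h l = none) :
    ((single l c).union h).erase l = h := by
  refine Heap.ext (funext fun l' => ?_)
  by_cases e : l' = l
  · simp [erase, e, hl]
  · simp [erase, union, single, e]

theorem update_single_union (l : Loc) (c d : Val Loc × Val Loc) (h : Heap Loc) :
    ((single l c).union h).update l d = (single l d).union h := by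
  refine Heap.ext (funext fun l' => ?_)
  by_cases e : l' = l <;> simp [update, union, single, e]

end Heap

theorem Fld.get_set (f : Fld) (c : Val Loc × Val Loc) (v : Val Loc) : f.get (f.set c v) = v := by
  cases f <;> rfl

theorem Fld.set_set (f : Fld) (c : Val Loc × Val Loc) (v w : Val Loc) :
    f.set (f.set c v) w = f.set c w := by
  cases f <;> rfl

/-! ### Worlds as a commutative monoid under separating conjunction -/

namespace World

theorem star_comm (r s : World Loc) : r.star s = s.star r := by
  have key : ∀ (r s : World Loc) h₀ h₁, (r.star s).rel h₀ h₁ → (s.star r).rel h₀ h₁ := by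
    rintro r s _ _ ⟨n₀, m₀, n₁, m₁, ⟨hd, rfl⟩, ⟨hd', rfl⟩, hr, hs⟩
    exact ⟨m₀, n₀, m₁, n₁, ⟨hd.symm, (Heap.union_comm hd).symm⟩,
      ⟨hd'.symm, (Heap.union_comm hd').symm⟩, hs, hr⟩
  exact World.ext (funext fun h₀ => funext fun h₁ => propext ⟨key r s h₀ h₁, key s r h₀ h₁⟩)

theorem star_assoc (r s t : World Loc) : (r.star s).star t = r.star (s.star t) := by
  refine World.ext (funext fun h₀ => funext fun h₁ => propext ⟨?_, ?_⟩)
  · rintro ⟨_, c₀, _, c₁, ⟨hd, rfl⟩, ⟨hd', rfl⟩,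
      ⟨a₀, b₀, a₁, b₁, ⟨he, rfl⟩, ⟨he', rfl⟩, hr, hs⟩, ht⟩
    rw [Heap.disj_union_left] at hd hd'
    exact ⟨a₀, b₀.union c₀, a₁, b₁.union c₁,
      ⟨Heap.disj_union_right.2 ⟨he, hd.1⟩, (Heap.union_assoc _ _ _).symm⟩,
      ⟨Heap.disj_union_right.2 ⟨he', hd'.1⟩, (Heap.union_assoc _ _ _).symm⟩, hr,
      b₀, c₀, b₁, c₁, ⟨hd.2, rfl⟩, ⟨hd'.2, rfl⟩, hs, ht⟩
  · rintro ⟨a₀, _, a₁, _, ⟨hd, rfl⟩, ⟨hd', rfl⟩, hr,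
      ⟨b₀, c₀, b₁, c₁, ⟨he, rfl⟩, ⟨he', rfl⟩, hs, ht⟩⟩
    rw [Heap.disj_union_right] at hd hd'
    exact ⟨a₀.union b₀, c₀, a₁.union b₁, c₁,
      ⟨Heap.disj_union_left.2 ⟨hd.2, he⟩, Heap.union_assoc _ _ _⟩,
      ⟨Heap.disj_union_left.2 ⟨hd'.2, he'⟩, Heap.union_assoc _ _ _⟩,
      ⟨a₀, b₀, a₁, b₁, ⟨hd.1, rfl⟩, ⟨hd'.1, rfl⟩, hr, hs⟩, ht⟩

theorem star_right_comm (r s t : World Loc) : (r.star s).star t = (r.star t).star s := by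
  rw [star_assoc, star_comm s, star_assoc]

/-- The relation that holds only between empty heaps. -/
def emp : World Loc where
  rel h₀ h₁ := h₀ = Heap.empty ∧ h₁ = Heap.empty
  supported := ⟨∅, supported_of_imp (by
    rintro π _ _ _ ⟨rfl, rfl⟩
    exact ⟨Heap.smul_empty π, Heap.smul_empty π⟩)⟩

theorem star_emp (r : World Loc) : r.star emp = r := by
  refine World.ext (funext fun h₀ => funext fun h₁ => propext ⟨?_, fun h => ?_⟩)
  · rintro ⟨n₀, _, n₁, _, ⟨-, rfl⟩, ⟨-, rfl⟩, hr, rfl, rfl⟩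
    rwa [Heap.union_empty, Heap.union_empty]
  · exact ⟨h₀, Heap.empty, h₁, Heap.empty, ⟨Heap.disj_empty _, Heap.union_empty _⟩,
      ⟨Heap.disj_empty _, Heap.union_empty _⟩, h, rfl, rfl⟩

/-- One splitting of a heap can be used on both sides; conversely, two splittings with equal
components recombine to the same heap. -/
theorem eq_star {n : ℕ} (P Q : Assertion n) (ρ : senv Loc n) :
    World.eq (.star P Q) ρ = (World.eq P ρ).star (World.eq Q ρ) := by
  refine World.ext (funext fun h₀ => funext fun h₁ => propext ⟨?_, ?_⟩)
  · rintro ⟨rfl, p, hp, q, hq, hd, rfl⟩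
    exact ⟨p, q, p, q, ⟨hd, rfl⟩, ⟨hd, rfl⟩, ⟨rfl, hp⟩, ⟨rfl, hq⟩⟩
  · rintro ⟨p, q, _, _, ⟨hd, rfl⟩, ⟨-, rfl⟩, ⟨rfl, hp⟩, ⟨rfl, hq⟩⟩
    exact ⟨rfl, p, hp, q, hq, hd, rfl⟩

theorem eq_star_rel {n : ℕ} {P : Assertion n} {ρ : senv Loc n} {r : World Loc} {h₀ h₁ : Heap Loc} :
    ((World.eq P ρ).star r).rel h₀ h₁ ↔ ∃ p ∈ P.den ρ, ∃ m₀ m₁, (p.Disj m₀ ∧ p.union m₀ = h₀) ∧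
      (p.Disj m₁ ∧ p.union m₁ = h₁) ∧ r.rel m₀ m₁ := by
  constructor
  · rintro ⟨p, m₀, _, m₁, h, h', ⟨rfl, hp⟩, hr⟩
    exact ⟨p, hp, m₀, m₁, h, h', hr⟩
  · rintro ⟨p, hp, m₀, m₁, h, h', hr⟩
    exact ⟨p, m₀, p, m₁, h, h', ⟨rfl, hp⟩, hr⟩

end World

/-! ### Semantic triples -/

/-- The continuations `k₀` and `k₁` agree, without error, on heaps that share a part in `D` and
whose remaining parts are related by `r`. -/
def AgreeOn (D : Set (Heap Loc)) (r : World Loc) (k₀ k₁ : contCpo Loc) : Prop :=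
  ∀ q ∈ D, ∀ m₀ m₁ : Heap Loc, q.Disj m₀ → q.Disj m₁ → r.rel m₀ m₁ →
    EqG (k₀ (q.union m₀)) (k₁ (q.union m₁))

/-- The meaning of a triple with precondition `D` and postcondition `D'` in the world `r`. -/
def SemTriple (D : Set (Heap Loc)) (c₀ c₁ : comCpo Loc) (D' : Set (Heap Loc)) (r : World Loc) :
    Prop :=
  ∀ (r' : World Loc) (k₀ k₁ : contCpo Loc), AgreeOn D' (r.star r') k₀ k₁ →
    ∀ p ∈ D, ∀ m₀ m₁ : Heap Loc, p.Disj m₀ → p.Disj m₁ → (r.star r').rel m₀ m₁ →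
      EqG (c₀ (p.union m₀, k₀)) (c₁ (p.union m₁, k₁))

/-- After reassociation the frame of the quadruple becomes `r * r'`, and the component related by
`eq(P)` or `eq(Q)` lies on the diagonal. Hence the two heaps have a common part, and all dependence
on the world sits in the remainders. -/
theorem quad_iff_semTriple {n : ℕ} {P Q : Assertion n} {ρ : senv Loc n} {r : World Loc}
    {c₀ c₁ : comCpo Loc} :
    Quad ((World.eq P ρ).star r) c₀ c₁ ((World.eq Q ρ).star r) ↔
      SemTriple (P.den ρ) c₀ c₁ (Q.den ρ) r := by
  constructor
  · intro h r' k₀ k₁ hk p hp m₀ m₁ hd hd' hr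
    refine h r' _ _ k₀ k₁ ?_ fun g₀ g₁ hg => ?_
    · rw [World.star_assoc]
      exact World.eq_star_rel.2 ⟨p, hp, m₀, m₁, ⟨hd, rfl⟩, ⟨hd', rfl⟩, hr⟩
    · rw [World.star_assoc] at hg
      obtain ⟨q, hq, n₀, n₁, ⟨he, rfl⟩, ⟨he', rfl⟩, hn⟩ := World.eq_star_rel.1 hg
      exact hk q hq n₀ n₁ he he' hn
  · intro h r' h₀ h₁ k₀ k₁ hr hk
    rw [World.star_assoc] at hr hk
    obtain ⟨p, hp, m₀, m₁, ⟨hd, rfl⟩, ⟨hd', rfl⟩, hm⟩ := World.eq_star_rel.1 hr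
    exact h r' k₀ k₁ (fun q hq n₀ n₁ he he' hn => hk _ _
      (World.eq_star_rel.2 ⟨q, hq, n₀, n₁, ⟨he, rfl⟩, ⟨he', rfl⟩, hn⟩)) p hp m₀ m₁ hd hd' hm

theorem AgreeOn.mono {D D' : Set (Heap Loc)} {r : World Loc} {k₀ k₁ : contCpo Loc}
    (h : AgreeOn D' r k₀ k₁) (hD : D ⊆ D') : AgreeOn D r k₀ k₁ :=
  fun q hq => h q (hD hq)

/-- The extension `s` is absorbed into the universally quantified frame, which becomes `s * r'`.
This is the semantic frame rule. -/
theorem SemTriple.star {D D' : Set (Heap Loc)} {c₀ c₁ : comCpo Loc} {r : World Loc}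
    (h : SemTriple D c₀ c₁ D' r) (s : World Loc) : SemTriple D c₀ c₁ D' (r.star s) := by
  intro r'
  rw [World.star_assoc]
  exact h (s.star r')

theorem SemTriple.mono {D₁ D₂ D₁' D₂' : Set (Heap Loc)} {c₀ c₁ : comCpo Loc} {r : World Loc}
    (h : SemTriple D₁ c₀ c₁ D₁' r) (hD : D₂ ⊆ D₁) (hD' : D₁' ⊆ D₂') :
    SemTriple D₂ c₀ c₁ D₂' r :=
  fun r' k₀ k₁ hk p hp => h r' k₀ k₁ (hk.mono hD') p (hD hp)

/-- Triples can be checked for each heap of the precondition separately. -/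
theorem SemTriple.of_pre {D D' : Set (Heap Loc)} {c₀ c₁ : comCpo Loc} {r : World Loc}
    (h : ∀ p ∈ D, SemTriple {p} c₀ c₁ D' r) : SemTriple D c₀ c₁ D' r :=
  fun r' k₀ k₁ hk p hp => h p hp r' k₀ k₁ hk p rfl

/-! ### Soundness of the individual commands -/

section

variable [Infinite Loc] {n : ℕ} {Γ : List Ty} {ρ : senv Loc n} {η₀ η₁ : ienv Loc Γ} {r : World Loc}

theorem sat_triple {P Q : Assertion n} {M : Term n Γ .com} :
    Sat ρ η₀ η₁ r (.triple P M Q) ↔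
      SemTriple (P.den ρ) (M.den ρ η₀) (M.den ρ η₁) (Q.den ρ) r :=
  quad_iff_semTriple

/-- In continuation passing style, the triple for the second command says exactly that the
continuations running it agree on the intermediate assertion, which is what the first triple asks
for, with the same frame. -/
theorem semTriple_seq {D D₀ D' : Set (Heap Loc)} {M N : Term n Γ .com}
    (hM : SemTriple D (M.den ρ η₀) (M.den ρ η₁) D₀ r)
    (hN : SemTriple D₀ (N.den ρ η₀) (N.den ρ η₁) D' r) :
    SemTriple D ((Term.seq M N).den ρ η₀) ((Term.seq M N).den ρ η₁) D' r := by
  intro r' k₀ k₁ hk p hp m₀ m₁ hd hd' hm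
  obtain ⟨k₀', hk₀, e₀⟩ := den_seq ρ η₀ M N (p.union m₀) k₀
  obtain ⟨k₁', hk₁, e₁⟩ := den_seq ρ η₁ M N (p.union m₁) k₁
  rw [e₀, e₁]
  refine hM r' k₀' k₁' (fun q hq n₀ n₁ he he' hn => ?_) p hp m₀ m₁ hd hd' hm
  rw [hk₀, hk₁]
  exact hN r' k₀ k₁ hk q hq n₀ n₁ he he' hn

/-- Both runs may allocate at the same address, as long as it is fresh for each of them. The new
cell is then identical on the two sides and can be counted as part of the shared heap. -/
theorem semTriple_new {D D' : Set (Heap Loc)} {M : Term (n + 1) Γ .com}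
    (hM : ∀ l, SemTriple
      {h | ∃ p ∈ D, p.Disj (Heap.single l (.int 0, .int 0)) ∧
        p.union (Heap.single l (.int 0, .int 0)) = h}
      (M.den (consV (.loc l) ρ) η₀) (M.den (consV (.loc l) ρ) η₁) D' r) :
    SemTriple D ((Term.new M).den ρ η₀) ((Term.new M).den ρ η₁) D' r := by
  classical
  intro r' k₀ k₁ hk p hp m₀ m₁ hd hd' hm
  obtain ⟨L₀, hL₀⟩ := ((env Loc n Γ).prod ((heapCpo Loc).prod (contCpo Loc))).supported
    ((ρ, η₀), (p.union m₀, k₀))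
  obtain ⟨L₁, hL₁⟩ := ((env Loc n Γ).prod ((heapCpo Loc).prod (contCpo Loc))).supported
    ((ρ, η₁), (p.union m₁, k₁))
  -- Avoiding the domains separately gives disjointness of the new cell directly, without relating
  -- the domain of a heap to its support.
  obtain ⟨l, hl⟩ := Infinite.exists_notMem_finset
    (L₀ ∪ L₁ ∪ (p.union m₀).finite_dom.toFinset ∪ (p.union m₁).finite_dom.toFinset)
  simp only [Finset.mem_union, not_or, Set.Finite.mem_toFinset, Set.mem_ofPred_eq, not_not] at hl
  obtain ⟨⟨⟨hl₀, hl₁⟩, hn₀⟩, hn₁⟩ := hl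
  rw [den_new ρ η₀ M _ _ l fun h => hl₀ (h L₀ hL₀), den_new ρ η₁ M _ _ l fun h => hl₁ (h L₁ hL₁)]
  obtain ⟨hpl, hm₀l⟩ := Option.or_eq_none_iff.1 hn₀
  obtain ⟨-, hm₁l⟩ := Option.or_eq_none_iff.1 hn₁
  -- The new cell is moved past the remainder, next to the shared part `p`.
  have e : ∀ m : Heap Loc, m l = none →
      (p.union m).union (Heap.single l (.int 0, .int 0)) =
        (p.union (Heap.single l (.int 0, .int 0))).union m := fun m hm => by
    rw [Heap.union_assoc, Heap.union_comm (Heap.disj_single.2 hm), Heap.union_assoc]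
  rw [e m₀ hm₀l, e m₁ hm₁l]
  exact hM l r' k₀ k₁ hk _ ⟨p, hp, Heap.disj_single.2 hpl, rfl⟩ m₀ m₁
    (Heap.disj_union_left.2 ⟨hd, Heap.single_disj.2 hm₀l⟩)
    (Heap.disj_union_left.2 ⟨hd', Heap.single_disj.2 hm₁l⟩) hm

theorem semTriple_free {E : Expr n} {l : Loc} (hE : E.den ρ = .loc l) (c : Val Loc × Val Loc) :
    SemTriple {Heap.single l c} ((Term.free E : Term n Γ .com).den ρ η₀)
      ((Term.free E : Term n Γ .com).den ρ η₁) {Heap.empty} r := by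
  rintro r' k₀ k₁ hk _ rfl m₀ m₁ hd hd' hm
  have h := hk _ rfl m₀ m₁ (Heap.empty_disj _) (Heap.empty_disj _) hm
  rw [den_free, den_free, hE, Heap.cell_of_apply (Heap.single_union_self l c m₀),
    Heap.cell_of_apply (Heap.single_union_self l c m₁)]
  simp only [Heap.erase_single_union (Heap.single_disj.1 hd),
    Heap.erase_single_union (Heap.single_disj.1 hd')]
  -- The union of `Heap.empty` with a heap reduces definitionally to that heap.
  exact h

theorem semTriple_assign {E F : Expr n} {f : Fld} {l : Loc} (hE : E.den ρ = .loc l)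
    (c : Val Loc × Val Loc) :
    SemTriple {Heap.single l c} ((Term.assign E f F : Term n Γ .com).den ρ η₀)
      ((Term.assign E f F : Term n Γ .com).den ρ η₁) {Heap.single l (f.set c (F.den ρ))} r := by
  rintro r' k₀ k₁ hk _ rfl m₀ m₁ hd hd' hm
  have h := hk _ rfl m₀ m₁ (Heap.single_disj.2 (Heap.single_disj.1 hd))
    (Heap.single_disj.2 (Heap.single_disj.1 hd')) hm
  rw [den_assign, den_assign, hE, Heap.cell_of_apply (Heap.single_union_self l c m₀),
    Heap.cell_of_apply (Heap.single_union_self l c m₁)]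
  simp only [Heap.update_single_union]
  exact h

/-- The cell lies in the shared part, so both sides read the same value and the body needs to be
correct only for that value. -/
theorem semTriple_lookup {E : Expr n} {f : Fld} {l : Loc} {c : Val Loc × Val Loc} {p : Heap Loc}
    {M : Term (n + 1) Γ .com} {D' : Set (Heap Loc)} (hE : E.den ρ = .loc l) (hp : p l = some c)
    (hM : SemTriple {p} (M.den (consV (f.get c) ρ) η₀) (M.den (consV (f.get c) ρ) η₁) D' r) :
    SemTriple {p} ((Term.lookup E f M).den ρ η₀) ((Term.lookup E f M).den ρ η₁) D' r := by
  have e : ∀ m, (p.union m) l = some c := fun m => by simp [Heap.union, hp]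
  intro r' k₀ k₁ hk q hq m₀ m₁ hd hd' hm
  obtain rfl : q = p := hq
  rw [den_lookup, den_lookup, hE, Heap.cell_of_apply (e m₀), Heap.cell_of_apply (e m₁)]
  exact hM r' k₀ k₁ hk _ rfl m₀ m₁ hd hd' hm

/-- Satisfaction is preserved by extending the world. -/
theorem Sat.star {n : ℕ} {Γ : List Ty} {ρ : senv Loc n} {η₀ η₁ : ienv Loc Γ} {r : World Loc}
    {φ : Spec n Γ} (h : Sat ρ η₀ η₁ r φ) (s : World Loc) : Sat ρ η₀ η₁ (r.star s) φ := by
  induction φ generalizing r with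
  | triple P M Q => exact sat_triple.2 ((sat_triple.1 h).star s)
  | inv φ P ih =>
    simp only [Sat] at h ⊢
    -- The new relation has to move outside the invariant `P` for the induction hypothesis to apply.
    rw [World.star_right_comm]
    exact ih h
  | eqE | eqT => exact h
  | and φ ψ ihφ ihψ => exact ⟨ihφ h.1, ihψ h.2⟩
  | or φ ψ ihφ ihψ => exact h.imp ihφ ihψ
  | imp φ ψ =>
    simp only [Sat] at h ⊢
    intro t ht
    -- Persistence of an implication uses no induction hypothesis: a further extension `t` of `r *
    -- s` is the extension `s * t` of `r`.
    rw [World.star_assoc] at ht ⊢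
    exact h _ ht
  | allI τ φ ih => exact fun m₀ m₁ => ih (h m₀ m₁)
  | exI τ φ ih =>
    obtain ⟨m₀, m₁, h⟩ := h
    exact ⟨m₀, m₁, ih h⟩
  | allV φ ih => exact fun v => ih (h v)
  | exV φ ih =>
    obtain ⟨v, h⟩ := h
    exact ⟨v, ih h⟩

end

/-! ### Fixed-point induction -/

/-- The two sequences coincide, hence so do their suprema. If the supremum were `err`, every term
would lie below `err` without being `err`, so all would be `⊥`, and so would the supremum. -/
theorem EqG.of_isLUB {a b : ℕ → Obs} {x y : Obs} (ha : IsLUB (Set.range a) x)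
    (hb : IsLUB (Set.range b) y) (h : ∀ i, EqG (a i) (b i)) : EqG x y := by
  obtain rfl : a = b := funext fun i => (h i).1
  refine ⟨ha.unique hb, ?_⟩
  rintro rfl
  have hbot : ∀ i, a i = Obs.bot := fun i => (ha.1 ⟨i, rfl⟩).resolve_right (h i).2
  rcases ha.2 (show Obs.bot ∈ upperBounds (Set.range a) by
    rintro _ ⟨i, rfl⟩
    exact Or.inl (hbot i)) with e | e <;> cases e

/-- Admissibility of triples: suprema of commands are pointwise, so for fixed heaps and
continuations the claim reduces to chains of observations. Finite support is carried along because
continuity and pointwise suprema are available only for such chains. -/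
theorem SemTriple.of_isLUB {X₀ X₁ : FMCpo Loc} {f₀ : Fn X₀ (comCpo Loc)} {f₁ : Fn X₁ (comCpo Loc)}
    {a₀ : ℕ → X₀} {a₁ : ℕ → X₁} {x₀ : X₀} {x₁ : X₁} (hm₀ : Monotone a₀) (hm₁ : Monotone a₁)
    (hs₀ : FSeq Loc a₀) (hs₁ : FSeq Loc a₁) (h₀ : IsLUB (Set.range a₀) x₀)
    (h₁ : IsLUB (Set.range a₁) x₁) {D D' : Set (Heap Loc)} {r : World Loc}
    (h : ∀ i, SemTriple D (f₀ (a₀ i)) (f₁ (a₁ i)) D' r) : SemTriple D (f₀ x₀) (f₁ x₁) D' r := by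
  intro r' k₀ k₁ hk p hp m₀ m₁ hd hd' hm
  obtain ⟨L₀, hL₀⟩ := f₀.supported
  obtain ⟨L₁, hL₁⟩ := f₁.supported
  exact EqG.of_isLUB
    (Fn.isLUB_apply (fun _ _ hij => f₀.monotone (hm₀ hij)) (hL₀.fseq hs₀)
      (f₀.continuous _ _ hm₀ hs₀ h₀) (p.union m₀, k₀))
    (Fn.isLUB_apply (fun _ _ hij => f₁.monotone (hm₁ hij)) (hL₁.fseq hs₁)
      (f₁.continuous _ _ hm₁ hs₁ h₁) (p.union m₁, k₁))
    fun i => h i r' k₀ k₁ hk p hp m₀ m₁ hd hd' hm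

/-- Triples express partial correctness: divergence on both sides counts as agreement. -/
theorem semTriple_bot (D D' : Set (Heap Loc)) (r : World Loc) :
    SemTriple D (⊥ : Ty.den Loc .com) (⊥ : Ty.den Loc .com) D' r :=
  fun _ _ _ _ _ _ _ _ _ _ _ => ⟨rfl, fun h => by cases h⟩

theorem leastfix_bot {X : FMCpo Loc} [OrderBot X] : leastfix (⊥ : X.exp X) = ⊥ :=
  le_antisymm (leastfix_le _ le_rfl) bot_le

theorem map_leastfix {X : FMCpo Loc} [OrderBot X] (f : Fn X X) : f (leastfix f) = leastfix f :=
  le_antisymm (map_leastfix_le f) (leastfix_le f (f.monotone (map_leastfix_le f)))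

theorem fseq_iterate {X : FMCpo Loc} [OrderBot X] (f : Fn X X) :
    FSeq Loc fun i : ℕ => f^[i] (⊥ : X) := by
  obtain ⟨L, hL⟩ := f.supported
  refine ⟨L, fun i π hπ => ?_⟩
  induction i with
  | zero => exact smul_bot X π
  | succ i ih =>
    change π • f^[i + 1] ⊥ = f^[i + 1] ⊥
    rw [Function.iterate_succ_apply', ← hL π hπ]
    exact congrArg f ih

/-! ### Term contexts as strict continuous functions of the hole -/

namespace TCtx

variable [Infinite Loc] {θ : Ty}

/-- The meaning of a term context, a morphism in the environment and the meaning of the hole. -/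
def hom (Loc : Type) [Infinite Loc] {n : ℕ} {Γ : List Ty} {τ : Ty} :
    TCtx θ n Γ τ → Hom ((env Loc n Γ).prod (θ.den Loc)) (τ.den Loc)
  | .hole => Hom.snd
  -- The bound value goes into the environment while the meaning of the hole is passed on unchanged;
  -- this mirrors the weakening of the inserted term under a binder.
  | .lamV C => Hom.curry ((C.hom Loc).comp
      (Hom.pair (extV.comp (Hom.pair (Hom.fst.comp Hom.fst) Hom.snd)) (Hom.snd.comp Hom.fst)))
  | .appV C E => Hom.app (C.hom Loc) (E.hom.comp Hom.fst)
  | .lam C => Hom.curry ((C.hom Loc).comp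
      (Hom.pair (extI.comp (Hom.pair (Hom.fst.comp Hom.fst) Hom.snd)) (Hom.snd.comp Hom.fst)))
  | .app C M => Hom.app (C.hom Loc) ((M.hom Loc).comp Hom.fst)
  | .fix C => Hom.fix.comp (C.hom Loc)
  | .seq C M => Hom.seq (C.hom Loc) ((M.hom Loc).comp Hom.fst)

/-- The meaning of a term context as a function of the meaning of the hole. -/
def den {n : ℕ} {Γ : List Ty} {τ : Ty} (C : TCtx θ n Γ τ) (ρ : senv Loc n) (η : ienv Loc Γ) :
    Fn (θ.den Loc) (τ.den Loc) :=
  (C.hom Loc).curry (ρ, η)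

theorem den_fill {n : ℕ} {Γ : List Ty} {τ : Ty} (C : TCtx θ n Γ τ) (N : Term n Γ θ)
    (ρ : senv Loc n) (η : ienv Loc Γ) : (C.fill N).den ρ η = C.den ρ η (N.den ρ η) := by
  induction C with
  | hole => rfl
  | lamV C ih =>
    exact Fn.ext (funext fun v => (ih _ _ _).trans (by rw [Term.den_wkV]; rfl))
  | appV C E ih => exact congrArg (fun c : Fn _ _ => c (E.den ρ)) (ih N ρ η)
  | lam C ih =>
    exact Fn.ext (funext fun v => (ih _ _ _).trans (by rw [Term.den_wkI]; rfl))
  | app C M ih => exact congrArg (fun c : Fn _ _ => c (M.den ρ η)) (ih N ρ η)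
  | fix C ih => exact congrArg leastfix (ih N ρ η)
  | seq C M ih => exact Hom.seq_congr (ih N ρ η) rfl

theorem den_rename {n m : ℕ} {Γ Γ' : List Ty} {τ : Ty} (f : Fin n → Fin m) (g : Ren Γ Γ')
    (C : TCtx θ n Γ τ) (ρ : senv Loc m) (η : ienv Loc Γ') (a : θ.den Loc) :
    (C.rename f g).den ρ η a = C.den (senv.ren f ρ) (ienv.ren g η) a := by
  induction C generalizing m Γ' with
  | hole => rfl
  | lamV C ih =>
    exact Fn.ext (funext fun v => (ih _ _ _ _).trans (by rw [senv.ren_liftV]; rfl))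
  | appV C E ih =>
    change (C.rename f g).den ρ η a ((E.rename f).den ρ) = _
    rw [ih, E.den_rename]
    rfl
  | lam C ih =>
    exact Fn.ext (funext fun v => (ih _ _ _ _).trans (by rw [ienv.ren_lift]; rfl))
  | app C M ih =>
    change (C.rename f g).den ρ η a ((M.rename f g).den ρ η) = _
    rw [ih, M.den_rename]
    rfl
  | fix C ih => exact congrArg leastfix (ih f g ρ η)
  | seq C M ih => exact Hom.seq_congr (ih f g ρ η) (M.den_rename f g ρ η)

/-- Strictness is the reason for the restricted grammar of contexts: the hole occurs only as the
function of an application or the first command of a sequence, never as an argument, and the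
remaining formers preserve `⊥`. -/
theorem den_bot {n : ℕ} {Γ : List Ty} {τ : Ty} (C : TCtx θ n Γ τ) (ρ : senv Loc n)
    (η : ienv Loc Γ) : C.den ρ η ⊥ = ⊥ := by
  induction C with
  | hole => rfl
  | lamV C ih => exact Fn.ext (funext fun v => ih _ _)
  | appV C E ih => exact congrArg (fun c : Fn _ _ => c (E.den ρ)) (ih ρ η)
  | lam C ih => exact Fn.ext (funext fun v => ih _ _)
  | app C M ih => exact congrArg (fun c : Fn _ _ => c (M.den ρ η)) (ih ρ η)
  | fix C ih => exact (congrArg leastfix (ih ρ η)).trans leastfix_bot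
  | seq C M ih =>
    exact Fn.ext (funext fun p => congrArg
      (fun c : comCpo Loc => c (p.1, (M.hom Loc).thenCont ((ρ, η), p.2))) (ih ρ η))

end TCtx

/-! ### Specification contexts as admissible relations on meanings of the hole -/

namespace SCtx

variable [Infinite Loc] {θ : Ty}

/-- Satisfaction for specification contexts, with a pair of meanings for the hole. -/
def Sat {n : ℕ} {Γ : List Ty} (ρ : senv Loc n) (η₀ η₁ : ienv Loc Γ) (r : World Loc)
    (a₀ a₁ : θ.den Loc) : SCtx θ n Γ → Prop
  | .triple P C Q => SemTriple (P.den ρ) (C.den ρ η₀ a₀) (C.den ρ η₁ a₁) (Q.den ρ) r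
  | .and γ δ => γ.Sat ρ η₀ η₁ r a₀ a₁ ∧ δ.Sat ρ η₀ η₁ r a₀ a₁
  | .allI τ γ => ∀ m₀ m₁ : τ.den Loc, γ.Sat ρ (consI m₀ η₀) (consI m₁ η₁) r a₀ a₁
  | .allV γ => ∀ v : Val Loc, γ.Sat (consV v ρ) η₀ η₁ r a₀ a₁

/-- This passes from syntax to semantics: the approximants `fⁱ(⊥)` of a fixed point need not be
denoted by terms, so Scott induction has to speak of arbitrary meanings of the hole. -/
theorem sat_fill {n : ℕ} {Γ : List Ty} (γ : SCtx θ n Γ) (N : Term n Γ θ) (ρ : senv Loc n)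
    (η₀ η₁ : ienv Loc Γ) (r : World Loc) :
    ParamSL.Sat ρ η₀ η₁ r (γ.fill N) ↔ γ.Sat ρ η₀ η₁ r (N.den ρ η₀) (N.den ρ η₁) := by
  induction γ with
  | triple P C Q => simp only [fill, sat_triple, SCtx.Sat, TCtx.den_fill]
  | and γ δ ihγ ihδ => simp only [fill, ParamSL.Sat, SCtx.Sat, ihγ, ihδ]
  | allI τ γ ih => simp only [fill, ParamSL.Sat, SCtx.Sat, ih, Term.den_wkI]
  | allV γ ih => simp only [fill, ParamSL.Sat, SCtx.Sat, ih, Term.den_wkV]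

theorem sat_rename {n m : ℕ} {Γ Γ' : List Ty} (f : Fin n → Fin m) (g : Ren Γ Γ')
    (γ : SCtx θ n Γ) (ρ : senv Loc m) (η₀ η₁ : ienv Loc Γ') (r : World Loc) (a₀ a₁ : θ.den Loc) :
    (γ.rename f g).Sat ρ η₀ η₁ r a₀ a₁ ↔
      γ.Sat (senv.ren f ρ) (ienv.ren g η₀) (ienv.ren g η₁) r a₀ a₁ := by
  induction γ generalizing m Γ' with
  | triple P C Q => simp only [rename, SCtx.Sat, TCtx.den_rename, Assertion.den_rename]
  | and γ δ ihγ ihδ => simp only [rename, SCtx.Sat, ihγ, ihδ]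
  | allI τ γ ih => simp only [rename, SCtx.Sat, ih, ienv.ren_lift]
  | allV γ ih => simp only [rename, SCtx.Sat, ih, senv.ren_liftV]

theorem sat_wkI {n : ℕ} {Γ : List Ty} {σ : Ty} (γ : SCtx θ n Γ) (m₀ m₁ : σ.den Loc)
    (ρ : senv Loc n) (η₀ η₁ : ienv Loc Γ) (r : World Loc) (a₀ a₁ : θ.den Loc) :
    γ.wkI.Sat ρ (consI m₀ η₀) (consI m₁ η₁) r a₀ a₁ ↔ γ.Sat ρ η₀ η₁ r a₀ a₁ :=
  sat_rename _ _ γ _ _ _ r a₀ a₁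

theorem sat_bot {n : ℕ} {Γ : List Ty} (γ : SCtx θ n Γ) (ρ : senv Loc n)
    (η₀ η₁ : ienv Loc Γ) (r : World Loc) : γ.Sat ρ η₀ η₁ r ⊥ ⊥ := by
  induction γ with
  | triple P C Q =>
    simp only [SCtx.Sat, TCtx.den_bot]
    exact semTriple_bot _ _ _
  | and γ δ ihγ ihδ => exact ⟨ihγ _ _ _, ihδ _ _ _⟩
  | allI τ γ ih => exact fun m₀ m₁ => ih _ _ _
  | allV γ ih => exact fun v => ih _ _ _

theorem sat_of_isLUB {a₀ a₁ : ℕ → θ.den Loc} {x₀ x₁ : θ.den Loc} (hm₀ : Monotone a₀)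
    (hm₁ : Monotone a₁) (hs₀ : FSeq Loc a₀) (hs₁ : FSeq Loc a₁) (h₀ : IsLUB (Set.range a₀) x₀)
    (h₁ : IsLUB (Set.range a₁) x₁) {n : ℕ} {Γ : List Ty} (γ : SCtx θ n Γ) (ρ : senv Loc n)
    (η₀ η₁ : ienv Loc Γ) (r : World Loc) (h : ∀ i, γ.Sat ρ η₀ η₁ r (a₀ i) (a₁ i)) :
    γ.Sat ρ η₀ η₁ r x₀ x₁ := by
  induction γ with
  | triple P C Q => exact SemTriple.of_isLUB hm₀ hm₁ hs₀ hs₁ h₀ h₁ h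
  | and γ δ ihγ ihδ => exact ⟨ihγ _ _ _ fun i => (h i).1, ihδ _ _ _ fun i => (h i).2⟩
  | allI τ γ ih => exact fun m₀ m₁ => ih _ _ _ fun i => h i m₀ m₁
  | allV γ ih => exact fun v => ih _ _ _ fun i => h i v

/-- Scott induction for specification contexts. -/
theorem sat_leastfix {n : ℕ} {Γ : List Ty} (γ : SCtx θ n Γ) (ρ : senv Loc n)
    (η₀ η₁ : ienv Loc Γ) (r : World Loc) (f₀ f₁ : Fn (θ.den Loc) (θ.den Loc))
    (h : ∀ a₀ a₁, γ.Sat ρ η₀ η₁ r a₀ a₁ → γ.Sat ρ η₀ η₁ r (f₀ a₀) (f₁ a₁)) :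
    γ.Sat ρ η₀ η₁ r (leastfix f₀) (leastfix f₁) := by
  refine sat_of_isLUB (f₀.monotone.monotone_iterate_of_le_map bot_le)
    (f₁.monotone.monotone_iterate_of_le_map bot_le) (fseq_iterate f₀) (fseq_iterate f₁)
    (leastfix_isLUB f₀) (leastfix_isLUB f₁) γ ρ η₀ η₁ r fun i => ?_
  induction i with
  | zero => exact γ.sat_bot ρ η₀ η₁ r
  | succ i ih =>
    rw [Function.iterate_succ_apply', Function.iterate_succ_apply']
    exact h _ _ ih

end SCtx

/-! ### Soundness -/

section

variable [Infinite Loc] {n : ℕ} {Γ : List Ty} {ρ : senv Loc n} {η₀ η₁ : ienv Loc Γ} {r : World Loc}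

/-- An implication speaks of all extensions `r * s`; the unit `World.emp` recovers the world `r`
itself. -/
theorem Sat.mp {φ ψ : Spec n Γ} (h : Sat ρ η₀ η₁ r (.imp φ ψ)) (hφ : Sat ρ η₀ η₁ r φ) :
    Sat ρ η₀ η₁ r ψ := by
  have := h World.emp
  rw [World.star_emp] at this
  exact this hφ

theorem sat_imp_of_forall {φ ψ : Spec n Γ} (h : ∀ r, Sat ρ η₀ η₁ r φ → Sat ρ η₀ η₁ r ψ) :
    Sat ρ η₀ η₁ r (.imp φ ψ) :=
  fun s => h (r.star s)

theorem sat_iff_of_forall {φ ψ : Spec n Γ} (h : ∀ r, Sat ρ η₀ η₁ r φ ↔ Sat ρ η₀ η₁ r ψ) :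
    Sat ρ η₀ η₁ r (.iff φ ψ) :=
  ⟨sat_imp_of_forall fun r => (h r).1, sat_imp_of_forall fun r => (h r).2⟩

theorem sat_inv_imp {φ ψ : Spec n Γ} {P : Assertion n} :
    Sat ρ η₀ η₁ r (.inv (.imp φ ψ) P) ↔ Sat ρ η₀ η₁ r (.imp (.inv φ P) (.inv ψ P)) := by
  simp only [Sat, World.star_right_comm r (World.eq P ρ)]

end

/-- Soundness of derivability from hypotheses. -/
theorem Provable.sat [Infinite Loc] {n : ℕ} {Γ : List Ty} {Φ : List (Spec n Γ)} {φ : Spec n Γ}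
    (h : Provable Loc Φ φ) (ρ : senv Loc n) (η₀ η₁ : ienv Loc Γ) (r : World Loc)
    (hΦ : ∀ ψ ∈ Φ, Sat ρ η₀ η₁ r ψ) : Sat ρ η₀ η₁ r φ := by
  -- The contexts are indices of `Provable`, so the environments are generalized as well; rules with
  -- binders extend them, and the introduction of implications extends the world.
  induction h generalizing r with
  | hyp h => exact hΦ _ h
  | andI _ _ ih ih' => exact ⟨ih _ _ _ _ hΦ, ih' _ _ _ _ hΦ⟩
  | andE₁ _ ih => exact (ih _ _ _ _ hΦ).1
  | andE₂ _ ih => exact (ih _ _ _ _ hΦ).2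
  | orI₁ _ ih => exact Or.inl (ih _ _ _ _ hΦ)
  | orI₂ _ ih => exact Or.inr (ih _ _ _ _ hΦ)
  | orE _ _ _ ih ih₁ ih₂ =>
    rcases ih _ _ _ _ hΦ with h | h
    · exact ih₁ _ _ _ _ (List.forall_mem_cons.2 ⟨h, hΦ⟩)
    · exact ih₂ _ _ _ _ (List.forall_mem_cons.2 ⟨h, hΦ⟩)
  | impI _ ih =>
    -- The remaining hypotheses are known at `r` only and are carried to `r * s` by persistence.
    exact fun s hs => ih _ _ _ _ (List.forall_mem_cons.2 ⟨hs, fun ψ hψ => (hΦ ψ hψ).star s⟩)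
  | impE _ _ ih ih' => exact (ih _ _ _ _ hΦ).mp (ih' _ _ _ _ hΦ)
  | exFalso _ ih =>
    have h : (Val.int 0 : Val Loc) = .int 1 := ih _ _ _ _ hΦ
    simp at h
  | allVI _ ih =>
    exact fun v => ih _ _ _ _ (List.forall_mem_map.2 fun ψ hψ => (sat_wkV ..).2 (hΦ ψ hψ))
  | allVE E _ ih => exact (sat_instV ..).2 (ih _ _ _ _ hΦ _)
  | exVI E _ ih => exact ⟨_, (sat_instV ..).1 (ih _ _ _ _ hΦ)⟩
  | exVE _ _ ih ih' =>
    obtain ⟨v, hv⟩ := ih _ _ _ _ hΦ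
    exact (sat_wkV ..).1 (ih' (consV v ρ) _ _ _ (List.forall_mem_cons.2
      ⟨hv, List.forall_mem_map.2 fun ψ hψ => (sat_wkV ..).2 (hΦ ψ hψ)⟩))
  | allII _ ih =>
    exact fun m₀ m₁ => ih _ _ _ _ (List.forall_mem_map.2 fun ψ hψ => (sat_wkI ..).2 (hΦ ψ hψ))
  | allIE M _ ih => exact (sat_instI ..).2 (ih _ _ _ _ hΦ _ _)
  | exII M _ ih => exact ⟨_, _, (sat_instI ..).1 (ih _ _ _ _ hΦ)⟩
  | exIE _ _ ih ih' =>
    obtain ⟨m₀, m₁, hm⟩ := ih _ _ _ _ hΦ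
    exact (sat_wkI ..).1 (ih' ρ (consI m₀ η₀) (consI m₁ η₁) _ (List.forall_mem_cons.2
      ⟨hm, List.forall_mem_map.2 fun ψ hψ => (sat_wkI ..).2 (hΦ ψ hψ)⟩))
  | reflE E => exact rfl
  | substE φ _ _ ih ih' =>
    have e : Expr.den _ ρ = Expr.den _ ρ := ih ρ η₀ η₁ r hΦ
    rw [sat_instV, ← e]
    exact (sat_instV ..).1 (ih' _ _ _ _ hΦ)
  | reflT M => exact ⟨rfl, rfl⟩
  | substT φ _ _ ih ih' =>
    have e := ih ρ η₀ η₁ r hΦ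
    simp only [Sat] at e
    rw [sat_instI, ← e.1, ← e.2]
    exact (sat_instI ..).1 (ih' _ _ _ _ hΦ)
  | betaV M E => exact ⟨(M.den_instV E ρ η₀).symm, (M.den_instV E ρ η₁).symm⟩
  | betaI M N => exact ⟨(M.den_instI N ρ η₀).symm, (M.den_instI N ρ η₁).symm⟩
  | etaV M =>
    have e : ∀ η, (Term.lamV (.appV M.wkV (.var 0))).den ρ η = M.den ρ η := fun η =>
      Fn.ext (funext fun v => by
        change M.wkV.den (consV v ρ) η v = M.den ρ η v
        rw [Term.den_wkV])
    exact ⟨e η₀, e η₁⟩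
  | etaI M =>
    have e : ∀ η, (Term.lam (.app M.wkI (.var .zero))).den ρ η = M.den ρ η := fun η =>
      Fn.ext (funext fun m => by
        change M.wkI.den ρ (consI m η) m = M.den ρ η m
        rw [Term.den_wkI])
    exact ⟨e η₀, e η₁⟩
  | xiV M N =>
    exact sat_imp_of_forall fun r h => ⟨Fn.ext (funext fun v => (h v).1),
      Fn.ext (funext fun v => (h v).2)⟩
  | xiI M N =>
    -- Diagonal pairs suffice: each of the two equations involves only one component of the pair.
    exact sat_imp_of_forall fun r h => ⟨Fn.ext (funext fun m => (h m m).1),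
      Fn.ext (funext fun m => (h m m).2)⟩
  | unfold M => exact ⟨(map_leastfix _).symm, (map_leastfix _).symm⟩
  | existsRule P Q M =>
    refine sat_imp_of_forall fun r h => sat_triple.2 (SemTriple.of_pre fun p hp => ?_)
    -- The witness depends on the heap `p`, but `p` is shared by the two sides, so a single instance
    -- of the premise applies.
    obtain ⟨v, hv⟩ := hp
    have h := sat_triple.1 (h v)
    rw [Term.den_wkV, Term.den_wkV] at h
    exact h.mono (Set.singleton_subset_iff.2 hv) fun q hq => ⟨v, hq⟩
  | disjRule P P' Q Q' M =>
    refine sat_imp_of_forall fun r h => sat_triple.2 (SemTriple.of_pre fun p hp => ?_)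
    rcases Assertion.mem_den_or.1 hp with hp | hp
    · exact (sat_triple.1 h.1).mono (Set.singleton_subset_iff.2 hp)
        fun q hq => Assertion.mem_den_or.2 (Or.inl hq)
    · exact (sat_triple.1 h.2).mono (Set.singleton_subset_iff.2 hp)
        fun q hq => Assertion.mem_den_or.2 (Or.inr hq)
  | iteRule P Q E F M N =>
    refine sat_imp_of_forall fun r h => sat_triple.2 ?_
    rw [den_ite, den_ite]
    -- The test depends only on the common stack `ρ`, so both sides take the same branch.
    split_ifs with e
    · exact (sat_triple.1 h.1).mono (fun p hp => ⟨hp, e⟩) subset_rfl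
    · exact (sat_triple.1 h.2).mono (fun p hp => ⟨hp, e⟩) subset_rfl
  | seqRule P P₀ Q M N =>
    exact sat_imp_of_forall fun r h =>
      sat_triple.2 (semTriple_seq (sat_triple.1 h.1) (sat_triple.1 h.2))
  | newRule P Q M =>
    refine sat_imp_of_forall fun r h => sat_triple.2 (semTriple_new fun l => ?_)
    refine (sat_triple.1 (h (.loc l))).mono ?_ (Assertion.den_wk ..).subset
    rintro _ ⟨p, hp, hd, rfl⟩
    exact ⟨p, (P.den_wk _ _).symm.subset hp, _, ⟨l, rfl, rfl⟩, hd, rfl⟩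
  | lookupRule f P Q E W M =>
    refine sat_imp_of_forall fun r h => sat_triple.2 (SemTriple.of_pre fun p hp => ?_)
    obtain ⟨v, hv⟩ := hp
    have h := (sat_triple.1 (h v)).mono (Set.singleton_subset_iff.2 hv) (Q.den_wk v ρ).subset
    obtain ⟨q, hq, c, hc, hd, rfl⟩ := hv
    obtain ⟨l, hl, rfl⟩ := Assertion.mem_den_field.1 hc
    rw [Expr.den_wk] at hl
    refine semTriple_lookup hl
      (by rw [Heap.union_comm hd]; exact Heap.single_union_self _ _ _) ?_
    -- The value read is exactly the existential witness `v`, so the premise at `v` is the one about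
    -- the body as it is run.
    rw [Fld.get_set]
    exact h
  | freeRule E =>
    refine sat_triple.2 (SemTriple.of_pre fun p hp => ?_)
    obtain ⟨v, w, l, hl, rfl⟩ := hp
    rw [Expr.den_wk, Expr.den_wk] at hl
    exact semTriple_free hl _
  | assignRule f E F W =>
    refine sat_triple.2 (SemTriple.of_pre fun p hp => ?_)
    obtain ⟨v, hv⟩ := hp
    obtain ⟨l, hl, rfl⟩ := Assertion.mem_den_field.1 hv
    rw [Expr.den_wk] at hl
    refine (semTriple_assign hl _).mono subset_rfl (Set.singleton_subset_iff.2 ?_)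
    -- The second write to the field erases the unknown old content `v`.
    rw [Fld.set_set, Expr.den_wk]
    exact Assertion.mem_den_field.2 ⟨l, hl, rfl⟩
  | consequence P P' Q Q' M hP hQ =>
    exact sat_imp_of_forall fun r h => sat_triple.2 ((sat_triple.1 h).mono (hP ρ) (hQ ρ))
  | invIntro φ P => exact sat_imp_of_forall fun r h => h.star _
  | invTriple P P' Q M =>
    refine sat_iff_of_forall fun r => ?_
    simp only [Sat, World.eq_star]
    rw [World.star_comm r, World.star_assoc, World.star_assoc]
  | invEqE E F Q => exact sat_iff_of_forall fun r => Iff.rfl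
  | invEqT M N Q => exact sat_iff_of_forall fun r => Iff.rfl
  | invInv φ P Q =>
    refine sat_iff_of_forall fun r => ?_
    simp only [Sat, World.eq_star]
    -- The outer invariant `Q` enters the world before `P`, hence the exchange.
    rw [World.star_assoc, World.star_comm (World.eq Q ρ)]
  | invImp φ ψ P => exact sat_iff_of_forall fun r => sat_inv_imp
  | invAnd φ ψ P => exact sat_iff_of_forall fun r => Iff.rfl
  | invOr φ ψ P => exact sat_iff_of_forall fun r => Iff.rfl
  | invAllI τ φ P => exact sat_iff_of_forall fun r => Iff.rfl
  | invExI τ φ P => exact sat_iff_of_forall fun r => Iff.rfl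
  | invAllV φ P | invExV φ P =>
    refine sat_iff_of_forall fun r => ?_
    simp only [Sat, World.eq_congr (P.den_wk _ ρ)]
  | fixInd γ M =>
    refine sat_imp_of_forall fun r h => (γ.sat_fill _ ρ η₀ η₁ r).2 ?_
    refine γ.sat_leastfix ρ η₀ η₁ r _ _ fun a₀ a₁ ha => ?_
    -- The premise is instantiated with the pair `a₀, a₁` as meanings of `x`; as `γ` and `M` are
    -- weakened, they do not see this extension of the environments.
    have h := (h a₀ a₁).mp ((SCtx.sat_fill ..).2 ((γ.sat_wkI ..).2 ha))
    have h := (γ.sat_wkI ..).1 ((SCtx.sat_fill ..).1 h)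
    rwa [den_app, den_app, Term.den_wkI, Term.den_wkI] at h

end ParamSL

end

theorem mainTheorem2 (Loc : Type) [Countable Loc] [Infinite Loc] (n : ℕ) (Γ : List ParamSL.Ty)
    (φ : ParamSL.Spec n Γ) (hφ : ParamSL.Provable Loc [] φ)
    (ρ : ParamSL.senv Loc n) (η₀ η₁ : ParamSL.ienv Loc Γ) (r : ParamSL.World Loc) :
    ParamSL.Sat ρ η₀ η₁ r φ := by
  exact hφ.sat ρ η₀ η₁ r (List.forall_mem_nil _)
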